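/- Let $p\ge 1$. There is a constant $C_5>0$ depending only on $p$, and for all $K\ge 0$, $b,r,g\in\mathbb R$ and $\alpha,\beta,\kappa>0$ there is a constant $M>0$ depending only on $p,K,b,r,g,\alpha,\beta,\kappa$, such that the following holds. Let $d\ge1$, $L>0$, $\lambda\ge 0$, and let $f:\mathbb R^d\to\mathbb R$ be $C^2$ with $\|\nabla f(x)-\nabla f(y)\|\le L\|x-y\|$, $\|\nabla^2 f(x)-\nabla^2 f(y)\|\le L\|x-y\|$ (operator norm), $\langle\nabla f(x)-\nabla f(y),x-y\rangle\ge-\lambda\|x-y\|^2$ and $\langle x,\nabla f(x)\rangle\ge\alpha\|x\|^2-\beta$ for all $x,y$, and $\|\nabla f(0)\|\le g$. Let $\varphi:\mathbb R^d\to\mathbb R$ be $K$-Lipschitz with $|\varphi(0)|\le b$. Let $S>\lambda/2$ with $1/\kappa\le S\le\kappa(L+\sqrt d)^2$. Let $T,h>0$ with $T=2Nh$, $N\in\mathbb N$, let $X_0$ be a random vector with $\|X_0\|\le r$ almost surely, and let $\Delta W_0,\Delta W_1,\dots$ be independent $\mathcal N(0,hI_d)$ vectors (Brownian increments), independent of $X_0$,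 on a probability space with measure $P$. Put $\hat Y^f_0=\hat Y^c_0=X_0$ and, for $n\ge0$, $$\hat Y^f_{n+1}=\hat Y^f_n+S(\hat Y^c_n-\hat Y^f_n)h-\nabla f(\hat Y^f_n)h+\sqrt2\,\Delta W_n,$$ $$\hat Y^c_{2n+1}=\hat Y^c_{2n}+S(\hat Y^f_{2n}-\hat Y^c_{2n})h-\nabla f(\hat Y^c_{2n})h+\sqrt2\,\Delta W_{2n},\qquad \hat Y^c_{2n+2}=\hat Y^c_{2n+1}+S(\hat Y^f_{2n}-\hat Y^c_{2n})h-\nabla f(\hat Y^c_{2n})h+\sqrt2\,\Delta W_{2n+1}.$$ With $\rho(\cdot\,|\,\mu,\Sigma)$ the density of $\mathcal N(\mu,\Sigma)$ let $$R(y',y,s,h)=\frac{\rho(y'\,|\,y-\nabla f(y)h,\,2hI_d)}{\rho(y'\,|\,y+sh-\nabla f(y)h,\,2hI_d)},$$ and define the Radon–Nikodym weights $$\frac{d\hat Q^f}{dP}=\prod_{n=0}^{2N-1}R\big(\hat Y^f_{n+1},\hat Y^f_n,S(\hat Y^c_n-\hat Y^f_n),h\big),\qquad \frac{d\hat Q^c}{dP}=\prod_{n=0}^{N-1}R\big(\hat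 Y^c_{2n+2},\hat Y^c_{2n},S(\hat Y^f_{2n}-\hat Y^c_{2n}),2h\big).$$ If $0<h\le h_{(4)}$, where $$h_{(4)}=C_5\min\Big\{\frac1S,\ \frac{\alpha}{S^2},\ \frac{\alpha}{L^2},\ \frac{\alpha}{2S-\lambda},\ \frac{\min\{1,\alpha\}}{\|\nabla f(0)\|^2},\ \frac{(2S-\lambda)^2}{T\,S^2L^2d},\ \frac{2S-\lambda}{\sqrt T\,S(L^2+L\sqrt d)}\Big\}$$ (the fifth entry being $+\infty$ if $\nabla f(0)=0$), then $$\mathbb E\left[\left|\varphi(\hat Y^f_{2N})\frac{d\hat Q^f}{dP}-\varphi(\hat Y^c_{2N})\frac{d\hat Q^c}{dP}\right|^p\right]^{1/p}\le M\,\sqrt T\,\frac{SLd(L+\sqrt d)}{2S-\lambda}\,h .$$ -/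

import Mathlib

open MeasureTheory ProbabilityTheory
open scoped Gradient NNReal ENNReal

noncomputable section

/-- `f` is differentiable and its gradient is `L`-Lipschitz. -/
def LSmooth {d : ℕ} (f : EuclideanSpace ℝ (Fin d) → ℝ) (L : ℝ) : Prop :=
  Differentiable ℝ f ∧ ∀ x y, ‖∇ f x - ∇ f y‖ ≤ L * ‖x - y‖

/-- `f` is twice continuously differentiable and its Hessian (the derivative of the gradient, with
the operator norm) is `L`-Lipschitz. -/
def LHessianSmooth {d : ℕ} (f : EuclideanSpace ℝ (Fin d) → ℝ) (L : ℝ) : Prop :=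
  ContDiff ℝ 2 f ∧ ∀ x y, ‖fderiv ℝ (∇ f) x - fderiv ℝ (∇ f) y‖ ≤ L * ‖x - y‖

/-- Weaker one-sided Lipschitz condition with parameter `lam`. -/
def WeakOneSidedLipschitz {d : ℕ} (f : EuclideanSpace ℝ (Fin d) → ℝ) (lam : ℝ) : Prop :=
  ∀ x y, -lam * ‖x - y‖ ^ 2 ≤ inner ℝ (∇ f x - ∇ f y) (x - y)

/-- Dissipativity with constants `α`, `β`. -/
def Dissipative {d : ℕ} (f : EuclideanSpace ℝ (Fin d) → ℝ) (α β : ℝ) : Prop :=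
  ∀ x, α * ‖x‖ ^ 2 - β ≤ inner ℝ x (∇ f x)

/-- The pair (fine, coarse) at time `2n+1` from the pair `y` at time `2n` and the increment `w`. -/
def oddStep {d : ℕ} (f : EuclideanSpace ℝ (Fin d) → ℝ) (S h : ℝ)
    (y : EuclideanSpace ℝ (Fin d) × EuclideanSpace ℝ (Fin d)) (w : EuclideanSpace ℝ (Fin d)) :
    EuclideanSpace ℝ (Fin d) × EuclideanSpace ℝ (Fin d) :=
  (y.1 + h • S • (y.2 - y.1) - h • ∇ f y.1 + √2 • w,
   y.2 + h • S • (y.1 - y.2) - h • ∇ f y.2 + √2 • w)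

/-- The pair (fine, coarse) at time `2n+2` from the pairs `y₀` at time `2n`, `y₁` at time `2n+1`
and the increment `w`: spring and drift of the coarse path are still evaluated at time `2n`. -/
def evenStep {d : ℕ} (f : EuclideanSpace ℝ (Fin d) → ℝ) (S h : ℝ)
    (y₀ y₁ : EuclideanSpace ℝ (Fin d) × EuclideanSpace ℝ (Fin d))
    (w : EuclideanSpace ℝ (Fin d)) :
    EuclideanSpace ℝ (Fin d) × EuclideanSpace ℝ (Fin d) :=
  (y₁.1 + h • S • (y₁.2 - y₁.1) - h • ∇ f y₁.1 + √2 • w,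
   y₁.2 + h • S • (y₀.1 - y₀.2) - h • ∇ f y₀.2 + √2 • w)

/-- The pair (fine, coarse) at time `2n`, started at `(x₀, x₀)` and driven by the increments
`w 0, w 1, …`. -/
def evenPath {d : ℕ} (f : EuclideanSpace ℝ (Fin d) → ℝ) (S h : ℝ)
    (x₀ : EuclideanSpace ℝ (Fin d)) (w : ℕ → EuclideanSpace ℝ (Fin d)) :
    ℕ → EuclideanSpace ℝ (Fin d) × EuclideanSpace ℝ (Fin d)
  | 0 => (x₀, x₀)
  | n + 1 =>
      evenStep f S h (evenPath f S h x₀ w n)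
        (oddStep f S h (evenPath f S h x₀ w n) (w (2 * n))) (w (2 * n + 1))

/-- The pair (fine, coarse) at an arbitrary time `n`. -/
def coupledPath {d : ℕ} (f : EuclideanSpace ℝ (Fin d) → ℝ) (S h : ℝ)
    (x₀ : EuclideanSpace ℝ (Fin d)) (w : ℕ → EuclideanSpace ℝ (Fin d)) (n : ℕ) :
    EuclideanSpace ℝ (Fin d) × EuclideanSpace ℝ (Fin d) :=
  if n % 2 = 0 then evenPath f S h x₀ w (n / 2)
  else oddStep f S h (evenPath f S h x₀ w (n / 2)) (w (2 * (n / 2)))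

/-- The fine path `Ŷᶠ_n`. -/
def fineY {d : ℕ} (f : EuclideanSpace ℝ (Fin d) → ℝ) (S h : ℝ)
    (x₀ : EuclideanSpace ℝ (Fin d)) (w : ℕ → EuclideanSpace ℝ (Fin d)) (n : ℕ) :
    EuclideanSpace ℝ (Fin d) :=
  (coupledPath f S h x₀ w n).1

/-- The coarse path `Ŷᶜ_n`. -/
def coarseY {d : ℕ} (f : EuclideanSpace ℝ (Fin d) → ℝ) (S h : ℝ)
    (x₀ : EuclideanSpace ℝ (Fin d)) (w : ℕ → EuclideanSpace ℝ (Fin d)) (n : ℕ) :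
    EuclideanSpace ℝ (Fin d) :=
  (coupledPath f S h x₀ w n).2

/-- Density at `x` of the normal law with mean `m` and covariance `v` times the identity. -/
def gaussDensity {d : ℕ} (m : EuclideanSpace ℝ (Fin d)) (v : ℝ) (x : EuclideanSpace ℝ (Fin d)) :
    ℝ :=
  (2 * Real.pi * v) ^ (-((d : ℝ) / 2)) * Real.exp (-‖x - m‖ ^ 2 / (2 * v))

/-- One-step Radon-Nikodym weight: the transition density (from `y` to `y'`, time step `h`) without
the spring term `s`, divided by the transition density with it. -/
def stepWeight {d : ℕ} (f : EuclideanSpace ℝ (Fin d) → ℝ) (y' y s : EuclideanSpace ℝ (Fin d))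
    (h : ℝ) : ℝ :=
  gaussDensity (y - h • ∇ f y) (2 * h) y' / gaussDensity (y + h • s - h • ∇ f y) (2 * h) y'

theorem stepWeight_eq {d : ℕ} (f : EuclideanSpace ℝ (Fin d) → ℝ)
    (y' y s : EuclideanSpace ℝ (Fin d)) {h : ℝ} (hh : 0 < h) :
    stepWeight f y' y s h =
      Real.exp (-(1 / 2) * inner ℝ (y' - y + h • ∇ f y) s + 1 / 4 * ‖s‖ ^ 2 * h) := by
  have hc : (2 * Real.pi * (2 * h)) ^ (-((d : ℝ) / 2)) ≠ 0 :=
    (Real.rpow_pos_of_pos (by positivity) _).ne'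
  unfold stepWeight gaussDensity
  rw [mul_div_mul_left _ _ hc, ← Real.exp_sub]
  congr 1
  have e1 : y' - (y - h • ∇ f y) = y' - y + h • ∇ f y := by abel
  have e2 : y' - (y + h • s - h • ∇ f y) = (y' - y + h • ∇ f y) - h • s := by abel
  rw [e1, e2, norm_sub_sq_real, norm_smul, inner_smul_right, Real.norm_of_nonneg hh.le]
  field_simp
  ring

/-- The accumulated weight of the fine path after `2N` fine steps. -/
def fineWeight {d : ℕ} (f : EuclideanSpace ℝ (Fin d) → ℝ) (S h : ℝ)
    (x₀ : EuclideanSpace ℝ (Fin d)) (w : ℕ → EuclideanSpace ℝ (Fin d)) (N : ℕ) : ℝ :=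
  ∏ n ∈ Finset.range (2 * N),
    stepWeight f (fineY f S h x₀ w (n + 1)) (fineY f S h x₀ w n)
      (S • (coarseY f S h x₀ w n - fineY f S h x₀ w n)) h

/-- The accumulated weight of the coarse path after `N` coarse steps. -/
def coarseWeight {d : ℕ} (f : EuclideanSpace ℝ (Fin d) → ℝ) (S h : ℝ)
    (x₀ : EuclideanSpace ℝ (Fin d)) (w : ℕ → EuclideanSpace ℝ (Fin d)) (N : ℕ) : ℝ :=
  ∏ n ∈ Finset.range N,
    stepWeight f (coarseY f S h x₀ w (2 * n + 2)) (coarseY f S h x₀ w (2 * n))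
      (S • (fineY f S h x₀ w (2 * n) - coarseY f S h x₀ w (2 * n))) (2 * h)

/-- The multilevel correction `φ(Ŷᶠ_{2N}) dQ̂ᶠ/dP - φ(Ŷᶜ_{2N}) dQ̂ᶜ/dP`. -/
def levelDifference {d : ℕ} (f φ : EuclideanSpace ℝ (Fin d) → ℝ) (S h : ℝ)
    (x₀ : EuclideanSpace ℝ (Fin d)) (w : ℕ → EuclideanSpace ℝ (Fin d)) (N : ℕ) : ℝ :=
  φ (fineY f S h x₀ w (2 * N)) * fineWeight f S h x₀ w N
    - φ (coarseY f S h x₀ w (2 * N)) * coarseWeight f S h x₀ w N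

/-- `ΔW` is a sequence of independent increments of a standard `d`-dimensional Brownian motion over
time steps of length `h`, independent of the initial value `X₀`. -/
structure BrownianIncrements {d : ℕ} {Ω : Type*} [MeasurableSpace Ω] (P : Measure Ω) (h : ℝ)
    (X₀ : Ω → EuclideanSpace ℝ (Fin d)) (ΔW : ℕ → Ω → EuclideanSpace ℝ (Fin d)) : Prop where
  law : ∀ n, HasLaw (ΔW n)
    (multivariateGaussian 0 (h • (1 : Matrix (Fin d) (Fin d) ℝ))) P
  indep : iIndepFun ΔW P
  indep_init : IndepFun X₀ (fun ω n => ΔW n ω) P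

/-- The step size restriction `h ≤ C · min {…}`, one conjunct for each entry of the minimum; `G`
stands for `‖∇ f 0‖`, and its conjunct is cleared of the denominator, which may vanish. -/
def StepAdmissible (C S lam L α G T : ℝ) (d : ℕ) (h : ℝ) : Prop :=
  h ≤ C * (1 / S) ∧
  h ≤ C * (α / S ^ 2) ∧
  h ≤ C * (α / L ^ 2) ∧
  h ≤ C * (α / (2 * S - lam)) ∧
  h * G ^ 2 ≤ C * min 1 α ∧
  h ≤ C * ((2 * S - lam) ^ 2 / (T * S ^ 2 * L ^ 2 * d)) ∧
  h ≤ C * ((2 * S - lam) / (√T * S * (L ^ 2 + L * √d)))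

end

/-! Write F = ∇f, m = 2S − λ, and let a, c be the fine and coarse values at an even time. Both paths
use the same increments, so the noise cancels in their gap after one fine step. After two fine steps
the only noise left in the gap is h(F(A + √2x) − F(A)), where x is the first increment and A the
noise-free part of the fine path after one step. Its part odd in x has size hL‖x‖, of order h^(3/2),
and is a symmetric increment, so that such terms add up in quadrature over time. Its part even in x
is a second difference of F, which the Lipschitz Hessian bounds by a multiple of hL‖x‖², of order
h². The springs and the one-sided Lipschitz condition contract the gap by 1 − hm/4 per coarse step,
up to a perturbation 5h²L² whose accumulated effect up to time T is kept below a factor 3 by the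
step restriction. Hence all moments of the gap are O(h): `gapMean_le`, `gap_recursion`,
`gap_sum_bound`, `eLpNorm_gap_le_uniform`, `eLpNorm_gap_le_terminal`.

The recursion is fed by F along the fine path, so moments of the paths uniform in time are needed.
The function ‖a‖² + ‖c‖² is a Lyapunov function: dissipativity provides the decay, and the leading
spring terms of the two paths combine to −4hS‖a − c‖². Gaussian integration turns this into an
exponential moment with rate of order α/d (`lyapunov_le`, `lintegral_exp_path_le`).

Each weight is a discrete exponential martingale. Its integrands are multiples of the gap, or of the
gap after one fine step, and are known at the beginning of the coarse step. Both log-weights are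
therefore O(h) separately, and no cancellation between them is used. Moments of the weights follow
as in Novikov's criterion from an exponential moment of hS² ∑ ‖gap‖²; pathwise, this sum is at most
a time average of quantities with exponential moments (`sum_gap_sq_le`,
`lintegral_exp_mul_logWeight_le`).

Burkholder-type inequalities are replaced by a reflection. Changing the sign of all increments from
some time on preserves their law, fixes the past A and negates the new term X; this yields ‖A + X‖²
≤ ‖A‖² + C‖X‖² for the norms of L^(2k) (`eLpNorm_add_le_of_symm`).

Finally φ(a)eˣ − φ(c)eʸ = (φ(a) − φ(c))eˣ + φ(c)(eˣ − eʸ), and Hölder's inequality combines the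
bounds (`eLpNorm_levelDifference_le`). They are uniform over initial values in the ball of radius r,
so Fubini's theorem covers a random one. -/

/-! ### The drift -/

/-- The properties of the drift `F = ∇ f` that the analysis uses. -/
structure DriftBounds {V : Type*} [NormedAddCommGroup V] [InnerProductSpace ℝ V] (F : V → V)
    (L lam α β G : ℝ) : Prop where
  lip : ∀ x y, ‖F x - F y‖ ≤ L * ‖x - y‖
  second : ∀ y u, ‖F (y + u) + F (y - u) - (2 : ℝ) • F y‖ ≤ 2 * L * ‖u‖ ^ 2
  oneSided : ∀ x y, -lam * ‖x - y‖ ^ 2 ≤ inner ℝ (F x - F y) (x - y)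
  dissip : ∀ x, α * ‖x‖ ^ 2 - β ≤ inner ℝ x (F x)
  zero : ‖F 0‖ ≤ G

/-- The consequences of the step size restriction for a single step. -/
structure SmallStep (ε S L α G h : ℝ) : Prop where
  h_pos : 0 < h
  S_pos : 0 < S
  L_pos : 0 < L
  α_pos : 0 < α
  G_nonneg : 0 ≤ G
  α_le : α ≤ L
  hS : S * h ≤ ε
  hS2 : h * S ^ 2 ≤ ε * α
  hL2 : h * L ^ 2 ≤ ε * α
  hG2 : h * G ^ 2 ≤ ε

namespace SmallStep

variable {ε S L α G h : ℝ}

/-- Since α ≤ L, one factor L cancels in h L² ≤ ε α ≤ ε L. -/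
theorem hL (H : SmallStep ε S L α G h) (hε : 0 ≤ ε) : h * L ≤ ε := by
  have h1 := H.hL2
  have h2 : ε * α ≤ ε * L := mul_le_mul_of_nonneg_left H.α_le hε
  have h3 : (h * L) * L ≤ ε * L := by nlinarith
  exact le_of_mul_le_mul_right h3 H.L_pos

theorem hα (H : SmallStep ε S L α G h) (hε : 0 ≤ ε) : α * h ≤ ε := by
  have := H.hL hε
  nlinarith [mul_le_mul_of_nonneg_left H.α_le H.h_pos.le]

theorem mono {ε' : ℝ} (H : SmallStep ε S L α G h) (hε : ε ≤ ε') : SmallStep ε' S L α G h :=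
  ⟨H.h_pos, H.S_pos, H.L_pos, H.α_pos, H.G_nonneg, H.α_le, H.hS.trans hε,
    H.hS2.trans (mul_le_mul_of_nonneg_right hε H.α_pos.le),
    H.hL2.trans (mul_le_mul_of_nonneg_right hε H.α_pos.le), H.hG2.trans hε⟩

end SmallStep

theorem norm_sub_sq_le_two_mul {V : Type*} [NormedAddCommGroup V] (a c : V) :
    ‖a - c‖ ^ 2 ≤ 2 * (‖a‖ ^ 2 + ‖c‖ ^ 2) := by
  have := norm_sub_le a c
  nlinarith [norm_nonneg (a - c), sq_nonneg (‖a‖ - ‖c‖)]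

theorem norm_add_sq_le_two_mul {V : Type*} [NormedAddCommGroup V] (a c : V) :
    ‖a + c‖ ^ 2 ≤ 2 * (‖a‖ ^ 2 + ‖c‖ ^ 2) := by
  have := norm_add_le a c
  nlinarith [norm_nonneg (a + c), sq_nonneg (‖a‖ - ‖c‖)]

section Deterministic

variable {V : Type*} [NormedAddCommGroup V] [InnerProductSpace ℝ V]

/-- Mean of the fine path after one step. -/
def fineMean (F : V → V) (S h : ℝ) (a c : V) : V := a - h • (S • (a - c) + F a)

/-- Mean of the coarse path after two steps. -/
def coarseMean (F : V → V) (S h : ℝ) (a c : V) : V := c - (2 * h) • (-S • (a - c) + F c)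

/-- Gap between the fine and the coarse path after one step. -/
def midGap (F : V → V) (S h : ℝ) (a c : V) : V :=
  (a - c) - (2 * S * h) • (a - c) - h • (F a - F c)

/-- The part of the gap after two steps that does not depend on the noise. -/
def gapMean (F : V → V) (S h : ℝ) (a c : V) : V :=
  (1 - 4 * S * h + 2 * S ^ 2 * h ^ 2) • (a - c) - ((2 - S * h) * h) • (F a - F c)
    - h • (F (fineMean F S h a c) - F a)

theorem norm_sub_smul_add_sq (a s g : V) (h : ℝ) :
    ‖a - h • (s + g)‖ ^ 2
      ≤ ‖a‖ ^ 2 - 2 * h * inner ℝ a s - 2 * h * inner ℝ a g + 2 * h ^ 2 * ‖s‖ ^ 2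
        + 2 * h ^ 2 * ‖g‖ ^ 2 := by
  have h2 : ‖s + g‖ ^ 2 ≤ 2 * ‖s‖ ^ 2 + 2 * ‖g‖ ^ 2 := by
    have := norm_add_le s g
    have h0 := norm_nonneg (s + g)
    nlinarith [sq_nonneg (‖s‖ - ‖g‖)]
  have h3 : ‖h • (s + g)‖ ^ 2 = h ^ 2 * ‖s + g‖ ^ 2 := by
    rw [norm_smul, mul_pow, Real.norm_eq_abs, sq_abs]
  rw [norm_sub_sq_real, h3, inner_smul_right, inner_add_right]
  nlinarith [mul_le_mul_of_nonneg_left h2 (sq_nonneg h)]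

namespace DriftBounds

variable {F : V → V} {L lam α β G : ℝ}

theorem norm_le (hF : DriftBounds F L lam α β G) (x : V) : ‖F x‖ ≤ L * ‖x‖ + G := by
  have h1 := hF.lip x 0
  have h2 : ‖F x‖ ≤ ‖F x - F 0‖ + ‖F 0‖ := by simpa using norm_add_le (F x - F 0) (F 0)
  rw [sub_zero] at h1
  linarith [hF.zero]

theorem norm_sq_le (hF : DriftBounds F L lam α β G) (x : V) :
    ‖F x‖ ^ 2 ≤ 2 * L ^ 2 * ‖x‖ ^ 2 + 2 * G ^ 2 := by
  have h1 := hF.norm_le x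
  have h2 := norm_nonneg (F x)
  nlinarith [sq_nonneg (L * ‖x‖ - G)]

/-- Dissipation of a drift step with an additional force `s`. -/
theorem dissipative_step (hF : DriftBounds F L lam α β G) (a s : V) {h : ℝ} (hh : 0 ≤ h) :
    ‖a - h • (s + F a)‖ ^ 2
      ≤ (1 - 2 * α * h + 4 * h ^ 2 * L ^ 2) * ‖a‖ ^ 2 + 2 * h * β + 4 * h ^ 2 * G ^ 2
        - 2 * h * inner ℝ a s + 2 * h ^ 2 * ‖s‖ ^ 2 := by
  have h1 := norm_sub_smul_add_sq a s (F a) h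
  have h2 := mul_le_mul_of_nonneg_left (hF.norm_sq_le a) (sq_nonneg h)
  have h3 := mul_le_mul_of_nonneg_left (hF.dissip a) hh
  nlinarith

theorem midGap_le (hF : DriftBounds F L lam α β G) {S h ε : ℝ} (H : SmallStep ε S L α G h)
    (hε0 : 0 ≤ ε) (hε : ε ≤ 1 / 1000) (a c : V) :
    ‖midGap F S h a c - (a - c)‖ ≤ h * (2 * S + L) * ‖a - c‖ ∧
    ‖midGap F S h a c‖ ≤ 2 * ‖a - c‖ := by
  have e : midGap F S h a c - (a - c) = -((2 * S * h) • (a - c) + h • (F a - F c)) := by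
    unfold midGap; abel
  have hh := H.h_pos
  have hS := H.S_pos
  have h1 : ‖midGap F S h a c - (a - c)‖ ≤ h * (2 * S + L) * ‖a - c‖ := by
    rw [e, norm_neg]
    refine (norm_add_le _ _).trans ?_
    rw [norm_smul, norm_smul, Real.norm_of_nonneg (by positivity), Real.norm_of_nonneg hh.le]
    nlinarith [mul_le_mul_of_nonneg_left (hF.lip a c) hh.le]
  refine ⟨h1, ?_⟩
  have h2 : ‖midGap F S h a c‖ ≤ ‖midGap F S h a c - (a - c)‖ + ‖a - c‖ := by
    simpa using norm_add_le (midGap F S h a c - (a - c)) (a - c)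
  have h3 : h * (2 * S + L) ≤ 1 := by nlinarith [H.hL hε0, H.hS]
  nlinarith [mul_le_mul_of_nonneg_right h3 (norm_nonneg (a - c))]

/-- With k = (2 − Sh)h the spring factor is exactly 1 − 2kS, so the map is one explicit step of size
k for the drift difference. Expanding the square, the one-sided condition controls the cross term.
-/
theorem contraction_of_oneSided (hF : DriftBounds F L lam α β G) {S h : ℝ} (hh : 0 < h)
    (hlam : 0 ≤ lam) (hS : lam < 2 * S) (hSh : S * h ≤ 1 / 1000) (a c : V) :
    ‖(1 - 4 * S * h + 2 * S ^ 2 * h ^ 2) • (a - c) - ((2 - S * h) * h) • (F a - F c)‖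
      ≤ (1 - h * (2 * S - lam) + 4 * h ^ 2 * L ^ 2) * ‖a - c‖ := by
  set k := (2 - S * h) * h with hk
  set m := 2 * S - lam with hm
  have hS0 : 0 < S := by linarith
  have hSh0 : 0 < S * h := by positivity
  have ek : 1 - 4 * S * h + 2 * S ^ 2 * h ^ 2 = 1 - 2 * k * S := by rw [hk]; ring
  have k1 : h ≤ k := by rw [hk]; nlinarith
  have k2 : k ≤ 2 * h := by rw [hk]; nlinarith
  have hkm : k * m ≤ 1 / 2 := by
    have : k * m ≤ (2 * h) * (2 * S) := by
      apply mul_le_mul k2 (by linarith) (by linarith) (by positivity)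
    nlinarith
  have hkS : k * S ≤ 1 / 4 := by nlinarith
  have hk0 : 0 < k := by linarith
  have hm0 : 0 < m := by linarith
  rw [ek]
  have hD := norm_nonneg (a - c)
  have key : ‖(1 - 2 * k * S) • (a - c) - k • (F a - F c)‖ ^ 2
      ≤ ((1 - k * m + k ^ 2 * L ^ 2) * ‖a - c‖) ^ 2 := by
    rw [norm_sub_sq_real, norm_smul, norm_smul, inner_smul_left, inner_smul_right, mul_pow, mul_pow,
      Real.norm_eq_abs, Real.norm_eq_abs, sq_abs, sq_abs]
    simp only [conj_trivial]
    have i1 := hF.oneSided a c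
    rw [real_inner_comm] at i1
    have i2 : ‖F a - F c‖ ^ 2 ≤ L ^ 2 * ‖a - c‖ ^ 2 := by
      rw [← mul_pow]; exact pow_le_pow_left₀ (norm_nonneg _) (hF.lip a c) 2
    have i3 := mul_le_mul_of_nonneg_left i1 (by nlinarith : 0 ≤ (1 - 2 * k * S) * k)
    have i4 := mul_le_mul_of_nonneg_left i2 (sq_nonneg k)
    -- The first two terms equal (1 − km)² − k²λ². The extra k²L² fits into the square on the right
    -- because km ≤ 1/2.
    have i5 : (1 - 2 * k * S) ^ 2 + 2 * ((1 - 2 * k * S) * k) * lam + k ^ 2 * L ^ 2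
        ≤ (1 - k * m + k ^ 2 * L ^ 2) ^ 2 := by
      have e1 : 2 * k * S = k * m + k * lam := by rw [hm]; ring
      have : 0 ≤ (1 - 2 * (k * m)) * (k ^ 2 * L ^ 2) := by
        apply mul_nonneg (by linarith) (by positivity)
      rw [e1]
      nlinarith [sq_nonneg (k * lam), sq_nonneg (k ^ 2 * L ^ 2)]
    have i6 := mul_le_mul_of_nonneg_right i5 (sq_nonneg ‖a - c‖)
    rw [mul_pow]
    nlinarith
  have hnn : 0 ≤ (1 - k * m + k ^ 2 * L ^ 2) * ‖a - c‖ :=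
    mul_nonneg (by nlinarith [sq_nonneg (k * L)]) hD
  refine (abs_le_of_sq_le_sq' key hnn).2.trans (mul_le_mul_of_nonneg_right ?_ hD)
  have : k ^ 2 * L ^ 2 ≤ (2 * h) ^ 2 * L ^ 2 := by gcongr
  nlinarith

/-- Beyond the contraction, `gapMean` contains h(F(A) − F(a)), whose spring part costs h²LS‖a − c‖.
This must be absorbed without a further condition on h, which forces a case distinction between S
and L. -/
theorem gapMean_le (hF : DriftBounds F L lam α β G) {S h ε : ℝ} (H : SmallStep ε S L α G h)
    (hε0 : 0 ≤ ε) (hε : ε ≤ 1 / 1000) (hlam : 0 ≤ lam) (hS : lam < 2 * S) (a c : V) :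
    ‖gapMean F S h a c‖
      ≤ (1 - h * (2 * S - lam) / 4 + 5 * h ^ 2 * L ^ 2) * ‖a - c‖ + h ^ 2 * L * ‖F a‖ := by
  have hh := H.h_pos
  have hL := H.L_pos
  have hSp := H.S_pos
  have hD := norm_nonneg (a - c)
  have hSh : S * h ≤ 1 / 1000 := H.hS.trans hε
  have hhL : h * L ≤ 1 / 1000 := (H.hL hε0).trans hε
  have e1 : ‖F (fineMean F S h a c) - F a‖ ≤ L * (h * (S * ‖a - c‖ + ‖F a‖)) := by
    refine (hF.lip _ _).trans (mul_le_mul_of_nonneg_left ?_ hL.le)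
    have : fineMean F S h a c - a = -(h • (S • (a - c) + F a)) := by unfold fineMean; abel
    rw [this, norm_neg, norm_smul, Real.norm_of_nonneg hh.le]
    refine mul_le_mul_of_nonneg_left ((norm_add_le _ _).trans ?_) hh.le
    rw [norm_smul, Real.norm_of_nonneg hSp.le]
  have e2 : ‖gapMean F S h a c‖ ≤
      ‖(1 - 4 * S * h + 2 * S ^ 2 * h ^ 2) • (a - c) - ((2 - S * h) * h) • (F a - F c)‖
        + h * (L * (h * (S * ‖a - c‖ + ‖F a‖))) := by
    unfold gapMean
    refine (norm_sub_le _ _).trans (add_le_add_right ?_ _)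
    rw [norm_smul, Real.norm_of_nonneg hh.le]
    exact mul_le_mul_of_nonneg_left e1 hh.le
  refine e2.trans ?_
  rcases le_total S L with hc | hc
  -- For S ≤ L the extra term is at most h²L²‖a − c‖, which turns the 4 into the 5.
  · have h1 := hF.contraction_of_oneSided hh hlam hS hSh a c
    have h2 : h ^ 2 * L * S ≤ h ^ 2 * L * L := by gcongr
    have h3 := mul_le_mul_of_nonneg_right h2 hD
    have h4 : 0 ≤ h * (2 * S - lam) * ‖a - c‖ := mul_nonneg (by nlinarith) hD
    nlinarith
  -- For S ≥ L the Lipschitz bound serves as a one-sided condition with parameter L. The contraction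
  -- rate 2S − L ≥ S then dominates both (2S − λ)/4 ≤ S/2 and the extra term.
  · have hF' : DriftBounds F L L α β G := ⟨hF.lip, hF.second, fun x y => by
      have i1 := abs_real_inner_le_norm (F x - F y) (x - y)
      have i2 := mul_le_mul_of_nonneg_right (hF.lip x y) (norm_nonneg (x - y))
      nlinarith [neg_abs_le (inner ℝ (F x - F y) (x - y))], hF.dissip, hF.zero⟩
    have h1 := hF'.contraction_of_oneSided hh hL.le (by linarith) hSh a c
    have h2 : h * (2 * S - lam) / 4 + h * (L * (h * S)) ≤ h * (2 * S - L) := by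
      have : h * L * (h * S) ≤ 1 / 1000 * (h * S) := by gcongr
      nlinarith
    have h3 := mul_le_mul_of_nonneg_right h2 hD
    nlinarith [mul_nonneg (sq_nonneg (h * L)) hD]

end DriftBounds

end Deterministic

/-! ### Lyapunov estimate for the pair of paths over one coarse step -/

theorem spring_cross_scalar {h S L G α x y z : ℝ} (hh : 0 ≤ h) (hα : 0 ≤ α)
    (hS2 : h * S ^ 2 ≤ 1 / 1000 * α) (hL2 : h * L ^ 2 ≤ 1 / 1000 * α) (hG2 : h * G ^ 2 ≤ 1 / 1000)
    (hx : x ^ 2 ≤ 2 * (y ^ 2 + z ^ 2)) :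
    2 * S * (y * (h * (2 * S + L) * x) + h * (S * x + L * y + G) * (2 * x))
      ≤ α / 10 * (y ^ 2 + z ^ 2) + 1 / 100 := by
  have k1 := mul_le_mul_of_nonneg_right hS2 (sq_nonneg x)
  have k2 := mul_le_mul_of_nonneg_right hS2 (sq_nonneg y)
  have k3 := mul_le_mul_of_nonneg_right hL2 (sq_nonneg y)
  have k4 := mul_nonneg hh (sq_nonneg (S * x - S * y))
  have k5 := mul_nonneg hh (sq_nonneg (S * x - L * y))
  have k6 := mul_nonneg hh (sq_nonneg (S * x - G))
  have k7 := mul_le_mul_of_nonneg_left hx hα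
  have k8 := mul_nonneg hα (sq_nonneg y)
  have k9 := mul_nonneg hα (sq_nonneg z)
  linarith

section Deterministic

variable {V : Type*} [NormedAddCommGroup V] [InnerProductSpace ℝ V]

/-- Coefficient of the first noise increment in the Lyapunov estimate. -/
def lyapunovSlope (F : V → V) (S α h : ℝ) (a c : V) : V :=
  (1 - α * h) • fineMean F S h a c + coarseMean F S h a c - (h * S) • midGap F S h a c

theorem norm_smul_sq (t : ℝ) (x : V) : ‖t • x‖ ^ 2 = t ^ 2 * ‖x‖ ^ 2 := by
  rw [norm_smul, mul_pow, Real.norm_eq_abs, sq_abs]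

namespace DriftBounds

variable {F : V → V} {L lam α β G : ℝ}

theorem fineMean_sq_le (hF : DriftBounds F L lam α β G) {S h ε : ℝ} (H : SmallStep ε S L α G h)
    (hε : ε ≤ 1 / 1000) (a c : V) :
    ‖fineMean F S h a c‖ ^ 2 ≤ (1 - 3 / 2 * (α * h)) * ‖a‖ ^ 2 + 2 * h * β + h / 100
      - 2 * (h * S) * inner ℝ a (a - c) + α * h / 100 * (‖a‖ ^ 2 + ‖c‖ ^ 2) := by
  have hh := H.h_pos
  have hα := H.α_pos
  have h1 := hF.dissipative_step a (S • (a - c)) hh.le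
  rw [inner_smul_right, norm_smul_sq] at h1
  have h2 : h * (h * L ^ 2) ≤ h * (1 / 1000 * α) :=
    mul_le_mul_of_nonneg_left (H.mono hε).hL2 hh.le
  have h3 : h * (h * G ^ 2) ≤ h * (1 / 1000) :=
    mul_le_mul_of_nonneg_left (H.mono hε).hG2 hh.le
  have h4 : h * (h * S ^ 2) ≤ h * (1 / 1000 * α) :=
    mul_le_mul_of_nonneg_left (H.mono hε).hS2 hh.le
  have h5 := mul_le_mul_of_nonneg_right h2 (sq_nonneg ‖a‖)
  have h6 := mul_le_mul_of_nonneg_right h4 (sq_nonneg ‖a - c‖)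
  have h7 := mul_le_mul_of_nonneg_left (norm_sub_sq_le_two_mul a c)
    (by positivity : 0 ≤ h * (1 / 1000 * α))
  have h8 : 0 ≤ α * h * ‖a‖ ^ 2 := by positivity
  have h9 : 0 ≤ α * h * ‖c‖ ^ 2 := by positivity
  unfold fineMean
  linarith

theorem coarseMean_sq_le (hF : DriftBounds F L lam α β G) {S h ε : ℝ}
    (H : SmallStep ε S L α G h) (hε : ε ≤ 1 / 1000) (a c : V) :
    ‖coarseMean F S h a c‖ ^ 2 ≤ (1 - 3 / 2 * (α * h)) * ‖c‖ ^ 2 + 4 * h * β + h / 50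
      + 4 * (h * S) * inner ℝ c (a - c) + α * h / 50 * (‖a‖ ^ 2 + ‖c‖ ^ 2) := by
  have hh := H.h_pos
  have hα := H.α_pos
  have h1 := hF.dissipative_step c (-S • (a - c)) (by positivity : 0 ≤ 2 * h)
  rw [inner_smul_right, norm_smul_sq] at h1
  have h2 : h * (h * L ^ 2) ≤ h * (1 / 1000 * α) :=
    mul_le_mul_of_nonneg_left (H.mono hε).hL2 hh.le
  have h3 : h * (h * G ^ 2) ≤ h * (1 / 1000) :=
    mul_le_mul_of_nonneg_left (H.mono hε).hG2 hh.le
  have h4 : h * (h * S ^ 2) ≤ h * (1 / 1000 * α) :=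
    mul_le_mul_of_nonneg_left (H.mono hε).hS2 hh.le
  have h5 := mul_le_mul_of_nonneg_right h2 (sq_nonneg ‖c‖)
  have h6 := mul_le_mul_of_nonneg_right h4 (sq_nonneg ‖a - c‖)
  have h7 := mul_le_mul_of_nonneg_left (norm_sub_sq_le_two_mul a c)
    (by positivity : 0 ≤ h * (1 / 1000 * α))
  have h8 : 0 ≤ α * h * ‖a‖ ^ 2 := by positivity
  have h9 : 0 ≤ α * h * ‖c‖ ^ 2 := by positivity
  unfold coarseMean
  linarith

/-- The spring force after one step still pulls the fine path towards the coarse one. -/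
theorem spring_cross_le (hF : DriftBounds F L lam α β G) {S h ε : ℝ} (H : SmallStep ε S L α G h)
    (hε0 : 0 ≤ ε) (hε : ε ≤ 1 / 1000) (a c : V) :
    -(2 * (h * S) * inner ℝ (fineMean F S h a c) (midGap F S h a c))
      ≤ -(2 * (h * S) * inner ℝ a (a - c)) + α * h / 10 * (‖a‖ ^ 2 + ‖c‖ ^ 2) + h / 100 := by
  have hh := H.h_pos
  have hα := H.α_pos
  have hS := H.S_pos
  have hL := H.L_pos
  have hG := H.G_nonneg
  obtain ⟨m1, m2⟩ := hF.midGap_le H hε0 hε a c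
  set D := a - c with hD
  set A := fineMean F S h a c with hA
  set M := midGap F S h a c with hM
  have n1 : ‖A - a‖ ≤ h * (S * ‖D‖ + L * ‖a‖ + G) := by
    have : A - a = -(h • (S • D + F a)) := by rw [hA]; unfold fineMean; abel
    rw [this, norm_neg, norm_smul, Real.norm_of_nonneg hh.le]
    refine mul_le_mul_of_nonneg_left ((norm_add_le _ _).trans ?_) hh.le
    rw [norm_smul, Real.norm_of_nonneg hS.le]
    linarith [hF.norm_le a]
  -- The spring of the second fine step acts through A and M. Replacing them by a and D costs two
  -- terms carrying an extra factor h, which the step restriction absorbs.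
  have e1 : inner ℝ A M = inner ℝ a D + inner ℝ a (M - D) + inner ℝ (A - a) M := by
    rw [inner_sub_right a M D, inner_sub_left A a M]; ring
  have i1 : -(‖a‖ * (h * (2 * S + L) * ‖D‖)) ≤ inner ℝ a (M - D) := by
    have := abs_real_inner_le_norm a (M - D)
    have h2 := mul_le_mul_of_nonneg_left m1 (norm_nonneg a)
    linarith [neg_abs_le (inner ℝ a (M - D))]
  have i2 : -(h * (S * ‖D‖ + L * ‖a‖ + G) * (2 * ‖D‖)) ≤ inner ℝ (A - a) M := by
    have := abs_real_inner_le_norm (A - a) M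
    have h2 := mul_le_mul n1 m2 (norm_nonneg _) (by positivity)
    linarith [neg_abs_le (inner ℝ (A - a) M)]
  rw [e1]
  have hD2 : ‖D‖ ^ 2 ≤ 2 * (‖a‖ ^ 2 + ‖c‖ ^ 2) := norm_sub_sq_le_two_mul a c
  have hS2 : h * S ^ 2 ≤ 1 / 1000 * α := (H.mono hε).hS2
  have hL2 : h * L ^ 2 ≤ 1 / 1000 * α := (H.mono hε).hL2
  have hG2 : h * G ^ 2 ≤ 1 / 1000 := H.hG2.trans hε
  have tot := spring_cross_scalar hh.le hα.le hS2 hL2 hG2 hD2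
  have i3 := mul_le_mul_of_nonneg_left i1 (by positivity : 0 ≤ 2 * (h * S))
  have i4 := mul_le_mul_of_nonneg_left i2 (by positivity : 0 ≤ 2 * (h * S))
  have i5 := mul_le_mul_of_nonneg_left tot hh.le
  linarith only [i3, i4, i5]

/-- Here z is the first noise; the second one is added after the means on the left. The spring terms
−2hS⟨a, D⟩ of each fine step and 4hS⟨c, D⟩ of the coarse step, with D = a − c, sum to −4hS‖D‖² ≤ 0.
Of the available dissipation only the rate α is kept, and the rest pays for the O(h²) terms. -/
theorem lyapunov_le (hF : DriftBounds F L lam α β G) {S h ε : ℝ} (H : SmallStep ε S L α G h)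
    (hε0 : 0 ≤ ε) (hε : ε ≤ 1 / 1000) (a c z : V) :
    ‖fineMean F S h a c + z - h • (S • midGap F S h a c + F (fineMean F S h a c + z))‖ ^ 2
        + ‖coarseMean F S h a c + z‖ ^ 2
      ≤ (1 - α * h) * (‖a‖ ^ 2 + ‖c‖ ^ 2) + h * (8 * β + 1)
        + 2 * inner ℝ (lyapunovSlope F S α h a c) z + 2 * ‖z‖ ^ 2 := by
  have hh := H.h_pos
  have hα := H.α_pos
  have hS := H.S_pos
  have f1 := hF.fineMean_sq_le H hε a c
  have f2 := hF.coarseMean_sq_le H hε a c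
  have f3 := hF.spring_cross_le H hε0 hε a c
  have m2 := (hF.midGap_le H hε0 hε a c).2
  unfold lyapunovSlope
  set D := a - c with hD
  set A := fineMean F S h a c with hA
  set C := coarseMean F S h a c with hC
  set M := midGap F S h a c with hM
  have g1 := hF.dissipative_step (A + z) (S • M) hh.le
  rw [inner_smul_right, norm_smul_sq] at g1
  have hL2 : h * (h * L ^ 2) ≤ h * (1 / 1000 * α) :=
    mul_le_mul_of_nonneg_left (H.mono hε).hL2 hh.le
  have hG2 : h * (h * G ^ 2) ≤ h * (1 / 1000) :=
    mul_le_mul_of_nonneg_left (H.mono hε).hG2 hh.le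
  have hS2 : h * (h * S ^ 2) ≤ h * (1 / 1000 * α) :=
    mul_le_mul_of_nonneg_left (H.mono hε).hS2 hh.le
  have hM2 : ‖M‖ ^ 2 ≤ 8 * (‖a‖ ^ 2 + ‖c‖ ^ 2) := by
    have := norm_sub_sq_le_two_mul a c
    nlinarith [norm_nonneg M]
  have h6 := mul_le_mul_of_nonneg_right hS2 (sq_nonneg ‖M‖)
  have h7 := mul_le_mul_of_nonneg_left hM2 (by positivity : 0 ≤ h * (1 / 1000 * α))
  have g2 : (1 - 2 * α * h + 4 * h ^ 2 * L ^ 2) * ‖A + z‖ ^ 2 ≤ (1 - α * h) * ‖A + z‖ ^ 2 := by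
    refine mul_le_mul_of_nonneg_right ?_ (sq_nonneg _)
    nlinarith [mul_pos hα hh]
  have e1 : ‖A + z‖ ^ 2 = ‖A‖ ^ 2 + 2 * inner ℝ A z + ‖z‖ ^ 2 := norm_add_sq_real A z
  have e2 : ‖C + z‖ ^ 2 = ‖C‖ ^ 2 + 2 * inner ℝ C z + ‖z‖ ^ 2 := norm_add_sq_real C z
  have e3 : inner ℝ ((1 - α * h) • A + C - (h * S) • M) z
      = (1 - α * h) * inner ℝ A z + inner ℝ C z - h * S * inner ℝ z M := by
    rw [inner_sub_left, inner_add_left, inner_smul_left, inner_smul_left, real_inner_comm z M]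
    simp
  have e4 : inner ℝ (A + z) M = inner ℝ A M + inner ℝ z M := inner_add_left _ _ _
  have e5 : inner ℝ c D = inner ℝ a D - ‖D‖ ^ 2 := by
    rw [← real_inner_self_eq_norm_sq, ← inner_sub_left]; congr 1; rw [hD]; abel
  rw [e1] at g2
  rw [e1, e4] at g1
  rw [e2, e3]
  rw [e5] at f2
  have p1 : 0 ≤ α * h * ‖A‖ ^ 2 := by positivity
  have p2 : 0 ≤ α * h * ‖z‖ ^ 2 := by positivity
  have p3 : 0 ≤ h * S * ‖D‖ ^ 2 := by positivity
  have p4 : 0 ≤ α * h * ‖a‖ ^ 2 := by positivity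
  have p5 : 0 ≤ α * h * ‖c‖ ^ 2 := by positivity
  linarith

/-- The size of the slope governs the Gaussian integral of the exponential of the term linear in the
noise. -/
theorem lyapunovSlope_sq_le (hF : DriftBounds F L lam α β G) {S h ε : ℝ}
    (H : SmallStep ε S L α G h) (hε0 : 0 ≤ ε) (hε : ε ≤ 1 / 1000) (a c : V) :
    ‖lyapunovSlope F S α h a c‖ ^ 2 ≤ 7 * (‖a‖ ^ 2 + ‖c‖ ^ 2) + h * (18 * β + 1) := by
  have hh := H.h_pos
  have hα := H.α_pos
  have hS := H.S_pos
  have f1 := hF.fineMean_sq_le H hε a c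
  have f2 := hF.coarseMean_sq_le H hε a c
  have m2 := (hF.midGap_le H hε0 hε a c).2
  unfold lyapunovSlope
  set D := a - c with hD
  set A := fineMean F S h a c with hA
  set C := coarseMean F S h a c with hC
  set M := midGap F S h a c with hM
  have hD2 : ‖D‖ ^ 2 ≤ 2 * (‖a‖ ^ 2 + ‖c‖ ^ 2) := norm_sub_sq_le_two_mul a c
  have hαh : α * h ≤ 1 / 1000 := (H.hα hε0).trans hε
  have hSh : h * S ≤ 1 / 1000 := by linarith [H.hS.trans hε, mul_comm h S]
  have hSh0 : 0 ≤ h * S := by positivity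
  have hαh0 : 0 ≤ α * h := by positivity
  have i1 := abs_real_inner_le_norm a D
  have i2 := abs_real_inner_le_norm c D
  have j1 : -inner ℝ a D ≤ 3 / 2 * (‖a‖ ^ 2 + ‖c‖ ^ 2) := by
    nlinarith [neg_abs_le (inner ℝ a D), sq_nonneg (‖a‖ - ‖D‖), sq_nonneg ‖c‖]
  have j2 : inner ℝ c D ≤ 3 / 2 * (‖a‖ ^ 2 + ‖c‖ ^ 2) := by
    nlinarith [le_abs_self (inner ℝ c D), sq_nonneg (‖c‖ - ‖D‖), sq_nonneg ‖a‖]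
  have j3 := mul_le_mul_of_nonneg_left j1 hSh0
  have j4 := mul_le_mul_of_nonneg_left j2 hSh0
  have hU : 0 ≤ ‖a‖ ^ 2 + ‖c‖ ^ 2 := by positivity
  have j5 := mul_le_mul_of_nonneg_right hSh hU
  have j6 := mul_le_mul_of_nonneg_right hαh hU
  have t1 : ‖(1 - α * h) • A + C - (h * S) • M‖ ≤ ‖A‖ + ‖C‖ + 1 / 1000 * (2 * ‖D‖) := by
    refine (norm_sub_le _ _).trans (add_le_add ((norm_add_le _ _).trans (add_le_add ?_ le_rfl)) ?_)
    · rw [norm_smul, Real.norm_of_nonneg (by linarith)]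
      nlinarith [norm_nonneg A]
    · rw [norm_smul, Real.norm_of_nonneg hSh0]
      exact mul_le_mul hSh m2 (norm_nonneg _) (by norm_num)
  have t2 : ‖(1 - α * h) • A + C - (h * S) • M‖ ^ 2
      ≤ 3 * (‖A‖ ^ 2 + ‖C‖ ^ 2 + (1 / 1000 * (2 * ‖D‖)) ^ 2) := by
    refine (pow_le_pow_left₀ (norm_nonneg _) t1 2).trans ?_
    nlinarith [sq_nonneg (‖A‖ - ‖C‖), sq_nonneg (‖A‖ - 1 / 1000 * (2 * ‖D‖)),
      sq_nonneg (‖C‖ - 1 / 1000 * (2 * ‖D‖))]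
  have p4 : 0 ≤ α * h * ‖a‖ ^ 2 := by positivity
  have p5 : 0 ≤ α * h * ‖c‖ ^ 2 := by positivity
  linarith

/-- Dissipativity and linear growth give α‖v‖² − β ≤ ‖v‖(L‖v‖ + G), which fails for large ‖v‖ if α >
L. -/
theorem α_le [Nontrivial V] (hF : DriftBounds F L lam α β G) : α ≤ L := by
  by_contra hlt
  push Not at hlt
  obtain ⟨v, hv⟩ := NormedSpace.exists_lt_norm ℝ V ((|G| + |β| + 1) / (α - L) + 1)
  have hd : 0 < α - L := by linarith
  have h1 := hF.dissip v
  have h2 := real_inner_le_norm v (F v)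
  have h3 := mul_le_mul_of_nonneg_left (hF.norm_le v) (norm_nonneg v)
  have hv1 : 1 < ‖v‖ := lt_of_le_of_lt (by
    have : 0 ≤ (|G| + |β| + 1) / (α - L) := by positivity
    linarith) hv
  have hv2 : |G| + |β| + 1 < (α - L) * ‖v‖ := by
    have : (|G| + |β| + 1) / (α - L) < ‖v‖ := by linarith
    rwa [div_lt_iff₀' hd] at this
  have h4 := mul_lt_mul_of_pos_right hv2 (by linarith : 0 < ‖v‖)
  have h5 : G * ‖v‖ ≤ |G| * ‖v‖ := by gcongr; exact le_abs_self G
  have h6 : β ≤ |β| * ‖v‖ := (le_abs_self β).trans (le_mul_of_one_le_right (abs_nonneg _) hv1.le)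
  nlinarith

end DriftBounds

end Deterministic

/-! ### The gradient of f as a drift -/

theorem driftBounds_gradient {d : ℕ} {f : EuclideanSpace ℝ (Fin d) → ℝ} {L lam α β : ℝ}
    (h1 : LSmooth f L) (h2 : LHessianSmooth f L) (h3 : WeakOneSidedLipschitz f lam)
    (h4 : Dissipative f α β) : DriftBounds (∇ f) L lam α β ‖∇ f 0‖ := by
  refine ⟨h1.2, fun y u => ?_, h3, h4, le_rfl⟩
  have hd : Differentiable ℝ (∇ f) := by
    have h5 : ContDiff ℝ 1 (fderiv ℝ f) := h2.1.fderiv_right (by norm_num)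
    have h6 : ∇ f = (InnerProductSpace.toDual ℝ (EuclideanSpace ℝ (Fin d))).symm ∘ fderiv ℝ f := rfl
    rw [h6]
    exact (LinearIsometryEquiv.differentiable _).comp (h5.differentiable (by norm_num))
  -- The second difference is the increment over [0, 1] of t ↦ F(y + tu) + F(y − tu). Its derivative
  -- compares the Hessian at two points at distance 2t‖u‖.
  have key : ∀ x ∈ Set.Icc (0 : ℝ) 1,
      ‖fderiv ℝ (∇ f) (y + x • u) u - fderiv ℝ (∇ f) (y - x • u) u‖ ≤ 2 * L * ‖u‖ ^ 2 := by
    intro x hx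
    rw [← sub_apply]
    refine (ContinuousLinearMap.le_opNorm _ _).trans ?_
    have e := h2.2 (y + x • u) (y - x • u)
    have e2 : y + x • u - (y - x • u) = (2 * x) • u := by rw [two_mul, add_smul]; abel
    rw [e2, norm_smul, Real.norm_of_nonneg (by linarith [hx.1])] at e
    have hL : 0 ≤ L * ‖u‖ := by
      have := (norm_nonneg _).trans (h1.2 u 0)
      simpa using this
    have e3 : L * (2 * x * ‖u‖) ≤ 2 * (L * ‖u‖) := by nlinarith [hx.2]
    calc _ ≤ L * (2 * x * ‖u‖) * ‖u‖ := by gcongr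
      _ ≤ 2 * (L * ‖u‖) * ‖u‖ := by gcongr
      _ = _ := by ring
  have hder : ∀ x ∈ Set.Icc (0 : ℝ) 1, HasDerivWithinAt
      (fun t : ℝ => ∇ f (y + t • u) + ∇ f (y - t • u))
      (fderiv ℝ (∇ f) (y + x • u) u - fderiv ℝ (∇ f) (y - x • u) u) (Set.Icc 0 1) x := by
    intro x _
    have a1 : HasDerivAt (fun t : ℝ => y + t • u) u x := by
      simpa using ((hasDerivAt_id x).smul_const u).const_add y
    have a2 : HasDerivAt (fun t : ℝ => y - t • u) (-u) x := by
      simpa using ((hasDerivAt_id x).smul_const u).const_sub y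
    have b1 := (hd (y + x • u)).hasFDerivAt.comp_hasDerivAt x a1
    have b2 := (hd (y - x • u)).hasFDerivAt.comp_hasDerivAt x a2
    have := b1.add b2
    rw [map_neg, ← sub_eq_add_neg] at this
    exact this.hasDerivWithinAt
  have := norm_image_sub_le_of_norm_deriv_le_segment_01' hder fun x hx =>
    key x (Set.Ico_subset_Icc_self hx)
  simpa [two_smul] using this

/-! ### Gaussian increments -/

theorem lintegral_exp_mul_gaussianReal (v : ℝ≥0) (t : ℝ) :
    ∫⁻ x, ENNReal.ofReal (Real.exp (t * x)) ∂(gaussianReal 0 v)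
      = ENNReal.ofReal (Real.exp (v * t ^ 2 / 2)) := by
  rw [← ofReal_integral_eq_lintegral_ofReal (integrable_exp_mul_gaussianReal t)
    (Filter.Eventually.of_forall fun x => (Real.exp_pos _).le)]
  have := congrFun (mgf_id_gaussianReal (μ := 0) (v := v)) t
  simp only [mgf, id, zero_mul, zero_add] at this
  rw [this]

/-- Tilting a centred Gaussian by exp(t x²) gives s^(−1/2) times a Gaussian density of variance v/s,
where s = 1 − 2tv. -/
theorem lintegral_exp_mul_sq_gaussianReal {v : ℝ≥0} (hv : 0 < v) {t : ℝ} (ht0 : 0 ≤ t)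
    (ht : t * v ≤ 1 / 4) :
    ∫⁻ x, ENNReal.ofReal (Real.exp (t * x ^ 2)) ∂(gaussianReal 0 v)
      ≤ ENNReal.ofReal (Real.exp (2 * (t * v))) := by
  have hv' : (0 : ℝ) < v := hv
  set s : ℝ := 1 - 2 * (t * v) with hs
  have hs0 : 1 / 2 ≤ s := by rw [hs]; linarith
  have hsp : 0 < s := by linarith
  set v' : ℝ≥0 := ⟨v / s, by positivity⟩ with hv'd
  have hv'0 : v' ≠ 0 := by
    have : (0 : ℝ) < v' := by change 0 < (v : ℝ) / s; positivity
    exact (NNReal.coe_pos.mp this).ne'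
  rw [gaussianReal_of_var_ne_zero _ hv.ne',
    lintegral_withDensity_eq_lintegral_mul _ (measurable_gaussianPDF 0 v) (by fun_prop)]
  have e : ∀ x : ℝ, (gaussianPDF 0 v * fun x => ENNReal.ofReal (Real.exp (t * x ^ 2))) x
      = ENNReal.ofReal ((√s)⁻¹) * gaussianPDF 0 v' x := by
    intro x
    rw [Pi.mul_apply, gaussianPDF, gaussianPDF, ← ENNReal.ofReal_mul (gaussianPDFReal_nonneg _ _ _),
      ← ENNReal.ofReal_mul (by positivity)]
    congr 1
    rw [gaussianPDFReal, gaussianPDFReal, mul_assoc, ← Real.exp_add, ← mul_assoc]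
    have c1 : ((v' : ℝ≥0) : ℝ) = v / s := rfl
    rw [c1]
    congr 1
    · rw [← mul_inv, ← Real.sqrt_mul hsp.le]
      congr 2
      field_simp
    · congr 1
      field_simp
      rw [hs]
      ring
  rw [lintegral_congr e, lintegral_const_mul _ (measurable_gaussianPDF 0 v'),
    lintegral_gaussianPDF_eq_one 0 hv'0, mul_one]
  refine ENNReal.ofReal_le_ofReal ?_
  have hsq : 0 < √s := Real.sqrt_pos.mpr hsp
  rw [inv_le_comm₀ hsq (Real.exp_pos _), ← Real.exp_neg]
  refine Real.le_sqrt_of_sq_le ?_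
  rw [← Real.exp_nat_mul]
  have h3 : 1 / Real.exp (4 * (t * v)) ≤ s := by
    rw [div_le_iff₀ (Real.exp_pos _)]
    have := Real.add_one_le_exp (4 * (t * v))
    have h0 : 0 ≤ t * v := by positivity
    -- (1 − 2y)(1 + 4y) ≥ 1 for 0 ≤ y ≤ 1/4, with y = tv.
    calc (1 : ℝ) ≤ s * (4 * (t * v) + 1) := by rw [hs]; nlinarith
      _ ≤ _ := by gcongr
  refine le_trans (le_of_eq ?_) h3
  rw [one_div, ← Real.exp_neg]
  congr 1
  push_cast
  ring

section

variable {d : ℕ}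

local notation "E" => EuclideanSpace ℝ (Fin d)

/-- The law of a Brownian increment over a time step of length `h`. -/
noncomputable def gaussLaw (d : ℕ) (h : ℝ) : Measure (EuclideanSpace ℝ (Fin d)) :=
  multivariateGaussian 0 (h • (1 : Matrix (Fin d) (Fin d) ℝ))

instance (h : ℝ) : IsProbabilityMeasure (gaussLaw d h) := by unfold gaussLaw; infer_instance

instance (h : ℝ) : IsGaussian (gaussLaw d h) := by unfold gaussLaw; infer_instance

theorem posSemidef_smul_one {h : ℝ} (hh : 0 ≤ h) :
    (h • (1 : Matrix (Fin d) (Fin d) ℝ)).PosSemidef :=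
  Matrix.PosSemidef.one.smul hh

theorem gaussLaw_map_neg {h : ℝ} (hh : 0 ≤ h) :
    (gaussLaw d h).map (fun x => -x) = gaussLaw d h := by
  apply Measure.ext_of_charFun
  ext t
  have e : (fun x : E => -x) = fun x => (-1 : ℝ) • x := by ext x; simp
  rw [e, charFun_map_smul, gaussLaw, charFun_multivariateGaussian (posSemidef_smul_one hh),
    charFun_multivariateGaussian (posSemidef_smul_one hh)]
  simp [Matrix.smul_mulVec]

theorem gaussLaw_map_inner {h : ℝ} (hh : 0 ≤ h) (a : E) :
    (gaussLaw d h).map (fun x => inner ℝ a x) = gaussianReal 0 (h * ‖a‖ ^ 2).toNNReal := by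
  have h1 := IsGaussian.map_eq_gaussianReal (μ := gaussLaw d h) (innerSL ℝ a)
  have h2 : ∫ x, (innerSL ℝ a) x ∂(gaussLaw d h) = 0 := by
    rw [ContinuousLinearMap.integral_comp_id_comm IsGaussian.integrable_id]
    simp [gaussLaw]
  have h3 : Var[innerSL ℝ a; gaussLaw d h] = h * ‖a‖ ^ 2 := by
    have : Var[fun x => inner ℝ a x; gaussLaw d h] = h * ‖a‖ ^ 2 := by
      rw [← covariance_self (by fun_prop), ← covarianceBilin_apply_eq_cov IsGaussian.memLp_two_id,
        gaussLaw, covarianceBilin_multivariateGaussian (posSemidef_smul_one hh)]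
      rw [EuclideanSpace.real_norm_sq_eq]
      simp [Matrix.smul_mulVec, dotProduct, Finset.mul_sum, sq, mul_left_comm]
    exact this
  rw [h2, h3] at h1
  exact h1

theorem lintegral_exp_inner {h : ℝ} (hh : 0 ≤ h) (a : E) :
    ∫⁻ x, ENNReal.ofReal (Real.exp (inner ℝ a x)) ∂(gaussLaw d h)
      = ENNReal.ofReal (Real.exp (h * ‖a‖ ^ 2 / 2)) := by
  have h1 := lintegral_exp_mul_gaussianReal (h * ‖a‖ ^ 2).toNNReal 1
  rw [← gaussLaw_map_inner hh a, lintegral_map (by fun_prop) (by fun_prop)] at h1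
  rw [Real.coe_toNNReal _ (by positivity)] at h1
  simpa using h1

/-- Jensen's inequality, applied to b‖x‖² as the average of the numbers b d xᵢ², reduces the bound
to single coordinates, without using their independence. -/
theorem lintegral_exp_mul_norm_sq {h b : ℝ} (hd : 1 ≤ d) (hh : 0 < h) (hb : 0 ≤ b)
    (hbh : b * d * h ≤ 1 / 4) :
    ∫⁻ x : E, ENNReal.ofReal (Real.exp (b * ‖x‖ ^ 2)) ∂(gaussLaw d h)
      ≤ ENNReal.ofReal (Real.exp (2 * (b * d * h))) := by
  have hd' : (0 : ℝ) < d := by exact_mod_cast hd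
  have key : ∀ x : E, ENNReal.ofReal (Real.exp (b * ‖x‖ ^ 2))
      ≤ ∑ i, ENNReal.ofReal (1 / d) * ENNReal.ofReal (Real.exp (b * d * x i ^ 2)) := by
    intro x
    simp_rw [← ENNReal.ofReal_mul (by positivity : (0 : ℝ) ≤ 1 / d)]
    rw [← ENNReal.ofReal_sum_of_nonneg (fun i _ => by positivity)]
    refine ENNReal.ofReal_le_ofReal ?_
    have := convexOn_exp.map_sum_le (t := Finset.univ) (w := fun _ : Fin d => (1 : ℝ) / d)
      (p := fun i => b * d * x i ^ 2) (fun _ _ => by positivity)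
      (by simp [hd'.ne']) (fun _ _ => Set.mem_univ _)
    simp only [smul_eq_mul] at this
    refine le_trans (le_of_eq ?_) this
    congr 1
    rw [EuclideanSpace.real_norm_sq_eq, Finset.mul_sum]
    refine Finset.sum_congr rfl fun i _ => ?_
    field_simp
  have coord : ∀ i : Fin d, ∫⁻ x : E, ENNReal.ofReal (Real.exp (b * d * x i ^ 2)) ∂(gaussLaw d h)
      ≤ ENNReal.ofReal (Real.exp (2 * (b * d * h))) := by
    intro i
    have mp := measurePreserving_eval_multivariateGaussian (μ := (0 : E))
      (posSemidef_smul_one (d := d) hh.le) (i := i)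
    have e1 := mp.lintegral_comp (f := fun y : ℝ => ENNReal.ofReal (Real.exp (b * d * y ^ 2)))
      (by fun_prop)
    rw [gaussLaw, e1]
    have hv : 0 < ((h • (1 : Matrix (Fin d) (Fin d) ℝ)) i i).toNNReal := by simp [hh]
    have hve : (((h • (1 : Matrix (Fin d) (Fin d) ℝ)) i i).toNNReal : ℝ) = h := by
      simp [hh.le]
    have := lintegral_exp_mul_sq_gaussianReal hv (t := b * d) (by positivity) (by rwa [hve])
    rw [hve] at this
    simpa using this
  calc _ ≤ ∫⁻ x : E, ∑ i, ENNReal.ofReal (1 / d) * ENNReal.ofReal (Real.exp (b * d * x i ^ 2))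
        ∂(gaussLaw d h) := lintegral_mono key
    _ = ∑ i : Fin d, ENNReal.ofReal (1 / d) *
          ∫⁻ x : E, ENNReal.ofReal (Real.exp (b * d * x i ^ 2)) ∂(gaussLaw d h) := by
        rw [lintegral_finsetSum _ (fun i _ => by fun_prop)]
        refine Finset.sum_congr rfl fun i _ => lintegral_const_mul _ (by fun_prop)
    _ ≤ ∑ i : Fin d, ENNReal.ofReal (1 / d) * ENNReal.ofReal (Real.exp (2 * (b * d * h))) := by
        gcongr with i; exact coord i
    _ = _ := by
        rw [Finset.sum_const, Finset.card_univ, Fintype.card_fin, nsmul_eq_mul,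
          ← ENNReal.ofReal_natCast, ← mul_assoc, ← ENNReal.ofReal_mul hd'.le,
          mul_one_div_cancel hd'.ne']
        simp

/-- Cauchy-Schwarz for exponentials. -/
theorem lintegral_exp_add_le {Ω : Type*} [MeasurableSpace Ω] (μ : Measure Ω) {u v : Ω → ℝ}
    (hu : Measurable u) (hv : Measurable v) {A B : ℝ}
    (h1 : ∫⁻ x, ENNReal.ofReal (Real.exp (2 * u x)) ∂μ ≤ ENNReal.ofReal (Real.exp (2 * A)))
    (h2 : ∫⁻ x, ENNReal.ofReal (Real.exp (2 * v x)) ∂μ ≤ ENNReal.ofReal (Real.exp (2 * B))) :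
    ∫⁻ x, ENNReal.ofReal (Real.exp (u x + v x)) ∂μ ≤ ENNReal.ofReal (Real.exp (A + B)) := by
  have hp : (2 : ℝ).HolderConjugate 2 := Real.HolderConjugate.two_two
  have hol := ENNReal.lintegral_mul_le_Lp_mul_Lq μ hp
    (f := fun x => ENNReal.ofReal (Real.exp (u x))) (g := fun x => ENNReal.ofReal (Real.exp (v x)))
    (by fun_prop) (by fun_prop)
  have e0 : ∀ y : ℝ, (ENNReal.ofReal (Real.exp y)) ^ (2 : ℝ) = ENNReal.ofReal (Real.exp (2 * y)) := by
    intro y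
    rw [ENNReal.ofReal_rpow_of_nonneg (Real.exp_pos _).le (by norm_num), ← Real.exp_mul, mul_comm]
  have e1 : ∀ y : ℝ, (ENNReal.ofReal (Real.exp (2 * y))) ^ (1 / (2 : ℝ))
      = ENNReal.ofReal (Real.exp y) := by
    intro y
    rw [ENNReal.ofReal_rpow_of_nonneg (Real.exp_pos _).le (by norm_num), ← Real.exp_mul]
    congr 2; ring
  simp only [Pi.mul_apply, e0] at hol
  calc _ = ∫⁻ x, ENNReal.ofReal (Real.exp (u x)) * ENNReal.ofReal (Real.exp (v x)) ∂μ := by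
        refine lintegral_congr fun x => ?_
        rw [← ENNReal.ofReal_mul (Real.exp_pos _).le, Real.exp_add]
    _ ≤ _ := hol
    _ ≤ (ENNReal.ofReal (Real.exp (2 * A))) ^ (1 / (2 : ℝ))
        * (ENNReal.ofReal (Real.exp (2 * B))) ^ (1 / (2 : ℝ)) := by gcongr
    _ = _ := by rw [e1, e1, ← ENNReal.ofReal_mul (Real.exp_pos _).le, Real.exp_add]

theorem lintegral_exp_inner_add_norm_sq {h b : ℝ} (hd : 1 ≤ d) (hh : 0 < h) (hb : 0 ≤ b)
    (hbh : b * d * h ≤ 1 / 8) (a : E) :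
    ∫⁻ x : E, ENNReal.ofReal (Real.exp (inner ℝ a x + b * ‖x‖ ^ 2)) ∂(gaussLaw d h)
      ≤ ENNReal.ofReal (Real.exp (h * ‖a‖ ^ 2 + 2 * (b * d * h))) := by
  refine lintegral_exp_add_le _ (by fun_prop) (by fun_prop) (le_of_eq ?_) ?_
  · have := lintegral_exp_inner hh.le ((2 : ℝ) • a)
    simp only [inner_smul_left, conj_trivial, norm_smul_sq] at this
    rw [this]
    congr 2; ring
  · have := lintegral_exp_mul_norm_sq (b := 2 * b) hd hh (by positivity) (by linarith)
    simp only [mul_assoc] at this ⊢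
    exact this

end

/-! ### Sequences of independent increments -/

section Sequences

variable {X : Type*} [MeasurableSpace X] (γ : Measure X) [IsProbabilityMeasure γ]

/-- Resampling one coordinate preserves the product law. This replaces conditional expectations: an
integrand that sees only the past of time n does not notice the resampling. -/
theorem infinitePi_map_update (n : ℕ) :
    ((Measure.infinitePi fun _ : ℕ => γ).prod γ).map (fun p => Function.update p.1 n p.2)
      = Measure.infinitePi fun _ : ℕ => γ := by
  have hm : Measurable fun p : (ℕ → X) × X => Function.update p.1 n p.2 := measurable_update'
  refine Measure.eq_infinitePi _ fun s t ht => ?_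
  rw [Measure.map_apply hm (.pi s.countable_toSet fun _ _ => ht _)]
  by_cases hn : n ∈ s
  · have e : (fun p : (ℕ → X) × X => Function.update p.1 n p.2) ⁻¹' ((s : Set ℕ).pi t)
        = (((s.erase n : Finset ℕ) : Set ℕ).pi t) ×ˢ t n := by
      ext p
      simp only [Set.mem_preimage, Set.mem_pi, Finset.mem_coe, Set.mem_prod, Finset.mem_erase]
      constructor
      · intro H
        refine ⟨fun i hi => ?_, by simpa using H n hn⟩
        simpa [hi.1] using H i hi.2
      · rintro ⟨H1, H2⟩ i hi
        by_cases hin : i = n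
        · subst hin; simpa using H2
        · simpa [hin] using H1 i ⟨hin, hi⟩
    rw [e, Measure.prod_prod, Measure.infinitePi_pi _ (fun i _ => ht i), mul_comm,
      Finset.mul_prod_erase s (fun i => γ (t i)) hn]
  · have e : (fun p : (ℕ → X) × X => Function.update p.1 n p.2) ⁻¹' ((s : Set ℕ).pi t)
        = ((s : Set ℕ).pi t) ×ˢ Set.univ := by
      ext p
      simp only [Set.mem_preimage, Set.mem_pi, Finset.mem_coe, Set.mem_prod, Set.mem_univ, and_true]
      refine forall₂_congr fun i hi => ?_
      have : i ≠ n := fun h => hn (h ▸ hi)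
      simp [this]
    rw [e, Measure.prod_prod, Measure.infinitePi_pi _ (fun i _ => ht i), measure_univ, mul_one]

/-- Integrating out the `n`-th increment. -/
theorem lintegral_infinitePi_eval (n : ℕ) {Φ : (ℕ → X) → X → ℝ≥0∞}
    (hm : Measurable (Function.uncurry Φ))
    (hdep : ∀ w w' x, (∀ i < n, w i = w' i) → Φ w x = Φ w' x) :
    ∫⁻ w, Φ w (w n) ∂(Measure.infinitePi fun _ : ℕ => γ)
      = ∫⁻ w, ∫⁻ x, Φ w x ∂γ ∂(Measure.infinitePi fun _ : ℕ => γ) := by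
  have h1 : Measurable fun w : ℕ → X => Φ w (w n) :=
    hm.comp (measurable_id.prodMk (measurable_pi_apply n))
  conv_lhs => rw [← infinitePi_map_update γ n]
  have h2 : Measurable fun p : (ℕ → X) × X =>
      Φ (Function.update p.1 n p.2) (Function.update p.1 n p.2 n) := h1.comp measurable_update'
  rw [lintegral_map h1 measurable_update', lintegral_prod _ h2.aemeasurable]
  refine lintegral_congr fun w => lintegral_congr fun x => ?_
  simp only [Function.update_self]
  exact hdep _ _ _ fun i hi => Function.update_of_ne hi.ne _ _

/-- Integrating out the increments `n` and `n + 1`. -/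
theorem lintegral_infinitePi_eval_two (n : ℕ) {Φ : (ℕ → X) → X → X → ℝ≥0∞}
    (hm : Measurable fun q : (ℕ → X) × X × X => Φ q.1 q.2.1 q.2.2)
    (hdep : ∀ w w' x y, (∀ i < n, w i = w' i) → Φ w x y = Φ w' x y) :
    ∫⁻ w, Φ w (w n) (w (n + 1)) ∂(Measure.infinitePi fun _ : ℕ => γ)
      = ∫⁻ w, ∫⁻ x, ∫⁻ y, Φ w x y ∂γ ∂γ ∂(Measure.infinitePi fun _ : ℕ => γ) := by
  have m1 : Measurable (Function.uncurry fun (w : ℕ → X) (y : X) => Φ w (w n) y) :=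
    hm.comp (measurable_fst.prodMk (((measurable_pi_apply n).comp measurable_fst).prodMk
      measurable_snd))
  have m2 : Measurable (Function.uncurry fun (w : ℕ → X) (x : X) => ∫⁻ y, Φ w x y ∂γ) := by
    refine Measurable.lintegral_prod_right' (f := fun q : ((ℕ → X) × X) × X => Φ q.1.1 q.1.2 q.2) ?_
    exact hm.comp (measurable_fst.fst.prodMk (measurable_fst.snd.prodMk measurable_snd))
  -- The later increment is integrated first, because for it `w n` belongs to the past.
  rw [lintegral_infinitePi_eval γ (n + 1) m1 fun w w' y hw => ?_,
    lintegral_infinitePi_eval γ n m2 fun w w' x hw => ?_]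
  · exact lintegral_congr fun y => hdep _ _ _ _ hw
  · simp only [hw n (Nat.lt_succ_self n)]
    exact hdep _ _ _ _ fun i hi => hw i (hi.trans (Nat.lt_succ_self n))

end Sequences

noncomputable section

variable {d : ℕ}

local notation "E" => EuclideanSpace ℝ (Fin d)

/-- The law of a sequence of independent Brownian increments. -/
noncomputable def seqLaw (d : ℕ) (h : ℝ) : Measure (ℕ → EuclideanSpace ℝ (Fin d)) :=
  Measure.infinitePi fun _ : ℕ => gaussLaw d h

instance (h : ℝ) : IsProbabilityMeasure (seqLaw d h) := by unfold seqLaw; infer_instance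

/-- Change of sign of all the increments from time `n` on. -/
def flipFrom (n : ℕ) (w : ℕ → E) : ℕ → E := fun i => if i < n then w i else -w i

theorem flipFrom_of_lt {n i : ℕ} (hi : i < n) (w : ℕ → E) : flipFrom n w i = w i := if_pos hi

theorem flipFrom_of_le {n i : ℕ} (hi : n ≤ i) (w : ℕ → E) : flipFrom n w i = -w i :=
  if_neg hi.not_gt

/-- The increments are independent with symmetric laws. This reflection is the source of every
symmetry hypothesis used for `eLpNorm_add_le_of_symm`. -/
theorem measurePreserving_flipFrom {h : ℝ} (hh : 0 ≤ h) (n : ℕ) :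
    MeasurePreserving (flipFrom (d := d) n) (seqLaw d h) (seqLaw d h) := by
  have hm : ∀ i : ℕ, Measurable fun x : E => if i < n then x else -x := fun i => by
    split_ifs <;> fun_prop
  have hm' : Measurable (flipFrom (d := d) n) := measurable_pi_iff.mpr fun i =>
    (hm i).comp (measurable_pi_apply i)
  refine ⟨hm', ?_⟩
  have := Measure.infinitePi_map_pi (fun _ : ℕ => gaussLaw d h) hm
  unfold seqLaw
  refine Eq.trans this ?_
  congr 1
  ext1 i
  split_ifs
  · exact Measure.map_id
  · exact gaussLaw_map_neg hh

/-! ### The coupled paths -/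

variable (f : EuclideanSpace ℝ (Fin d) → ℝ) (S h : ℝ)

theorem evenPath_congr (x₀ : E) {w w' : ℕ → E} {n : ℕ} (hw : ∀ i < 2 * n, w i = w' i) :
    evenPath f S h x₀ w n = evenPath f S h x₀ w' n := by
  induction n with
  | zero => rfl
  | succ n ih =>
    rw [evenPath, evenPath, ih fun i hi => hw i (by omega), hw (2 * n) (by omega),
      hw (2 * n + 1) (by omega)]

variable {f} in
theorem measurable_evenPath (hf : Measurable (∇ f)) (n : ℕ) :
    Measurable fun q : E × (ℕ → E) => evenPath f S h q.1 q.2 n := by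
  induction n with
  | zero => exact measurable_fst.prodMk measurable_fst
  | succ n ih =>
    simp only [evenPath, evenStep, oddStep]
    fun_prop

variable {f} in
theorem measurable_evenPath_right (hf : Measurable (∇ f)) (x₀ : E) (n : ℕ) :
    Measurable fun w : ℕ → E => evenPath f S h x₀ w n :=
  (measurable_evenPath S h hf n).comp (measurable_const.prodMk measurable_id)

/-- The shared noise cancels, so the gap after one fine step, and with it the integrand of the
weight in the second step, is already determined at the even time. -/
theorem oddStep_gap (y : E × E) (w : E) :
    (oddStep f S h y w).1 - (oddStep f S h y w).2 = midGap (∇ f) S h y.1 y.2 := by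
  simp only [oddStep, midGap]
  module

theorem evenPath_succ_fst (x₀ : E) (w : ℕ → E) (n : ℕ) :
    (evenPath f S h x₀ w (n + 1)).1
      = fineMean (∇ f) S h (evenPath f S h x₀ w n).1 (evenPath f S h x₀ w n).2 + √2 • w (2 * n)
        - h • (S • midGap (∇ f) S h (evenPath f S h x₀ w n).1 (evenPath f S h x₀ w n).2
          + ∇ f (fineMean (∇ f) S h (evenPath f S h x₀ w n).1 (evenPath f S h x₀ w n).2
            + √2 • w (2 * n))) + √2 • w (2 * n + 1) := by
  have e1 : ∀ y : E × E, (oddStep f S h y (w (2 * n))).1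
      = fineMean (∇ f) S h y.1 y.2 + √2 • w (2 * n) := fun y => by
    simp only [oddStep, fineMean]; module
  have e2 : ∀ y : E × E, (oddStep f S h y (w (2 * n))).2 - (oddStep f S h y (w (2 * n))).1
      = -midGap (∇ f) S h y.1 y.2 := fun y => by rw [← oddStep_gap f S h y (w (2 * n))]; abel
  rw [evenPath, evenStep]
  simp only [e2]
  rw [e1]
  module

theorem evenPath_succ_snd (x₀ : E) (w : ℕ → E) (n : ℕ) :
    (evenPath f S h x₀ w (n + 1)).2
      = coarseMean (∇ f) S h (evenPath f S h x₀ w n).1 (evenPath f S h x₀ w n).2 + √2 • w (2 * n)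
        + √2 • w (2 * n + 1) := by
  simp only [evenPath, evenStep, oddStep, coarseMean]
  module

/-- The gap between the fine and the coarse path at time `2n`. -/
def gap (x₀ : E) (w : ℕ → E) (n : ℕ) : E :=
  (evenPath f S h x₀ w n).1 - (evenPath f S h x₀ w n).2

/-- The noise contribution to the gap that is odd in the increment `x`. -/
def gapOdd (y : E × E) (x : E) : E :=
  -(h / 2) • (∇ f (fineMean (∇ f) S h y.1 y.2 + √2 • x)
    - ∇ f (fineMean (∇ f) S h y.1 y.2 - √2 • x))

/-- The noise contribution to the gap that is even in the increment `x`. -/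
def gapRem (y : E × E) (x : E) : E :=
  -(h / 2) • (∇ f (fineMean (∇ f) S h y.1 y.2 + √2 • x)
    + ∇ f (fineMean (∇ f) S h y.1 y.2 - √2 • x) - (2 : ℝ) • ∇ f (fineMean (∇ f) S h y.1 y.2))

/-- F(A + √2x) is written as F(A) plus half its odd difference plus half its second difference. The
odd term has mean zero by symmetry and the remaining one is quadratic in x; this gains half an order
over the plain Lipschitz bound. -/
theorem gap_succ (x₀ : E) (w : ℕ → E) (n : ℕ) :
    gap f S h x₀ w (n + 1)
      = gapMean (∇ f) S h (evenPath f S h x₀ w n).1 (evenPath f S h x₀ w n).2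
        + gapOdd f S h (evenPath f S h x₀ w n) (w (2 * n))
        + gapRem f S h (evenPath f S h x₀ w n) (w (2 * n)) := by
  rw [gap, evenPath_succ_fst, evenPath_succ_snd, gapMean, gapOdd, gapRem, midGap]
  generalize ∇ f (fineMean (∇ f) S h (evenPath f S h x₀ w n).1 (evenPath f S h x₀ w n).2
    + √2 • w (2 * n)) = p
  generalize ∇ f (fineMean (∇ f) S h (evenPath f S h x₀ w n).1 (evenPath f S h x₀ w n).2
    - √2 • w (2 * n)) = q
  generalize ∇ f (fineMean (∇ f) S h (evenPath f S h x₀ w n).1 (evenPath f S h x₀ w n).2) = r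
  simp only [fineMean, coarseMean]
  module

/-! ### The weights -/

/-- Logarithm of the exponential martingale with integrands `P`, `Q`. -/
def logWeight (P Q : E × E → E) (x₀ : E) (w : ℕ → E) (N : ℕ) : ℝ :=
  ∑ n ∈ Finset.range N,
    (inner ℝ (P (evenPath f S h x₀ w n)) (w (2 * n))
      + inner ℝ (Q (evenPath f S h x₀ w n)) (w (2 * n + 1))
      - h / 2 * (‖P (evenPath f S h x₀ w n)‖ ^ 2 + ‖Q (evenPath f S h x₀ w n)‖ ^ 2))

theorem logWeight_succ (P Q : E × E → E) (x₀ : E) (w : ℕ → E) (N : ℕ) :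
    logWeight f S h P Q x₀ w (N + 1) = logWeight f S h P Q x₀ w N
      + (inner ℝ (P (evenPath f S h x₀ w N)) (w (2 * N))
      + inner ℝ (Q (evenPath f S h x₀ w N)) (w (2 * N + 1))
      - h / 2 * (‖P (evenPath f S h x₀ w N)‖ ^ 2 + ‖Q (evenPath f S h x₀ w N)‖ ^ 2)) :=
  Finset.sum_range_succ _ _

/-- Integrand of the weight of the fine path in the even steps. -/
def fineP (y : E × E) : E := (S / √2) • (y.1 - y.2)

/-- Integrand of the weight of the fine path in the odd steps. -/
def fineQ (y : E × E) : E := (S / √2) • midGap (∇ f) S h y.1 y.2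

/-- Integrand of the weight of the coarse path. -/
def coarseP (y : E × E) : E := -(S / √2) • (y.1 - y.2)

theorem coupledPath_even (x₀ : E) (w : ℕ → E) (n : ℕ) :
    coupledPath f S h x₀ w (2 * n) = evenPath f S h x₀ w n := by
  simp [coupledPath]

theorem coupledPath_odd (x₀ : E) (w : ℕ → E) (n : ℕ) :
    coupledPath f S h x₀ w (2 * n + 1)
      = oddStep f S h (evenPath f S h x₀ w n) (w (2 * n)) := by
  have h1 : (2 * n + 1) % 2 = 1 := by omega
  have h2 : (2 * n + 1) / 2 = n := by omega
  simp [coupledPath, h1, h2]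

theorem coupledPath_even_succ (x₀ : E) (w : ℕ → E) (n : ℕ) :
    coupledPath f S h x₀ w (2 * n + 2) = evenPath f S h x₀ w (n + 1) :=
  coupledPath_even f S h x₀ w (n + 1)

variable {h} in
-- With p = −s/√2 the logarithm becomes ⟨p, w⟩ − (h/2)‖p‖², the form whose exponential has Gaussian
-- mean one.
theorem stepWeight_of_eq (hh : 0 < h) (y' y s w : E) (hy : y' - y + h • ∇ f y = h • s + √2 • w) :
    stepWeight f y' y s h
      = Real.exp (inner ℝ (-(1 / √2) • s) w - h / 2 * ‖-(1 / √2) • s‖ ^ 2) := by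
  rw [stepWeight_eq f y' y s hh, hy]
  congr 1
  have h2 : √2 ^ 2 = 2 := Real.sq_sqrt (by norm_num)
  have h3 : (1 / √2) ^ 2 = 1 / 2 := by rw [div_pow, h2, one_pow]
  have h4 : 1 / √2 = √2 / 2 := by
    field_simp
    exact h2.symm
  rw [inner_add_left, inner_smul_left, inner_smul_left, inner_smul_left,
    real_inner_self_eq_norm_sq, norm_smul_sq, neg_sq, h3, real_inner_comm w s, h4]
  simp only [conj_trivial]
  ring

variable {h} in
theorem fineWeight_eq (hh : 0 < h) (x₀ : E) (w : ℕ → E) (N : ℕ) :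
    fineWeight f S h x₀ w N
      = Real.exp (logWeight f S h (fineP S) (fineQ f S h) x₀ w N) := by
  induction N with
  | zero => simp [fineWeight, logWeight]
  | succ N ih =>
    have e2 : 2 * (N + 1) = 2 * N + 1 + 1 := by ring
    have ih' := ih
    unfold fineWeight at ih'
    rw [fineWeight, e2, Finset.prod_range_succ, Finset.prod_range_succ, ih', logWeight_succ,
      Real.exp_add, mul_assoc]
    congr 1
    simp only [fineY, coarseY, coupledPath_even, coupledPath_odd,
      show 2 * N + 1 + 1 = 2 * N + 2 from rfl, coupledPath_even_succ]
    rw [stepWeight_of_eq f hh _ _ _ (w (2 * N)), stepWeight_of_eq f hh _ _ _ (w (2 * N + 1)),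
      ← Real.exp_add]
    · congr 1
      have p1 : -(1 / √2) • S • ((evenPath f S h x₀ w N).2 - (evenPath f S h x₀ w N).1)
          = fineP S (evenPath f S h x₀ w N) := by
        rw [fineP, div_eq_mul_one_div]; module
      have p2 : -(1 / √2) • S • ((oddStep f S h (evenPath f S h x₀ w N) (w (2 * N))).2
          - (oddStep f S h (evenPath f S h x₀ w N) (w (2 * N))).1)
          = fineQ f S h (evenPath f S h x₀ w N) := by
        rw [fineQ, ← oddStep_gap f S h _ (w (2 * N)), div_eq_mul_one_div]; module
      rw [p1, p2]
      ring
    · simp only [evenPath, evenStep]; module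
    · simp only [oddStep]; module

variable {h} in
-- A coarse step sees the sum of two increments with the same integrand and length 2h, so it splits
-- into two exponential martingale factors of length h.
theorem coarseWeight_eq (hh : 0 < h) (x₀ : E) (w : ℕ → E) (N : ℕ) :
    coarseWeight f S h x₀ w N
      = Real.exp (logWeight f S h (coarseP S) (coarseP S) x₀ w N) := by
  rw [coarseWeight, logWeight, Real.exp_sum]
  refine Finset.prod_congr rfl fun n _ => ?_
  simp only [fineY, coarseY, coupledPath_even, coupledPath_even_succ]
  rw [stepWeight_of_eq f (by positivity : 0 < 2 * h) _ _ _ (w (2 * n) + w (2 * n + 1))]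
  · congr 1
    have p1 : -(1 / √2) • S • ((evenPath f S h x₀ w n).1 - (evenPath f S h x₀ w n).2)
        = coarseP S (evenPath f S h x₀ w n) := by
      rw [coarseP, div_eq_mul_one_div]; module
    rw [p1, inner_add_right]
    ring
  · rw [evenPath_succ_snd, coarseMean]; module

theorem levelDifference_eq {f φ : E → ℝ} {S h : ℝ} (hh : 0 < h) (x₀ : E) (w : ℕ → E) (N : ℕ) :
    levelDifference f φ S h x₀ w N
      = φ (evenPath f S h x₀ w N).1
          * Real.exp (logWeight f S h (fineP S) (fineQ f S h) x₀ w N)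
        - φ (evenPath f S h x₀ w N).2
          * Real.exp (logWeight f S h (coarseP S) (coarseP S) x₀ w N) := by
  rw [levelDifference, fineWeight_eq f S hh, coarseWeight_eq f S hh, fineY, coarseY,
    coupledPath_even]

end

/-! ### Exponential moments of the paths -/

section

variable {d : ℕ}

local notation "E" => EuclideanSpace ℝ (Fin d)

theorem norm_add_sqrt_two_smul_sq (p y : E) :
    ‖p + √2 • y‖ ^ 2 = ‖p‖ ^ 2 + 2 * √2 * inner ℝ p y + 2 * ‖y‖ ^ 2 := by
  rw [norm_add_sq_real, norm_smul_sq, inner_smul_right, Real.sq_sqrt (by norm_num)]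
  ring

/-- The exponent is quadratic in y with linear part 2√2 c⟨p + q, y⟩ and quadratic part 4c‖y‖².
Integrating it out inflates c only by the factor 1 + 16ch. -/
theorem lintegral_exp_pair_le {h c : ℝ} (hd : 1 ≤ d) (hh : 0 < h) (hc : 0 ≤ c)
    (hch : c * d * h ≤ 1 / 32) (p q : E) :
    ∫⁻ y : E, ENNReal.ofReal (Real.exp (c * (‖p + √2 • y‖ ^ 2 + ‖q + √2 • y‖ ^ 2))) ∂(gaussLaw d h)
      ≤ ENNReal.ofReal
        (Real.exp (c * (1 + 16 * (c * h)) * (‖p‖ ^ 2 + ‖q‖ ^ 2) + 8 * (c * d * h))) := by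
  have key := lintegral_exp_inner_add_norm_sq (b := 4 * c) hd hh (by positivity) (by linarith)
    ((2 * √2 * c) • (p + q))
  have e : ∀ y : E, ENNReal.ofReal (Real.exp (c * (‖p + √2 • y‖ ^ 2 + ‖q + √2 • y‖ ^ 2)))
      = ENNReal.ofReal (Real.exp (c * (‖p‖ ^ 2 + ‖q‖ ^ 2)))
        * ENNReal.ofReal (Real.exp (inner ℝ ((2 * √2 * c) • (p + q)) y + 4 * c * ‖y‖ ^ 2)) := by
    intro y
    rw [← ENNReal.ofReal_mul (Real.exp_pos _).le, ← Real.exp_add, norm_add_sqrt_two_smul_sq,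
      norm_add_sqrt_two_smul_sq, inner_smul_left, inner_add_left]
    simp only [conj_trivial]
    congr 2
    ring
  rw [lintegral_congr e, lintegral_const_mul _ (by fun_prop)]
  refine (mul_le_mul_right key _).trans ?_
  rw [← ENNReal.ofReal_mul (Real.exp_pos _).le, ← Real.exp_add]
  refine ENNReal.ofReal_le_ofReal (Real.exp_le_exp.mpr ?_)
  rw [norm_smul_sq]
  have h2 : √2 ^ 2 = 2 := Real.sq_sqrt (by norm_num)
  have h3 := mul_le_mul_of_nonneg_left (norm_add_sq_le_two_mul p q)
    (by positivity : 0 ≤ h * (8 * c ^ 2))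
  have h4 : h * ((2 * √2 * c) ^ 2 * ‖p + q‖ ^ 2) = h * (8 * c ^ 2) * ‖p + q‖ ^ 2 := by
    rw [mul_pow, mul_pow, h2]; ring
  rw [h4]
  linarith

/-- Rate of the exponential moment. -/
noncomputable def expRate (d : ℕ) (α : ℝ) : ℝ := α / (10000 * d)

theorem expRate_nonneg {α : ℝ} (hα : 0 ≤ α) : 0 ≤ expRate d α := by unfold expRate; positivity

theorem expRate_mul {α : ℝ} (hd : 1 ≤ d) : expRate d α * d = α / 10000 := by
  have hd' : (d : ℝ) ≠ 0 := by positivity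
  unfold expRate; field_simp

theorem expRate_le {α : ℝ} (hα : 0 ≤ α) (hd : 1 ≤ d) : expRate d α ≤ α / 10000 := by
  rw [← expRate_mul hd]
  exact le_mul_of_one_le_right (expRate_nonneg hα) (by exact_mod_cast hd)

/-- D stands for the dimension and V for the squared slope. Because cD = α/10000, the dimensional
terms cDh are a small multiple of αh. The terms c²hU are at most (αh/10000)·cU, so a quarter of the
dissipation survives. -/
theorem lyapunov_exponent_le {c c' α β h U D V : ℝ} (hc : 0 ≤ c) (hcα : c ≤ α / 10000)
    (hcD : c * D = α / 10000) (hh : 0 < h) (hα : 0 < α) (hβ : 0 ≤ β)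
    (hαh : α * h ≤ 1 / 1000) (hU : 0 ≤ U) (hV : V ≤ 7 * U + h * (18 * β + 1))
    (hc' : c' = c * (1 + 16 * (c * h))) :
    c' * ((1 - α * h) * U + h * (8 * β + 1)) + 8 * (c * D * h) + h * (8 * c' ^ 2 * V)
        + 8 * (c' * D * h)
      ≤ (1 - α * h / 4) * (c * U) + α * h / 4 * (β + 1) := by
  have hch : c * h ≤ 1 / 10000000 := by nlinarith
  have hch0 : 0 ≤ c * h := by positivity
  have hαh0 : 0 < α * h := by positivity
  have c'1 : c' ≤ 2 * c := by rw [hc']; nlinarith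
  have c'0 : 0 ≤ c' := by rw [hc']; positivity
  have c'2 : c' ≤ α / 5000 := by linarith
  have cu0 : 0 ≤ c * U := by positivity
  have t1 : c' * ((1 - α * h) * U) ≤ (1 - α * h / 2) * (c * U) := by
    have e : c' * ((1 - α * h) * U) = (1 + 16 * (c * h)) * (1 - α * h) * (c * U) := by
      rw [hc']; ring
    rw [e]
    refine mul_le_mul_of_nonneg_right ?_ cu0
    have : c * h ≤ α * h / 10000 := by nlinarith
    nlinarith
  have t2 : c' * (h * (8 * β + 1)) ≤ α * h / 5000 * (8 * β + 1) := by
    have : c' * h ≤ α * h / 5000 := by nlinarith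
    nlinarith
  have t3 : c * D * h = α * h / 10000 := by rw [hcD]; ring
  have t4 : c' * D * h ≤ α * h / 5000 := by
    have : c' * D * h = (1 + 16 * (c * h)) * (c * D * h) := by rw [hc']; ring
    rw [this, t3]
    nlinarith
  have t5 : h * (8 * c' ^ 2 * V) ≤ α * h / 20 * (c * U) + α * h / 100 * (β + 1) := by
    have s1 : h * (8 * c' ^ 2 * V) ≤ h * (8 * c' ^ 2 * (7 * U + h * (18 * β + 1))) := by gcongr
    have s2 : 8 * c' ^ 2 ≤ α / 250 * c := by nlinarith
    have s3 : c * (h * (18 * β + 1)) ≤ β + 1 := by nlinarith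
    have s4 : h * (8 * c' ^ 2 * (7 * U + h * (18 * β + 1)))
        ≤ h * (α / 250 * c * (7 * U + h * (18 * β + 1))) := by gcongr
    have s5 : h * (α / 250 * c * (7 * U + h * (18 * β + 1)))
        = α * h * 7 / 250 * (c * U) + α * h / 250 * (c * (h * (18 * β + 1))) := by ring
    have s6 := mul_le_mul_of_nonneg_left s3 (by positivity : 0 ≤ α * h / 250)
    have : 0 ≤ α * h * (c * U) := by positivity
    have : 0 ≤ α * h * (β + 1) := by positivity
    linarith
  have : 0 ≤ α * h * (c * U) := by positivity
  have : 0 ≤ α * h * β := by positivity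
  nlinarith

/-- The second increment is integrated out first, then `lyapunov_le` makes the exponent quadratic in
the first one. -/
theorem lyapunov_exp_step {F : E → E} {L lam α β G S h ε : ℝ} (hF : DriftBounds F L lam α β G)
    (H : SmallStep ε S L α G h) (hε0 : 0 ≤ ε) (hε : ε ≤ 1 / 1000) (hd : 1 ≤ d) (hβ : 0 ≤ β)
    (a c : E) :
    ∫⁻ x, ∫⁻ y, ENNReal.ofReal (Real.exp (expRate d α *
        (‖fineMean F S h a c + √2 • x
            - h • (S • midGap F S h a c + F (fineMean F S h a c + √2 • x)) + √2 • y‖ ^ 2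
          + ‖coarseMean F S h a c + √2 • x + √2 • y‖ ^ 2))) ∂(gaussLaw d h) ∂(gaussLaw d h)
      ≤ ENNReal.ofReal (Real.exp ((1 - α * h / 4) * (expRate d α * (‖a‖ ^ 2 + ‖c‖ ^ 2))
          + α * h / 4 * (β + 1))) := by
  set r := expRate d α with hr
  have hh := H.h_pos
  have hα := H.α_pos
  have hr0 : 0 ≤ r := expRate_nonneg hα.le
  have hrα : r ≤ α / 10000 := expRate_le hα.le hd
  have hrd : r * d = α / 10000 := expRate_mul hd
  have hαh : α * h ≤ 1 / 1000 := (H.hα hε0).trans hε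
  have hrh : r * d * h ≤ 1 / 32 := by rw [hrd]; linarith
  have hrh' : r * h ≤ 1 / 10000000 := by nlinarith
  set r' := r * (1 + 16 * (r * h)) with hr'
  have r'0 : 0 ≤ r' := by positivity
  have r'2 : r' ≤ 2 * r := by rw [hr']; nlinarith
  set v := lyapunovSlope F S α h a c with hv
  set R₀ := (1 - α * h) * (‖a‖ ^ 2 + ‖c‖ ^ 2) + h * (8 * β + 1) with hR₀
  have hd0 : (0 : ℝ) ≤ d := by positivity
  have key := lintegral_exp_inner_add_norm_sq (b := 4 * r') hd hh (by positivity)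
    (by
      have : r' * d * h ≤ 2 * r * d * h := by gcongr
      nlinarith) ((2 * √2 * r') • v)
  calc _ ≤ ∫⁻ x : E, ENNReal.ofReal (Real.exp (r' * R₀ + 8 * (r * d * h)))
        * ENNReal.ofReal (Real.exp (inner ℝ ((2 * √2 * r') • v) x + 4 * r' * ‖x‖ ^ 2))
          ∂(gaussLaw d h) := by
        refine lintegral_mono fun x => ?_
        refine (lintegral_exp_pair_le hd hh hr0 hrh _ _).trans ?_
        rw [← ENNReal.ofReal_mul (Real.exp_pos _).le, ← Real.exp_add]
        refine ENNReal.ofReal_le_ofReal (Real.exp_le_exp.mpr ?_)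
        have h1 := mul_le_mul_of_nonneg_left (hF.lyapunov_le H hε0 hε a c (√2 • x)) r'0
        rw [norm_smul_sq, Real.sq_sqrt (by norm_num), inner_smul_right] at h1
        rw [inner_smul_left]
        simp only [conj_trivial]
        linarith
    _ ≤ ENNReal.ofReal (Real.exp (r' * R₀ + 8 * (r * d * h)))
        * ENNReal.ofReal (Real.exp (h * ‖(2 * √2 * r') • v‖ ^ 2 + 2 * (4 * r' * d * h))) := by
        rw [lintegral_const_mul _ (by fun_prop)]
        exact mul_le_mul_right key _
    _ ≤ _ := by
        rw [← ENNReal.ofReal_mul (Real.exp_pos _).le, ← Real.exp_add]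
        refine ENNReal.ofReal_le_ofReal (Real.exp_le_exp.mpr ?_)
        have h2 : √2 ^ 2 = 2 := Real.sq_sqrt (by norm_num)
        have h3 := lyapunov_exponent_le hr0 hrα hrd hh hα hβ hαh
          (by positivity : 0 ≤ ‖a‖ ^ 2 + ‖c‖ ^ 2) (hF.lyapunovSlope_sq_le H hε0 hε a c) hr'
        rw [norm_smul_sq, mul_pow, mul_pow, h2]
        linarith

theorem lintegral_exp_path_le {f : E → ℝ} {L lam α β G S h ε r : ℝ}
    (hF : DriftBounds (∇ f) L lam α β G) (hfm : Measurable (∇ f))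
    (H : SmallStep ε S L α G h) (hε0 : 0 ≤ ε) (hε : ε ≤ 1 / 1000) (hd : 1 ≤ d) (hβ : 0 ≤ β)
    {x₀ : E} (hx₀ : ‖x₀‖ ≤ r) (n : ℕ) :
    ∫⁻ w, ENNReal.ofReal (Real.exp (expRate d α * (‖(evenPath f S h x₀ w n).1‖ ^ 2
        + ‖(evenPath f S h x₀ w n).2‖ ^ 2))) ∂(seqLaw d h)
      ≤ ENNReal.ofReal (Real.exp (β + 1 + α * r ^ 2)) := by
  have hα := H.α_pos
  have hh := H.h_pos
  have hαh : α * h ≤ 1 / 1000 := (H.hα hε0).trans hε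
  have hαh0 : 0 < α * h := by positivity
  induction n with
  | zero =>
    simp only [evenPath, lintegral_const, measure_univ, mul_one]
    refine ENNReal.ofReal_le_ofReal (Real.exp_le_exp.mpr ?_)
    have h1 := expRate_le hα.le hd
    have h2 : ‖x₀‖ ^ 2 ≤ r ^ 2 := pow_le_pow_left₀ (norm_nonneg _) hx₀ 2
    have h3 := expRate_nonneg (d := d) hα.le
    nlinarith [mul_le_mul h1 h2 (by positivity) (by positivity), mul_nonneg hα.le (sq_nonneg r)]
  | succ n ih =>
    have hm := measurable_evenPath_right S h hfm x₀ n
    have c2 := lintegral_infinitePi_eval_two (gaussLaw d h) (2 * n)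
      (Φ := fun w x y => ENNReal.ofReal (Real.exp (expRate d α *
        (‖fineMean (∇ f) S h (evenPath f S h x₀ w n).1 (evenPath f S h x₀ w n).2 + √2 • x
            - h • (S • midGap (∇ f) S h (evenPath f S h x₀ w n).1 (evenPath f S h x₀ w n).2
              + ∇ f (fineMean (∇ f) S h (evenPath f S h x₀ w n).1 (evenPath f S h x₀ w n).2
                + √2 • x)) + √2 • y‖ ^ 2
          + ‖coarseMean (∇ f) S h (evenPath f S h x₀ w n).1 (evenPath f S h x₀ w n).2
            + √2 • x + √2 • y‖ ^ 2))))
      (by simp only [fineMean, midGap, coarseMean]; fun_prop)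
      (fun w w' x y hw => by rw [evenPath_congr f S h x₀ hw])
    have e : ∀ w : ℕ → E, ENNReal.ofReal (Real.exp (expRate d α *
        (‖(evenPath f S h x₀ w (n + 1)).1‖ ^ 2 + ‖(evenPath f S h x₀ w (n + 1)).2‖ ^ 2)))
        = _ := fun w => by rw [evenPath_succ_fst, evenPath_succ_snd]
    rw [lintegral_congr e]
    unfold seqLaw at ih ⊢
    rw [c2]
    set B := β + 1 + α * r ^ 2 with hB
    -- Convexity of exp turns the contraction of the exponent into one of the exponential moment.
    -- Since β + 1 ≤ B, the value exp B reproduces itself, which makes the bound uniform in n.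
    have conv : ∀ u : ℝ, Real.exp ((1 - α * h / 4) * u + α * h / 4 * (β + 1))
        ≤ (1 - α * h / 4) * Real.exp u + α * h / 4 * Real.exp B := by
      intro u
      have h1 := convexOn_exp.2 (Set.mem_univ u) (Set.mem_univ B)
        (by linarith : 0 ≤ 1 - α * h / 4) (by positivity : 0 ≤ α * h / 4) (by ring)
      simp only [smul_eq_mul] at h1
      refine le_trans (Real.exp_le_exp.mpr ?_) h1
      have : β + 1 ≤ B := by rw [hB]; nlinarith [mul_nonneg hα.le (sq_nonneg r)]
      nlinarith
    calc _ ≤ ∫⁻ w, (ENNReal.ofReal (1 - α * h / 4) * ENNReal.ofReal (Real.exp (expRate d α *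
            (‖(evenPath f S h x₀ w n).1‖ ^ 2 + ‖(evenPath f S h x₀ w n).2‖ ^ 2)))
            + ENNReal.ofReal (α * h / 4 * Real.exp B))
            ∂(Measure.infinitePi fun _ : ℕ => gaussLaw d h) := by
          refine lintegral_mono fun w => ?_
          refine (lyapunov_exp_step hF H hε0 hε hd hβ _ _).trans ?_
          rw [← ENNReal.ofReal_mul (by linarith), ← ENNReal.ofReal_add
            (mul_nonneg (by linarith) (Real.exp_pos _).le) (by positivity)]
          exact ENNReal.ofReal_le_ofReal (conv _)
      _ ≤ ENNReal.ofReal (1 - α * h / 4) * ENNReal.ofReal (Real.exp B)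
            + ENNReal.ofReal (α * h / 4 * Real.exp B) := by
          rw [lintegral_add_right _ measurable_const, lintegral_const_mul _ (by fun_prop)]
          simp only [lintegral_const, measure_univ, mul_one]
          gcongr
      _ = _ := by
          rw [← ENNReal.ofReal_mul (by linarith), ← ENNReal.ofReal_add
            (mul_nonneg (by linarith) (Real.exp_pos _).le) (by positivity)]
          congr 1; ring

end

/-! ### Moment estimates -/

section Moments

variable {Ω : Type*} [MeasurableSpace Ω] {μ : Measure Ω}
  {V : Type*} [NormedAddCommGroup V]

theorem eLpNorm_nat_pow (X : Ω → V) {k : ℕ} (hk : k ≠ 0) :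
    eLpNorm X (k : ℝ≥0∞) μ ^ k = ∫⁻ ω, ENNReal.ofReal (‖X ω‖ ^ k) ∂μ := by
  have hk' : (k : ℝ≥0∞) ≠ 0 := by exact_mod_cast hk
  have hk'' : (k : ℝ) ≠ 0 := by exact_mod_cast hk
  rw [eLpNorm_eq_lintegral_rpow_enorm_toReal hk' (ENNReal.natCast_ne_top k), ENNReal.toReal_natCast,
    ← ENNReal.rpow_natCast, ← ENNReal.rpow_mul, one_div_mul_cancel hk'', ENNReal.rpow_one]
  refine lintegral_congr fun ω => ?_
  rw [ENNReal.rpow_natCast, ENNReal.ofReal_pow (norm_nonneg _), ofReal_norm]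

theorem eLpNorm_nat_le_iff (X : Ω → V) {k : ℕ} (hk : k ≠ 0) {A : ℝ} (hA : 0 ≤ A) :
    eLpNorm X (k : ℝ≥0∞) μ ≤ ENNReal.ofReal A ↔
      ∫⁻ ω, ENNReal.ofReal (‖X ω‖ ^ k) ∂μ ≤ ENNReal.ofReal (A ^ k) := by
  rw [← eLpNorm_nat_pow X hk, ENNReal.ofReal_pow hA]
  exact (ENNReal.pow_le_pow_left_iff hk).symm

/-- Constant in the moment bound deduced from an exponential moment. -/
noncomputable def momentConst (k : ℕ) (B : ℝ) : ℝ := (k.factorial : ℝ) * Real.exp B + 1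

theorem momentConst_ge_one (k : ℕ) (B : ℝ) : 1 ≤ momentConst k B := by
  unfold momentConst
  have : 0 ≤ (k.factorial : ℝ) * Real.exp B := by positivity
  linarith

theorem eLpNorm_le_of_exp_moment {X : Ω → V} {c B : ℝ} (hc : 0 < c)
    (h : ∫⁻ ω, ENNReal.ofReal (Real.exp (c * ‖X ω‖ ^ 2)) ∂μ ≤ ENNReal.ofReal (Real.exp B))
    {k : ℕ} (hk : k ≠ 0) :
    eLpNorm X ((2 * k : ℕ) : ℝ≥0∞) μ ≤ ENNReal.ofReal (momentConst k B / √c) := by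
  have hM := momentConst_ge_one k B
  have hsc : 0 < √c := Real.sqrt_pos.mpr hc
  rw [eLpNorm_nat_le_iff X (by omega) (by positivity)]
  have hfac : (0 : ℝ) < k.factorial := by exact_mod_cast k.factorial_pos
  have key : ∀ ω, ENNReal.ofReal (‖X ω‖ ^ (2 * k))
      ≤ ENNReal.ofReal (k.factorial / c ^ k) * ENNReal.ofReal (Real.exp (c * ‖X ω‖ ^ 2)) := by
    intro ω
    rw [← ENNReal.ofReal_mul (by positivity)]
    refine ENNReal.ofReal_le_ofReal ?_
    have h1 := Real.pow_div_factorial_le_exp (c * ‖X ω‖ ^ 2) (by positivity) k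
    rw [div_le_iff₀ hfac, mul_pow] at h1
    rw [div_mul_eq_mul_div, le_div_iff₀ (by positivity), pow_mul]
    linarith
  calc _ ≤ ∫⁻ ω, ENNReal.ofReal (k.factorial / c ^ k)
        * ENNReal.ofReal (Real.exp (c * ‖X ω‖ ^ 2)) ∂μ := lintegral_mono key
    _ = ENNReal.ofReal (k.factorial / c ^ k)
        * ∫⁻ ω, ENNReal.ofReal (Real.exp (c * ‖X ω‖ ^ 2)) ∂μ :=
      lintegral_const_mul' _ _ ENNReal.ofReal_ne_top
    _ ≤ ENNReal.ofReal (k.factorial / c ^ k) * ENNReal.ofReal (Real.exp B) := by gcongr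
    _ = ENNReal.ofReal (k.factorial * Real.exp B / c ^ k) := by
      rw [← ENNReal.ofReal_mul (by positivity)]; congr 1; ring
    _ ≤ _ := by
      refine ENNReal.ofReal_le_ofReal ?_
      rw [div_pow, pow_mul √c, Real.sq_sqrt hc.le]
      gcongr
      -- The summand 1 in `momentConst` makes it at least 1, so that the root of order 2k may be
      -- dropped.
      have h2 : momentConst k B ≤ momentConst k B ^ (2 * k) := le_self_pow₀ hM (by omega)
      unfold momentConst at h2 ⊢
      linarith

theorem eLpNorm_norm_sq (X : Ω → V) {k : ℕ} (hk : k ≠ 0) :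
    eLpNorm (fun ω => ‖X ω‖ ^ 2) (k : ℝ≥0∞) μ = eLpNorm X ((2 * k : ℕ) : ℝ≥0∞) μ ^ 2 := by
  have h1 := eLpNorm_nat_pow (μ := μ) (fun ω => ‖X ω‖ ^ 2) hk
  have h2 := eLpNorm_nat_pow (μ := μ) X (k := 2 * k) (by omega)
  have e : ∫⁻ ω, ENNReal.ofReal (‖‖X ω‖ ^ 2‖ ^ k) ∂μ = ∫⁻ ω, ENNReal.ofReal (‖X ω‖ ^ (2 * k)) ∂μ := by
    refine lintegral_congr fun ω => ?_
    rw [Real.norm_of_nonneg (by positivity), pow_mul]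
  rw [e, ← h2, pow_mul] at h1
  exact (ENNReal.pow_right_strictMono hk).injective h1

end Moments

/-! ### Symmetric increments -/

/-- Constant in the moment inequality for symmetric increments. -/
noncomputable def symmConst (k : ℕ) : ℝ := 1 + 2 * k * Real.exp (k / 2)

theorem symmConst_ge_one (k : ℕ) : 1 ≤ symmConst k := by
  unfold symmConst
  have : 0 ≤ 2 * (k : ℝ) * Real.exp (k / 2) := by positivity
  linarith

/-- The left side is at most 2cosh(kτ) ≤ 2exp(k²τ²/2), which is twice a k-th power; then eʸ ≤ 1 + y
eʸ for y = kτ²/2 ≤ k/2. -/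
theorem one_add_pow_add_one_sub_pow_le {τ : ℝ} (h1 : |τ| ≤ 1) (k : ℕ) :
    (1 + τ) ^ k + (1 - τ) ^ k ≤ 2 * (1 + k / 2 * Real.exp (k / 2) * τ ^ 2) ^ k := by
  obtain ⟨ha, hb⟩ := abs_le.mp h1
  have e1 : (1 + τ) ^ k ≤ Real.exp (k * τ) := by
    rw [Real.exp_nat_mul]
    exact pow_le_pow_left₀ (by linarith) (by linarith [Real.add_one_le_exp τ]) k
  have e2 : (1 - τ) ^ k ≤ Real.exp (-(k * τ)) := by
    rw [← mul_neg, Real.exp_nat_mul]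
    exact pow_le_pow_left₀ (by linarith) (by linarith [Real.add_one_le_exp (-τ)]) k
  have e3 := Real.cosh_le_exp_half_sq (k * τ)
  rw [Real.cosh_eq] at e3
  have e4 : Real.exp ((k * τ) ^ 2 / 2) = Real.exp (k / 2 * τ ^ 2) ^ k := by
    rw [← Real.exp_nat_mul]; congr 1; ring
  have e5 : Real.exp (k / 2 * τ ^ 2) ≤ 1 + k / 2 * Real.exp (k / 2) * τ ^ 2 := by
    set y : ℝ := k / 2 * τ ^ 2 with hy
    have hy0 : 0 ≤ y := by positivity
    have hτ : τ ^ 2 ≤ 1 := by rw [← sq_abs]; exact pow_le_one₀ (abs_nonneg _) h1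
    have hy1 : y ≤ k / 2 := by rw [hy]; exact mul_le_of_le_one_right (by positivity) hτ
    have h2 : 1 - y ≤ Real.exp (-y) := by linarith [Real.add_one_le_exp (-y)]
    have h3 : (1 - y) * Real.exp y ≤ 1 := by
      calc _ ≤ Real.exp (-y) * Real.exp y := by gcongr
        _ = 1 := by rw [← Real.exp_add]; simp
    have h4 : y * Real.exp y ≤ y * Real.exp (k / 2) := by gcongr
    have h5 : y * Real.exp (k / 2) = k / 2 * Real.exp (k / 2) * τ ^ 2 := by rw [hy]; ring
    linarith
  have e6 := pow_le_pow_left₀ (Real.exp_pos _).le e5 k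
  rw [e4] at e3
  linarith

/-- A pointwise two-point inequality of 2-smoothness type. Apply the scalar case to τ = 2⟨a, x⟩/s
with s = ‖a‖² + ‖x‖², for which sτ² ≤ 4‖x‖². -/
theorem norm_add_pow_add_norm_sub_pow_le {V : Type*} [NormedAddCommGroup V] [InnerProductSpace ℝ V]
    (a x : V) (k : ℕ) :
    ‖a + x‖ ^ (2 * k) + ‖a - x‖ ^ (2 * k) ≤ 2 * (‖a‖ ^ 2 + symmConst k * ‖x‖ ^ 2) ^ k := by
  rw [pow_mul, pow_mul, norm_add_sq_real, norm_sub_sq_real]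
  set s := ‖a‖ ^ 2 + ‖x‖ ^ 2 with hs
  set t := 2 * inner ℝ a x with ht
  have hs0 : 0 ≤ s := by positivity
  have ht1 : |t| ≤ 2 * (‖a‖ * ‖x‖) := by
    rw [ht, abs_mul, abs_two]
    exact mul_le_mul_of_nonneg_left (abs_real_inner_le_norm a x) (by norm_num)
  have ht2 : |t| ≤ s := ht1.trans (by rw [hs]; nlinarith [sq_nonneg (‖a‖ - ‖x‖)])
  have ht3 : t ^ 2 ≤ 4 * s * ‖x‖ ^ 2 := by
    have h1 : t ^ 2 ≤ (2 * (‖a‖ * ‖x‖)) ^ 2 := by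
      rw [← sq_abs]; exact pow_le_pow_left₀ (abs_nonneg _) ht1 2
    have h2 : 0 ≤ ‖x‖ ^ 2 * ‖x‖ ^ 2 := by positivity
    rw [hs]
    linarith
  rw [show ‖a‖ ^ 2 + t + ‖x‖ ^ 2 = s + t by rw [hs]; ring,
    show ‖a‖ ^ 2 - t + ‖x‖ ^ 2 = s - t by rw [hs]; ring]
  rcases hs0.eq_or_lt with h0 | hpos
  · have hx : ‖x‖ ^ 2 = 0 := by nlinarith [sq_nonneg ‖a‖, sq_nonneg ‖x‖]
    have ha : ‖a‖ ^ 2 = 0 := by nlinarith [sq_nonneg ‖a‖, sq_nonneg ‖x‖]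
    have ht0 : t = 0 := by rw [← h0] at ht2; exact abs_nonpos_iff.mp ht2
    rw [← h0, ht0, hx, ha]
    simp [two_mul]
  · set τ := t / s with hτ
    have hts : t = s * τ := by rw [hτ]; field_simp
    have hτ1 : |τ| ≤ 1 := by rw [hτ, abs_div, abs_of_pos hpos]; exact div_le_one_of_le₀ ht2 hs0
    rw [show s + t = s * (1 + τ) by rw [hts]; ring, show s - t = s * (1 - τ) by rw [hts]; ring,
      mul_pow, mul_pow, ← mul_add]
    refine (mul_le_mul_of_nonneg_left (one_add_pow_add_one_sub_pow_le hτ1 k)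
      (pow_nonneg hs0 k)).trans ?_
    rw [mul_left_comm, ← mul_pow]
    have h6 : s * τ ^ 2 ≤ 4 * ‖x‖ ^ 2 := by
      have : s * (s * τ ^ 2) ≤ s * (4 * ‖x‖ ^ 2) := by
        calc s * (s * τ ^ 2) = t ^ 2 := by rw [hts]; ring
          _ ≤ _ := ht3.trans (le_of_eq (by ring))
      exact le_of_mul_le_mul_left this hpos
    refine mul_le_mul_of_nonneg_left (pow_le_pow_left₀ (by positivity) ?_ k) (by norm_num)
    have h7 := mul_le_mul_of_nonneg_left h6 (by positivity : 0 ≤ (k : ℝ) / 2 * Real.exp (k / 2))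
    unfold symmConst
    rw [hs]
    rw [hs] at h7
    linarith

/-- Moments of a sum with a symmetric increment grow quadratically. -/
theorem eLpNorm_add_le_of_symm {Ω : Type*} [MeasurableSpace Ω] {μ : Measure Ω}
    {V : Type*} [NormedAddCommGroup V] [InnerProductSpace ℝ V] {A X : Ω → V} {k : ℕ} (hk : k ≠ 0)
    (hAm : AEStronglyMeasurable A μ) (hXm : AEStronglyMeasurable X μ)
    (hsym : eLpNorm (fun ω => A ω - X ω) ((2 * k : ℕ) : ℝ≥0∞) μ
      = eLpNorm (fun ω => A ω + X ω) ((2 * k : ℕ) : ℝ≥0∞) μ)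
    {a x : ℝ} (ha0 : 0 ≤ a) (hx0 : 0 ≤ x)
    (ha : eLpNorm A ((2 * k : ℕ) : ℝ≥0∞) μ ≤ ENNReal.ofReal a)
    (hx : eLpNorm X ((2 * k : ℕ) : ℝ≥0∞) μ ≤ ENNReal.ofReal x) :
    eLpNorm (fun ω => A ω + X ω) ((2 * k : ℕ) : ℝ≥0∞) μ
      ≤ ENNReal.ofReal √(a ^ 2 + symmConst k * x ^ 2) := by
  have hC : 0 ≤ symmConst k := zero_le_one.trans (symmConst_ge_one k)
  have h2k : 2 * k ≠ 0 := by omega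
  have hY : eLpNorm (fun ω => ‖A ω‖ ^ 2 + symmConst k * ‖X ω‖ ^ 2) (k : ℝ≥0∞) μ
      ≤ ENNReal.ofReal (a ^ 2 + symmConst k * x ^ 2) := by
    have h1 : eLpNorm (fun ω => ‖A ω‖ ^ 2) (k : ℝ≥0∞) μ ≤ ENNReal.ofReal (a ^ 2) := by
      rw [eLpNorm_norm_sq A hk, ENNReal.ofReal_pow ha0]
      exact pow_le_pow_left₀ zero_le ha 2
    have h2 : eLpNorm (fun ω => symmConst k * ‖X ω‖ ^ 2) (k : ℝ≥0∞) μ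
        ≤ ENNReal.ofReal (symmConst k * x ^ 2) := by
      have e := eLpNorm_const_smul (symmConst k) (fun ω => ‖X ω‖ ^ 2) (k : ℝ≥0∞) μ
      have e' : (fun ω => symmConst k * ‖X ω‖ ^ 2) = symmConst k • fun ω => ‖X ω‖ ^ 2 := by
        ext ω; simp
      rw [e', e, eLpNorm_norm_sq X hk, ENNReal.ofReal_mul hC, ENNReal.ofReal_pow hx0,
        Real.enorm_of_nonneg hC]
      gcongr
    refine (eLpNorm_add_le (hAm.norm.pow 2) ((hXm.norm.pow 2).const_mul _) ?_).trans ?_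
    · exact_mod_cast Nat.one_le_iff_ne_zero.mpr hk
    · rw [ENNReal.ofReal_add (by positivity) (by positivity)]
      exact add_le_add h1 h2
  rw [eLpNorm_nat_le_iff _ hk (by positivity)] at hY
  rw [eLpNorm_nat_le_iff _ h2k (Real.sqrt_nonneg _), pow_mul, Real.sq_sqrt (by positivity)]
  have i1 := eLpNorm_nat_pow (μ := μ) (fun ω => A ω + X ω) h2k
  have i2 := eLpNorm_nat_pow (μ := μ) (fun ω => A ω - X ω) h2k
  rw [hsym, i1] at i2
  -- By symmetry twice the moment of A + X is the sum of the moments of A + X and A − X, to which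
  -- the pointwise inequality applies. The triangle inequality in Lᵏ for ‖A‖² + C‖X‖² finishes.
  have i3 : 2 * ∫⁻ ω, ENNReal.ofReal (‖A ω + X ω‖ ^ (2 * k)) ∂μ
      ≤ 2 * ∫⁻ ω, ENNReal.ofReal (‖‖A ω‖ ^ 2 + symmConst k * ‖X ω‖ ^ 2‖ ^ k) ∂μ := by
    have m1 : AEMeasurable (fun ω => ENNReal.ofReal (‖A ω + X ω‖ ^ (2 * k))) μ :=
      ((hAm.add hXm).norm.aemeasurable.pow_const _).ennreal_ofReal
    calc _ = ∫⁻ ω, ENNReal.ofReal (‖A ω + X ω‖ ^ (2 * k)) ∂μ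
          + ∫⁻ ω, ENNReal.ofReal (‖A ω - X ω‖ ^ (2 * k)) ∂μ := by rw [← i2, two_mul]
      _ = ∫⁻ ω, ENNReal.ofReal (‖A ω + X ω‖ ^ (2 * k))
          + ENNReal.ofReal (‖A ω - X ω‖ ^ (2 * k)) ∂μ := (lintegral_add_left' m1 _).symm
      _ ≤ ∫⁻ ω, 2 * ENNReal.ofReal (‖‖A ω‖ ^ 2 + symmConst k * ‖X ω‖ ^ 2‖ ^ k) ∂μ := by
        refine lintegral_mono fun ω => ?_
        rw [← ENNReal.ofReal_add (by positivity) (by positivity), ← ENNReal.ofReal_ofNat,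
          ← ENNReal.ofReal_mul (by norm_num)]
        refine ENNReal.ofReal_le_ofReal ?_
        rw [Real.norm_of_nonneg (by positivity)]
        exact norm_add_pow_add_norm_sub_pow_le _ _ _
      _ = _ := lintegral_const_mul' _ _ (by norm_num)
  have i4 := (ENNReal.mul_le_mul_iff_right (by norm_num) (by norm_num)).mp i3
  exact i4.trans hY

section

variable {d : ℕ}

local notation "E" => EuclideanSpace ℝ (Fin d)

theorem eLpNorm_increment_le {h : ℝ} (hd : 1 ≤ d) (hh : 0 < h) (n : ℕ) {k : ℕ} (hk : k ≠ 0) :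
    eLpNorm (fun w : ℕ → E => w n) ((2 * k : ℕ) : ℝ≥0∞) (seqLaw d h)
      ≤ ENNReal.ofReal (3 * momentConst k 1 * (√h * √d)) := by
  have hd' : (0 : ℝ) < d := by exact_mod_cast hd
  have mp : MeasurePreserving (fun w : ℕ → E => w n) (seqLaw d h) (gaussLaw d h) :=
    measurePreserving_eval_infinitePi _ n
  have e : ∫⁻ w : ℕ → E, ENNReal.ofReal (Real.exp (1 / (4 * (h * d)) * ‖w n‖ ^ 2)) ∂(seqLaw d h)
      ≤ ENNReal.ofReal (Real.exp 1) := by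
    have h1 := mp.lintegral_comp
      (f := fun x : E => ENNReal.ofReal (Real.exp (1 / (4 * (h * d)) * ‖x‖ ^ 2))) (by fun_prop)
    rw [h1]
    -- The rate 1/(4hd) is the largest one that the Gaussian moment bound admits.
    have h2 : 1 / (4 * (h * d)) * d * h = 1 / 4 := by field_simp
    refine (lintegral_exp_mul_norm_sq hd hh (by positivity) h2.le).trans ?_
    rw [h2]
    exact ENNReal.ofReal_le_ofReal (Real.exp_le_exp.mpr (by norm_num))
  refine (eLpNorm_le_of_exp_moment (by positivity) e hk).trans (ENNReal.ofReal_le_ofReal ?_)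
  have hM := momentConst_ge_one k 1
  rw [Real.sqrt_div zero_le_one, Real.sqrt_one, Real.sqrt_mul (by norm_num), Real.sqrt_mul hh.le,
    show (4 : ℝ) = 2 ^ 2 by norm_num, Real.sqrt_sq (by norm_num), div_div_eq_mul_div, div_one]
  have : 0 ≤ √h * √d := by positivity
  nlinarith [mul_nonneg (zero_le_one.trans hM) this]

/-- A pairing with a fixed vector is one-dimensional, so no factor √d appears. After scaling by
√h‖p‖ the bound |y|^(2k) ≤ (2k)!(eʸ + e⁻ʸ) applies. -/
theorem lintegral_inner_pow_le {h : ℝ} (hh : 0 < h) (p : E) {k : ℕ} (hk : k ≠ 0) :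
    ∫⁻ x, ENNReal.ofReal (‖inner ℝ p x‖ ^ (2 * k)) ∂(gaussLaw d h)
      ≤ ENNReal.ofReal (((4 * (2 * k).factorial) * (√h * ‖p‖)) ^ (2 * k)) := by
  rcases eq_or_ne p 0 with rfl | hp
  · simp [hk]
  have hp' : 0 < ‖p‖ := norm_pos_iff.mpr hp
  have hsh : 0 < √h := Real.sqrt_pos.mpr hh
  set c := √h * ‖p‖ with hc
  have hc0 : 0 < c := by positivity
  set M : ℝ := ((2 * k).factorial : ℝ) with hM
  have hM1 : 1 ≤ M := by rw [hM]; exact_mod_cast (2 * k).factorial_pos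
  have key : ∀ x : E, ENNReal.ofReal (‖inner ℝ p x‖ ^ (2 * k))
      ≤ ENNReal.ofReal (c ^ (2 * k) * M) * (ENNReal.ofReal (Real.exp (inner ℝ ((1 / c) • p) x))
        + ENNReal.ofReal (Real.exp (inner ℝ ((-(1 / c)) • p) x))) := by
    intro x
    rw [← ENNReal.ofReal_add (Real.exp_pos _).le (Real.exp_pos _).le,
      ← ENNReal.ofReal_mul (by positivity)]
    refine ENNReal.ofReal_le_ofReal ?_
    rw [inner_smul_left, inner_smul_left]
    simp only [conj_trivial]
    set y := 1 / c * inner ℝ p x with hy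
    have e1 : inner ℝ p x = c * y := by rw [hy]; field_simp
    have h1 := Real.pow_div_factorial_le_exp |y| (abs_nonneg _) (2 * k)
    rw [div_le_iff₀ (by positivity)] at h1
    rw [neg_mul, ← hy, e1, norm_mul, mul_pow, Real.norm_of_nonneg hc0.le, Real.norm_eq_abs]
    have h2 : Real.exp |y| ≤ Real.exp y + Real.exp (-y) := by
      rcases abs_choice y with h | h <;> rw [h] <;>
        linarith [Real.exp_pos y, Real.exp_pos (-y)]
    rw [mul_assoc]
    refine mul_le_mul_of_nonneg_left (h1.trans ?_) (by positivity)
    rw [mul_comm]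
    gcongr
  have val : ∀ s : ℝ, s ^ 2 = (1 / c) ^ 2 →
      ∫⁻ x, ENNReal.ofReal (Real.exp (inner ℝ (s • p) x)) ∂(gaussLaw d h) ≤ ENNReal.ofReal 2 := by
    intro s hs
    rw [lintegral_exp_inner hh.le, norm_smul_sq, hs]
    refine ENNReal.ofReal_le_ofReal ?_
    have e2 : h * ((1 / c) ^ 2 * ‖p‖ ^ 2) / 2 = 1 / 2 := by
      rw [hc, div_pow, mul_pow, Real.sq_sqrt hh.le]; field_simp
    rw [e2]
    have h3 : Real.exp (1 / 2) ^ 2 < 2 ^ 2 := by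
      rw [← Real.exp_nat_mul]; norm_num; linarith [Real.exp_one_lt_d9]
    exact (abs_lt_of_sq_lt_sq' h3 (by norm_num)).2.le
  calc _ ≤ ∫⁻ x, ENNReal.ofReal (c ^ (2 * k) * M)
        * (ENNReal.ofReal (Real.exp (inner ℝ ((1 / c) • p) x))
          + ENNReal.ofReal (Real.exp (inner ℝ ((-(1 / c)) • p) x))) ∂(gaussLaw d h) :=
        lintegral_mono key
    _ ≤ ENNReal.ofReal (c ^ (2 * k) * M) * (ENNReal.ofReal 2 + ENNReal.ofReal 2) := by
        rw [lintegral_const_mul _ (by fun_prop), lintegral_add_left (by fun_prop)]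
        gcongr
        · exact val _ rfl
        · exact val _ (by ring)
    _ ≤ _ := by
        rw [← ENNReal.ofReal_add (by norm_num) (by norm_num), ← ENNReal.ofReal_mul (by positivity)]
        refine ENNReal.ofReal_le_ofReal ?_
        have h4 : 4 * M ≤ (4 * M) ^ (2 * k) := le_self_pow₀ (by linarith) (by omega)
        have h5 := mul_le_mul_of_nonneg_right h4 (pow_pos hc0 (2 * k)).le
        rw [← mul_pow] at h5
        linarith

/-- Moments of a Gaussian increment paired with an integrand that does not depend on it. -/
theorem eLpNorm_inner_increment_le {h : ℝ} (hh : 0 < h) (n : ℕ) {P : (ℕ → E) → E}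
    (hPm : Measurable P) (hP : ∀ w w', (∀ i < n, w i = w' i) → P w = P w') {k : ℕ} (hk : k ≠ 0)
    {p : ℝ} (hp0 : 0 ≤ p)
    (hp : eLpNorm P ((2 * k : ℕ) : ℝ≥0∞) (seqLaw d h) ≤ ENNReal.ofReal p) :
    eLpNorm (fun w => inner ℝ (P w) (w n)) ((2 * k : ℕ) : ℝ≥0∞) (seqLaw d h)
      ≤ ENNReal.ofReal (4 * (2 * k).factorial * (√h * p)) := by
  have h2k : 2 * k ≠ 0 := by omega
  rw [eLpNorm_nat_le_iff _ h2k (by positivity)] at hp ⊢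
  have c1 := lintegral_infinitePi_eval (gaussLaw d h) n
    (Φ := fun w x => ENNReal.ofReal (‖inner ℝ (P w) x‖ ^ (2 * k)))
    (by simp only [Function.uncurry_def]; fun_prop) (fun w w' x hw => by rw [hP w w' hw])
  unfold seqLaw at hp ⊢
  rw [c1]
  calc _ ≤ ∫⁻ w, ENNReal.ofReal ((4 * (2 * k).factorial * √h) ^ (2 * k))
        * ENNReal.ofReal (‖P w‖ ^ (2 * k)) ∂(Measure.infinitePi fun _ : ℕ => gaussLaw d h) := by
        refine lintegral_mono fun w => (lintegral_inner_pow_le hh (P w) hk).trans (le_of_eq ?_)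
        rw [← ENNReal.ofReal_mul (by positivity), ← mul_pow]
        congr 2; ring
    _ ≤ ENNReal.ofReal ((4 * (2 * k).factorial * √h) ^ (2 * k)) * ENNReal.ofReal (p ^ (2 * k)) := by
        rw [lintegral_const_mul _ (by fun_prop)]
        gcongr
    _ = _ := by
        rw [← ENNReal.ofReal_mul (by positivity), ← mul_pow]
        congr 2; ring

end

/-! ### Moments of the gap between the paths -/

/-- In the moment recursion of the gap, deterministic errors leave the root and add linearly, while
the noise keeps adding in quadrature. -/
theorem sqrt_add_sq_add_sq_le {x y V : ℝ} (hx : 0 ≤ x) :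
    √((x + y) ^ 2 + V ^ 2) ≤ x + √(y ^ 2 + V ^ 2) := by
  have h0 : 0 ≤ √(y ^ 2 + V ^ 2) := Real.sqrt_nonneg _
  have h1 : y ≤ √(y ^ 2 + V ^ 2) := Real.le_sqrt_of_sq_le (by nlinarith [sq_nonneg V])
  have h2 : √(y ^ 2 + V ^ 2) ^ 2 = y ^ 2 + V ^ 2 := Real.sq_sqrt (by positivity)
  refine Real.sqrt_le_iff.mpr ⟨by positivity, ?_⟩
  nlinarith [mul_le_mul_of_nonneg_left h1 hx]

/-! ### Geometric sums with a slightly perturbed ratio -/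

section Geometric

variable {q q₀ δ : ℝ} {N : ℕ}

theorem pow_le_three_mul_pow (hq : 0 ≤ q) (hq₀ : 0 ≤ q₀) (hδ : 0 ≤ δ) (hqq : q ≤ q₀ * (1 + δ))
    (hδN : δ * N ≤ 1) {j : ℕ} (hj : j ≤ N) : q ^ j ≤ 3 * q₀ ^ j := by
  have h1 : (1 + δ) ^ j ≤ 3 := by
    calc (1 + δ) ^ j ≤ Real.exp δ ^ j :=
          pow_le_pow_left₀ (by linarith) (by linarith [Real.add_one_le_exp δ]) j
      _ = Real.exp (j * δ) := (Real.exp_nat_mul δ j).symm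
      _ ≤ Real.exp 1 := by
          refine Real.exp_le_exp.mpr (le_trans ?_ hδN)
          rw [mul_comm]; gcongr
      _ ≤ 3 := by linarith [Real.exp_one_lt_d9]
  calc q ^ j ≤ (q₀ * (1 + δ)) ^ j := pow_le_pow_left₀ hq hqq j
    _ = q₀ ^ j * (1 + δ) ^ j := mul_pow _ _ _
    _ ≤ q₀ ^ j * 3 := by gcongr
    _ = _ := mul_comm _ _

theorem geom_sum_le_inv {θ : ℝ} (hθ : 0 < θ) (hθ1 : θ ≤ 1) (n : ℕ) :
    ∑ j ∈ Finset.range n, (1 - θ) ^ j ≤ 1 / θ := by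
  have h1 := geom_sum_mul (1 - θ) n
  have h2 : 0 ≤ (1 - θ) ^ n := pow_nonneg (by linarith) n
  rw [le_div_iff₀ hθ]
  linarith

theorem geom_sum_le_card {θ : ℝ} (hθ : 0 ≤ θ) (hθ1 : θ ≤ 1) {n : ℕ} (hn : n ≤ N) :
    ∑ j ∈ Finset.range n, (1 - θ) ^ j ≤ N := by
  calc _ ≤ ∑ j ∈ Finset.range n, (1 : ℝ) :=
        Finset.sum_le_sum fun j _ => pow_le_one₀ (by linarith) (by linarith)
    _ = n := by simp
    _ ≤ N := by exact_mod_cast hn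

end Geometric

/-! ### Standing assumptions and the moment recursion of the gap -/

noncomputable section

variable {d : ℕ}

local notation "E" => EuclideanSpace ℝ (Fin d)

/-- The standing assumptions, for a deterministic initial value `x₀`. -/
structure Setting (f : E → ℝ) (L lam α β G S h T ε r κ g : ℝ) (N : ℕ) (x₀ : E) : Prop where
  drift : DriftBounds (∇ f) L lam α β G
  meas : Measurable (∇ f)
  small : SmallStep ε S L α G h
  ε_nonneg : 0 ≤ ε
  ε_le : ε ≤ 1 / 1000
  one_le_d : 1 ≤ d
  β_nonneg : 0 ≤ β
  lam_nonneg : 0 ≤ lam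
  lam_lt : lam < 2 * S
  T_pos : 0 < T
  T_eq : T = 2 * N * h
  time : T * S ^ 2 * L ^ 2 * d * h ≤ ε * (2 * S - lam) ^ 2
  init : ‖x₀‖ ≤ r
  κ_pos : 0 < κ
  S_ge : 1 / κ ≤ S
  S_le : S ≤ κ * (L + √d) ^ 2
  G_le : G ≤ g

/-- Contraction factor of the gap over two steps. -/
def gapFactor (S lam L h : ℝ) : ℝ := 1 - h * (2 * S - lam) / 4 + 5 * h ^ 2 * L ^ 2

/-- Exponent in the exponential moment bound of the paths. -/
def pathExponent (α β r : ℝ) : ℝ := β + 1 + α * r ^ 2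

/-- Constant in the moment bound of the paths. -/
def pathConst (k : ℕ) (α β r : ℝ) : ℝ := 100 * momentConst k (pathExponent α β r) / √α

namespace Setting

variable {f : EuclideanSpace ℝ (Fin d) → ℝ} {L lam α β G S h T ε r κ g : ℝ} {N : ℕ}
  {x₀ : EuclideanSpace ℝ (Fin d)}

theorem one_le_sqrt_d (H : Setting f L lam α β G S h T ε r κ g N x₀) : 1 ≤ √(d : ℝ) :=
  Real.one_le_sqrt.mpr (by exact_mod_cast H.one_le_d)

theorem hm_pos (H : Setting f L lam α β G S h T ε r κ g N x₀) : 0 < h * (2 * S - lam) :=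
  mul_pos H.small.h_pos (by linarith [H.lam_lt])

theorem hm_le (H : Setting f L lam α β G S h T ε r κ g N x₀) : h * (2 * S - lam) ≤ 1 / 500 := by
  have h1 := H.small.hS.trans H.ε_le
  nlinarith [mul_nonneg H.small.h_pos.le H.lam_nonneg]

theorem T_hL2_le (H : Setting f L lam α β G S h T ε r κ g N x₀) : T * h * L ^ 2 ≤ 4 * ε := by
  have hS := H.small.S_pos
  have h1 : (2 * S - lam) ^ 2 ≤ (2 * S) ^ 2 := by
    refine pow_le_pow_left₀ (by linarith [H.lam_lt]) (by linarith [H.lam_nonneg]) 2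
  have h2 := H.time
  have h3 : T * h * L ^ 2 * S ^ 2 ≤ T * S ^ 2 * L ^ 2 * d * h := by
    have hd : (1 : ℝ) ≤ d := by exact_mod_cast H.one_le_d
    have : 0 ≤ T * S ^ 2 * L ^ 2 * h := by
      have := H.T_pos; have := H.small.h_pos; positivity
    nlinarith
  have h4 : T * h * L ^ 2 * S ^ 2 ≤ 4 * ε * S ^ 2 := by
    nlinarith [mul_le_mul_of_nonneg_left h1 H.ε_nonneg]
  exact le_of_mul_le_mul_right h4 (by positivity)

theorem gapFactor_nonneg (H : Setting f L lam α β G S h T ε r κ g N x₀) :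
    0 ≤ gapFactor S lam L h := by
  unfold gapFactor
  have := H.hm_le
  have : 0 ≤ 5 * h ^ 2 * L ^ 2 := by positivity
  linarith

theorem gapFactor_pow_le (H : Setting f L lam α β G S h T ε r κ g N x₀) {j : ℕ} (hj : j ≤ N) :
    gapFactor S lam L h ^ j ≤ 3 * (1 - h * (2 * S - lam) / 4) ^ j := by
  have h1 := H.hm_le
  have h2 := H.hm_pos
  -- As 1 − hm/4 ≥ 1/2, the factor 1 + δ covers the additive 5h²L². Moreover δN = 5ThL² ≤ 20ε ≤ 1,
  -- by the restriction that involves T.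
  refine pow_le_three_mul_pow (δ := 10 * h ^ 2 * L ^ 2) H.gapFactor_nonneg (by linarith)
    (by positivity) ?_ ?_ hj
  · unfold gapFactor
    nlinarith [sq_nonneg (h * L)]
  · have h3 := H.T_hL2_le
    have h4 := H.ε_le
    rw [H.T_eq] at h3
    linarith

theorem gapFactor_sum_le (H : Setting f L lam α β G S h T ε r κ g N x₀) {n : ℕ} (hn : n ≤ N) :
    ∑ j ∈ Finset.range n, gapFactor S lam L h ^ j ≤ 3 * N ∧
    ∑ j ∈ Finset.range n, gapFactor S lam L h ^ j ≤ 12 / (h * (2 * S - lam)) ∧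
    ∑ j ∈ Finset.range n, (gapFactor S lam L h ^ 2) ^ j ≤ 9 * N ∧
    ∑ j ∈ Finset.range n, (gapFactor S lam L h ^ 2) ^ j ≤ 36 / (h * (2 * S - lam)) := by
  have h1 := H.hm_le
  have h2 := H.hm_pos
  set θ := h * (2 * S - lam) / 4 with hθ
  have hθ0 : 0 < θ := by positivity
  have hθ1 : θ ≤ 1 := by linarith
  have b1 := geom_sum_le_card hθ0.le hθ1 hn
  have b2 := geom_sum_le_inv hθ0 hθ1 n
  have e : 1 / θ = 4 / (h * (2 * S - lam)) := by rw [hθ]; field_simp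
  rw [e] at b2
  have s1 : ∑ j ∈ Finset.range n, gapFactor S lam L h ^ j
      ≤ 3 * ∑ j ∈ Finset.range n, (1 - θ) ^ j := by
    rw [Finset.mul_sum]
    refine Finset.sum_le_sum fun j hj => H.gapFactor_pow_le ?_
    exact (Finset.mem_range.mp hj).le.trans hn
  have s2 : ∑ j ∈ Finset.range n, (gapFactor S lam L h ^ 2) ^ j
      ≤ 9 * ∑ j ∈ Finset.range n, (1 - θ) ^ j := by
    rw [Finset.mul_sum]
    refine Finset.sum_le_sum fun j hj => ?_
    have := H.gapFactor_pow_le ((Finset.mem_range.mp hj).le.trans hn)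
    rw [← pow_mul, mul_comm, pow_mul]
    have h0 := pow_nonneg H.gapFactor_nonneg j
    have h3 : (1 - θ) ^ j ≤ 1 := pow_le_one₀ (by linarith) (by linarith)
    have h4 : 0 ≤ (1 - θ) ^ j := pow_nonneg (by linarith) j
    calc (gapFactor S lam L h ^ j) ^ 2 ≤ (3 * (1 - θ) ^ j) ^ 2 := pow_le_pow_left₀ h0 this 2
      _ = 9 * ((1 - θ) ^ j * (1 - θ) ^ j) := by ring
      _ ≤ 9 * ((1 - θ) ^ j * 1) := by gcongr
      _ = _ := by ring
  refine ⟨by linarith, ?_, by linarith, ?_⟩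
  · refine s1.trans ((mul_le_mul_of_nonneg_left b2 (by norm_num)).trans (le_of_eq (by ring)))
  · refine s2.trans ((mul_le_mul_of_nonneg_left b2 (by norm_num)).trans (le_of_eq (by ring)))

theorem pathConst_nonneg (k : ℕ) (α β r : ℝ) : 0 ≤ pathConst k α β r := by
  unfold pathConst
  have := momentConst_ge_one k (pathExponent α β r)
  positivity

theorem eLpNorm_path_le (H : Setting f L lam α β G S h T ε r κ g N x₀) (n : ℕ) {k : ℕ}
    (hk : k ≠ 0) :
    eLpNorm (fun w => (evenPath f S h x₀ w n).1) ((2 * k : ℕ) : ℝ≥0∞) (seqLaw d h)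
        ≤ ENNReal.ofReal (pathConst k α β r * √d) ∧
      eLpNorm (fun w => (evenPath f S h x₀ w n).2) ((2 * k : ℕ) : ℝ≥0∞) (seqLaw d h)
        ≤ ENNReal.ofReal (pathConst k α β r * √d) := by
  have key := lintegral_exp_path_le H.drift H.meas H.small H.ε_nonneg H.ε_le H.one_le_d H.β_nonneg
    H.init n
  have hα := H.small.α_pos
  have hd : (0 : ℝ) < d := by exact_mod_cast H.one_le_d
  have hr : 0 < expRate d α := by unfold expRate; positivity
  have e : momentConst k (pathExponent α β r) / √(expRate d α) = pathConst k α β r * √d := by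
    unfold pathConst expRate
    have h4 : √(10000 : ℝ) = 100 := by
      rw [show (10000 : ℝ) = 100 ^ 2 by norm_num, Real.sqrt_sq (by norm_num)]
    rw [Real.sqrt_div hα.le, Real.sqrt_mul (by norm_num), h4]
    have : √α ≠ 0 := (Real.sqrt_pos.mpr hα).ne'
    field_simp
  rw [← e]
  constructor <;>
  · refine eLpNorm_le_of_exp_moment hr (le_trans (lintegral_mono fun w => ?_) key) hk
    refine ENNReal.ofReal_le_ofReal (Real.exp_le_exp.mpr (mul_le_mul_of_nonneg_left ?_ hr.le))
    first
      | exact le_add_of_nonneg_right (sq_nonneg _)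
      | exact le_add_of_nonneg_left (sq_nonneg _)

theorem gapOdd_norm_le (H : Setting f L lam α β G S h T ε r κ g N x₀) (y : E × E) (x : E) :
    ‖gapOdd f S h y x‖ ≤ 2 * h * L * ‖x‖ := by
  have hh := H.small.h_pos
  have hL := H.small.L_pos
  have h1 := H.drift.lip (fineMean (∇ f) S h y.1 y.2 + √2 • x) (fineMean (∇ f) S h y.1 y.2 - √2 • x)
  rw [show fineMean (∇ f) S h y.1 y.2 + √2 • x - (fineMean (∇ f) S h y.1 y.2 - √2 • x)
    = (2 * √2) • x by module, norm_smul, Real.norm_of_nonneg (by positivity)] at h1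
  rw [gapOdd, norm_smul, norm_neg, Real.norm_of_nonneg (by positivity)]
  have h2 : √2 ≤ 2 := Real.sqrt_le_iff.mpr ⟨by norm_num, by norm_num⟩
  calc _ ≤ h / 2 * (L * (2 * √2 * ‖x‖)) := by gcongr
    _ ≤ h / 2 * (L * (2 * 2 * ‖x‖)) := by gcongr
    _ = _ := by ring

theorem gapRem_norm_le (H : Setting f L lam α β G S h T ε r κ g N x₀) (y : E × E) (x : E) :
    ‖gapRem f S h y x‖ ≤ 2 * h * L * ‖x‖ ^ 2 := by
  have hh := H.small.h_pos
  have h1 := H.drift.second (fineMean (∇ f) S h y.1 y.2) (√2 • x)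
  rw [norm_smul_sq, Real.sq_sqrt (by norm_num)] at h1
  rw [gapRem, norm_smul, norm_neg, Real.norm_of_nonneg (by positivity)]
  calc _ ≤ h / 2 * (2 * L * (2 * ‖x‖ ^ 2)) := by gcongr
    _ = _ := by ring

/-- The conditional mean, the symmetric noise and the quadratic remainder enter differently: the
first two combine in quadrature by reflection, and the last is added by the triangle inequality. -/
theorem gap_recursion (H : Setting f L lam α β G S h T ε r κ g N x₀) (n : ℕ) {k : ℕ}
    (hk : k ≠ 0) {u : ℝ} (hu : 0 ≤ u)
    (hn : eLpNorm (fun w => gap f S h x₀ w n) ((2 * k : ℕ) : ℝ≥0∞) (seqLaw d h)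
      ≤ ENNReal.ofReal u) :
    eLpNorm (fun w => gap f S h x₀ w (n + 1)) ((2 * k : ℕ) : ℝ≥0∞) (seqLaw d h)
      ≤ ENNReal.ofReal (√((gapFactor S lam L h * u
            + h ^ 2 * L * (L * (pathConst k α β r * √d) + G)) ^ 2
          + (√(symmConst k) * (2 * h * L * (3 * momentConst k 1 * (√h * √d)))) ^ 2)
        + 2 * h * L * (3 * momentConst (2 * k) 1 * (√h * √d)) ^ 2) := by
  have hh := H.small.h_pos
  have hL := H.small.L_pos
  have hG := H.small.G_nonneg
  have hfm := H.meas
  have hpm := measurable_evenPath_right S h hfm x₀ n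
  have hq := H.gapFactor_nonneg
  have hpc := pathConst_nonneg k α β r
  have hmc1 : 0 ≤ momentConst k 1 := zero_le_one.trans (momentConst_ge_one _ _)
  have hmc2 : 0 ≤ momentConst (2 * k) 1 := zero_le_one.trans (momentConst_ge_one _ _)
  have hsc : 0 ≤ symmConst k := zero_le_one.trans (symmConst_ge_one _)
  have h1k : (1 : ℝ≥0∞) ≤ ((2 * k : ℕ) : ℝ≥0∞) := by
    have : 1 ≤ 2 * k := by omega
    exact_mod_cast this
  set A : (ℕ → E) → E := fun w =>
    gapMean (∇ f) S h (evenPath f S h x₀ w n).1 (evenPath f S h x₀ w n).2 with hA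
  set X : (ℕ → E) → E := fun w => gapOdd f S h (evenPath f S h x₀ w n) (w (2 * n)) with hX
  set B : (ℕ → E) → E := fun w => gapRem f S h (evenPath f S h x₀ w n) (w (2 * n)) with hB
  have mA : Measurable A := by simp only [hA, gapMean, fineMean]; fun_prop
  have mX : Measurable X := by simp only [hX, gapOdd, fineMean]; fun_prop
  have mB : Measurable B := by simp only [hB, gapRem, fineMean]; fun_prop
  have bA : eLpNorm A ((2 * k : ℕ) : ℝ≥0∞) (seqLaw d h)
      ≤ ENNReal.ofReal (gapFactor S lam L h * u
            + h ^ 2 * L * (L * (pathConst k α β r * √d) + G)) := by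
    have h1 : eLpNorm A ((2 * k : ℕ) : ℝ≥0∞) (seqLaw d h)
        ≤ eLpNorm ((fun w => gapFactor S lam L h * ‖gap f S h x₀ w n‖)
          + ((fun w => h ^ 2 * L * (L * ‖(evenPath f S h x₀ w n).1‖))
          + fun _ => h ^ 2 * L * G)) ((2 * k : ℕ) : ℝ≥0∞) (seqLaw d h) := by
      refine eLpNorm_mono_real fun w => ?_
      have h2 := H.drift.gapMean_le H.small H.ε_nonneg H.ε_le H.lam_nonneg H.lam_lt
        (evenPath f S h x₀ w n).1 (evenPath f S h x₀ w n).2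
      have h3 := mul_le_mul_of_nonneg_left (H.drift.norm_le (evenPath f S h x₀ w n).1)
        (by positivity : 0 ≤ h ^ 2 * L)
      simp only [Pi.add_apply, gap, gapFactor]
      linarith
    refine h1.trans ?_
    have mg : Measurable fun w => gap f S h x₀ w n := by simp only [gap]; fun_prop
    refine (eLpNorm_add_le (by fun_prop) (by fun_prop) h1k).trans ?_
    refine (add_le_add le_rfl (eLpNorm_add_le (by fun_prop) (by fun_prop) h1k)).trans ?_
    have c1 : eLpNorm (fun w => gapFactor S lam L h * ‖gap f S h x₀ w n‖) ((2 * k : ℕ) : ℝ≥0∞)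
        (seqLaw d h) ≤ ENNReal.ofReal (gapFactor S lam L h * u) := by
      refine (eLpNorm_const_smul (gapFactor S lam L h) (fun w => ‖gap f S h x₀ w n‖) _ _).le.trans ?_
      rw [eLpNorm_norm, ENNReal.ofReal_mul hq, Real.enorm_of_nonneg hq]
      gcongr
    have c2 : eLpNorm (fun w => h ^ 2 * L * (L * ‖(evenPath f S h x₀ w n).1‖))
        ((2 * k : ℕ) : ℝ≥0∞) (seqLaw d h)
        ≤ ENNReal.ofReal (h ^ 2 * L * L * (pathConst k α β r * √d)) := by
      simp only [← mul_assoc (h ^ 2 * L) L]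
      refine (eLpNorm_const_smul (h ^ 2 * L * L)
        (fun w => ‖(evenPath f S h x₀ w n).1‖) _ _).le.trans ?_
      rw [eLpNorm_norm, ENNReal.ofReal_mul (by positivity), Real.enorm_of_nonneg (by positivity)]
      gcongr
      exact (H.eLpNorm_path_le n hk).1
    have c3 : eLpNorm (fun _ : ℕ → E => h ^ 2 * L * G) ((2 * k : ℕ) : ℝ≥0∞) (seqLaw d h)
        ≤ ENNReal.ofReal (h ^ 2 * L * G) := by
      rw [eLpNorm_const _ (by exact_mod_cast (by omega : 2 * k ≠ 0)) (NeZero.ne _)]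
      simp [Real.enorm_of_nonneg (by positivity : 0 ≤ h ^ 2 * L * G)]
    rw [show gapFactor S lam L h * u + h ^ 2 * L * (L * (pathConst k α β r * √d) + G)
      = gapFactor S lam L h * u + (h ^ 2 * L * L * (pathConst k α β r * √d) + h ^ 2 * L * G) by
        ring, ENNReal.ofReal_add (by positivity) (by positivity),
      ENNReal.ofReal_add (by positivity) (by positivity)]
    gcongr
  have bX : eLpNorm X ((2 * k : ℕ) : ℝ≥0∞) (seqLaw d h)
      ≤ ENNReal.ofReal (2 * h * L * (3 * momentConst k 1 * (√h * √d))) := by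
    rw [ENNReal.ofReal_mul (by positivity)]
    refine (eLpNorm_le_mul_eLpNorm_of_ae_le_mul (g := fun w : ℕ → E => w (2 * n))
      (Filter.Eventually.of_forall fun w => H.gapOdd_norm_le _ _) _).trans ?_
    gcongr
    exact eLpNorm_increment_le H.one_le_d hh _ hk
  have bB : eLpNorm B ((2 * k : ℕ) : ℝ≥0∞) (seqLaw d h)
      ≤ ENNReal.ofReal (2 * h * L * (3 * momentConst (2 * k) 1 * (√h * √d)) ^ 2) := by
    rw [ENNReal.ofReal_mul (by positivity)]
    refine (eLpNorm_le_mul_eLpNorm_of_ae_le_mul (g := fun w : ℕ → E => ‖w (2 * n)‖ ^ 2)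
      (c := 2 * h * L)
      (Filter.Eventually.of_forall fun w => ?_) _).trans ?_
    · rw [Real.norm_of_nonneg (sq_nonneg ‖w (2 * n)‖)]
      exact H.gapRem_norm_le _ _
    · gcongr
      rw [eLpNorm_norm_sq (fun w : ℕ → E => w (2 * n)) (by omega : 2 * k ≠ 0),
        ENNReal.ofReal_pow (by positivity)]
      exact pow_le_pow_left₀ zero_le (eLpNorm_increment_le H.one_le_d hh _ (by omega)) 2
  -- Reflection of the increments from time 2n on fixes the paths up to that time, hence A, and
  -- negates the odd term X.
  have sym : eLpNorm (fun w => A w - X w) ((2 * k : ℕ) : ℝ≥0∞) (seqLaw d h)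
      = eLpNorm (fun w => A w + X w) ((2 * k : ℕ) : ℝ≥0∞) (seqLaw d h) := by
    have mp := measurePreserving_flipFrom (d := d) hh.le (2 * n)
    have e1 := eLpNorm_comp_measurePreserving (p := ((2 * k : ℕ) : ℝ≥0∞))
      (mA.add mX).aestronglyMeasurable mp
    rw [← show (A + X) = fun w => A w + X w from rfl, ← e1]
    congr 1
    ext1 w
    have e2 : evenPath f S h x₀ (flipFrom (2 * n) w) n = evenPath f S h x₀ w n :=
      evenPath_congr f S h x₀ fun i hi => flipFrom_of_lt hi w
    simp only [Function.comp, Pi.add_apply, hA, hX, e2, flipFrom_of_le le_rfl, gapOdd]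
    rw [sub_eq_add_neg]
    congr 1
    simp only [smul_neg, sub_neg_eq_add]
    rw [← sub_eq_add_neg, ← smul_neg, neg_sub]
  have bAX := eLpNorm_add_le_of_symm hk mA.aestronglyMeasurable mX.aestronglyMeasurable sym
    (by positivity) (by positivity) bA bX
  have e : (fun w => gap f S h x₀ w (n + 1)) = (fun w => A w + X w) + B := by
    ext1 w; exact gap_succ f S h x₀ w n
  rw [e]
  refine (eLpNorm_add_le (mA.add mX).aestronglyMeasurable mB.aestronglyMeasurable h1k).trans ?_
  rw [ENNReal.ofReal_add (Real.sqrt_nonneg _) (by positivity), mul_pow, Real.sq_sqrt hsc]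
  exact add_le_add bAX bB

/-- Discrete variation of constants, started from gap zero. -/
theorem gap_sum_bound (H : Setting f L lam α β G S h T ε r κ g N x₀) (n : ℕ) {k : ℕ}
    (hk : k ≠ 0) :
    eLpNorm (fun w => gap f S h x₀ w n) ((2 * k : ℕ) : ℝ≥0∞) (seqLaw d h)
      ≤ ENNReal.ofReal ((h ^ 2 * L * (L * (pathConst k α β r * √d) + G)
            + 2 * h * L * (3 * momentConst (2 * k) 1 * (√h * √d)) ^ 2)
            * ∑ j ∈ Finset.range n, gapFactor S lam L h ^ j
          + √(symmConst k) * (2 * h * L * (3 * momentConst k 1 * (√h * √d)))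
            * √(∑ j ∈ Finset.range n, (gapFactor S lam L h ^ 2) ^ j)) := by
  have hh := H.small.h_pos
  have hL := H.small.L_pos
  have hG := H.small.G_nonneg
  have hq := H.gapFactor_nonneg
  have hpc := pathConst_nonneg k α β r
  have hmc1 : 0 ≤ momentConst k 1 := zero_le_one.trans (momentConst_ge_one _ _)
  induction n with
  | zero => simp [gap, evenPath]
  | succ n ih =>
    have hrec := fun u : ℝ => H.gap_recursion n hk (u := u)
    set w₁ := h ^ 2 * L * (L * (pathConst k α β r * √d) + G) with hw₁
    set w₂ := 2 * h * L * (3 * momentConst (2 * k) 1 * (√h * √d)) ^ 2 with hw₂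
    set V := √(symmConst k) * (2 * h * L * (3 * momentConst k 1 * (√h * √d))) with hV
    set q := gapFactor S lam L h with hqd
    have w₁0 : 0 ≤ w₁ := by positivity
    have w₂0 : 0 ≤ w₂ := by positivity
    have V0 : 0 ≤ V := by positivity
    set σ := ∑ j ∈ Finset.range n, q ^ j with hσ
    set ρ := ∑ j ∈ Finset.range n, (q ^ 2) ^ j with hρ
    have σ0 : 0 ≤ σ := Finset.sum_nonneg fun j _ => by positivity
    have ρ0 : 0 ≤ ρ := Finset.sum_nonneg fun j _ => by positivity
    refine (hrec _ (by positivity) ih).trans (ENNReal.ofReal_le_ofReal ?_)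
    have eσ : ∑ j ∈ Finset.range (n + 1), q ^ j = q * σ + 1 := by
      rw [Finset.sum_range_succ', hσ, Finset.mul_sum, pow_zero]
      simp only [pow_succ']
    have eρ : ∑ j ∈ Finset.range (n + 1), (q ^ 2) ^ j = q ^ 2 * ρ + 1 := by
      rw [Finset.sum_range_succ', hρ, Finset.mul_sum, pow_zero]
      simp only [pow_succ']
    rw [eσ, eρ]
    have e1 : q * ((w₁ + w₂) * σ + V * √ρ) + w₁ = (q * ((w₁ + w₂) * σ) + w₁) + q * (V * √ρ) := by
      ring
    rw [e1]
    have h1 := sqrt_add_sq_add_sq_le (V := V)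
      (y := q * (V * √ρ)) (by positivity : 0 ≤ q * ((w₁ + w₂) * σ) + w₁)
    have h2 : √((q * (V * √ρ)) ^ 2 + V ^ 2) = V * √(q ^ 2 * ρ + 1) := by
      have : (q * (V * √ρ)) ^ 2 + V ^ 2 = V ^ 2 * (q ^ 2 * ρ + 1) := by
        rw [mul_pow, mul_pow, Real.sq_sqrt ρ0]; ring
      rw [this, Real.sqrt_mul (sq_nonneg V), Real.sqrt_sq V0]
    rw [h2] at h1
    linarith

end Setting

end

/-! ### Explicit rates for the moments of the gap -/

noncomputable section

variable {d : ℕ}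

local notation "E" => EuclideanSpace ℝ (Fin d)

/-- Constant of the drift contribution to the gap. -/
def gapDriftConst (k : ℕ) (α β r g : ℝ) : ℝ :=
  pathConst k α β r + g + 2 * (3 * momentConst (2 * k) 1) ^ 2

/-- Constant of the martingale contribution to the gap. -/
def gapNoiseConst (k : ℕ) : ℝ := √(symmConst k) * (6 * momentConst k 1)

/-- Constant in the moment bounds of the gap. -/
def gapConst (k : ℕ) (α β r g κ : ℝ) : ℝ :=
  12 * gapDriftConst k α β r g * (1 + √(2 * κ)) + 6 * gapNoiseConst k * (1 + √(2 * κ))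

theorem gapNoiseConst_nonneg (k : ℕ) : 0 ≤ gapNoiseConst k := by
  have := momentConst_ge_one k 1
  unfold gapNoiseConst
  positivity

/-- The rate in the final estimate. -/
def targetRate (d : ℕ) (L lam S h T : ℝ) : ℝ :=
  √T * (S * L * d * (L + √d) / (2 * S - lam)) * h

namespace Setting

variable {f : EuclideanSpace ℝ (Fin d) → ℝ} {L lam α β G S h T ε r κ g : ℝ} {N : ℕ}
  {x₀ : EuclideanSpace ℝ (Fin d)}

theorem gapDriftConst_nonneg (H : Setting f L lam α β G S h T ε r κ g N x₀) (k : ℕ) :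
    0 ≤ gapDriftConst k α β r g := by
  have := pathConst_nonneg k α β r
  have := H.small.G_nonneg.trans H.G_le
  unfold gapDriftConst
  positivity

theorem gapConst_nonneg (H : Setting f L lam α β G S h T ε r κ g N x₀) (k : ℕ) :
    0 ≤ gapConst k α β r g κ := by
  have := H.gapDriftConst_nonneg k
  have := gapNoiseConst_nonneg k
  unfold gapConst
  positivity

theorem m_pos (H : Setting f L lam α β G S h T ε r κ g N x₀) : 0 < 2 * S - lam := by
  linarith [H.lam_lt]

/-- From m ≤ 2S, together with 2S ≤ 2κ(L + √d)² or 2S ≤ 2κS². The two-sided bound on S by κ enters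
here, to trade a factor 1/√m for the 1/m of the stated rate. -/
theorem sqrt_m_le (H : Setting f L lam α β G S h T ε r κ g N x₀) :
    √(2 * S - lam) ≤ √(2 * κ) * (L + √d) ∧ √(2 * S - lam) ≤ √(2 * κ) * S := by
  have hL := H.small.L_pos
  have hS := H.small.S_pos
  have hκ := H.κ_pos
  have h1 : 2 * S - lam ≤ 2 * S := by linarith [H.lam_nonneg]
  constructor
  · rw [Real.sqrt_le_left (by positivity), mul_pow, Real.sq_sqrt (by positivity)]
    linarith [H.S_le]
  · rw [Real.sqrt_le_left (by positivity), mul_pow, Real.sq_sqrt (by positivity)]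
    have h2 : 1 ≤ S * κ := by
      have := H.S_ge
      rwa [div_le_iff₀ hκ] at this
    nlinarith

theorem inv_sqrt_m_le (H : Setting f L lam α β G S h T ε r κ g N x₀) :
    1 / √(2 * S - lam) ≤ √(2 * κ) * (L + √d) / (2 * S - lam) ∧
    1 / √(2 * S - lam) ≤ √(2 * κ) * S / (2 * S - lam) := by
  obtain ⟨h1, h2⟩ := H.sqrt_m_le
  have hm := H.m_pos
  have hs : 0 < √(2 * S - lam) := Real.sqrt_pos.mpr hm
  have e : 1 / √(2 * S - lam) = √(2 * S - lam) / (2 * S - lam) := by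
    rw [div_eq_div_iff hs.ne' hm.ne', one_mul, Real.mul_self_sqrt hm.le]
  rw [e]
  exact ⟨by gcongr, by gcongr⟩

theorem one_le_dim (H : Setting f L lam α β G S h T ε r κ g N x₀) : 1 ≤ √d * (L + √d) := by
  have h1 := H.one_le_sqrt_d
  have hL := H.small.L_pos
  nlinarith

theorem gap_drift_le (H : Setting f L lam α β G S h T ε r κ g N x₀) (k : ℕ) :
    h ^ 2 * L * (L * (pathConst k α β r * √d) + G)
        + 2 * h * L * (3 * momentConst (2 * k) 1 * (√h * √d)) ^ 2
      ≤ gapDriftConst k α β r g * (h ^ 2 * L * (√d * (L + √d))) := by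
  have hh := H.small.h_pos
  have hL := H.small.L_pos
  have hX := H.one_le_dim
  have hsd := H.one_le_sqrt_d
  have hA := pathConst_nonneg k α β r
  have hG := H.small.G_nonneg
  have e : 2 * h * L * (3 * momentConst (2 * k) 1 * (√h * √d)) ^ 2
      = 2 * (3 * momentConst (2 * k) 1) ^ 2 * (h ^ 2 * L * (√d * √d)) := by
    rw [mul_pow, mul_pow √h, Real.sq_sqrt hh.le]; ring
  rw [e]
  have t1 : h ^ 2 * L * (L * (pathConst k α β r * √d))
      ≤ pathConst k α β r * (h ^ 2 * L * (√d * (L + √d))) := by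
    have : L * √d ≤ √d * (L + √d) := by nlinarith
    have := mul_le_mul_of_nonneg_left this (by positivity : 0 ≤ h ^ 2 * L * pathConst k α β r)
    linarith
  have t2 : h ^ 2 * L * G ≤ g * (h ^ 2 * L * (√d * (L + √d))) := by
    have h1 : G * 1 ≤ g * (√d * (L + √d)) :=
      mul_le_mul H.G_le hX zero_le_one (hG.trans H.G_le)
    have := mul_le_mul_of_nonneg_left h1 (by positivity : 0 ≤ h ^ 2 * L)
    linarith
  have t3 : h ^ 2 * L * (√d * √d) ≤ h ^ 2 * L * (√d * (L + √d)) := by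
    gcongr; linarith
  have t4 := mul_le_mul_of_nonneg_left t3
    (by positivity : 0 ≤ 2 * (3 * momentConst (2 * k) 1) ^ 2)
  unfold gapDriftConst
  linarith

theorem gap_noise_eq (k : ℕ) :
    √(symmConst k) * (2 * h * L * (3 * momentConst k 1 * (√h * √d)))
      = gapNoiseConst k * (h * L * (√h * √d)) := by
  unfold gapNoiseConst; ring

/-- The drift errors sum to h²/(hm) and the noise to h^(3/2)/√(hm) = h/√m, up to factors in L and d.
-/
theorem eLpNorm_gap_le_uniform (H : Setting f L lam α β G S h T ε r κ g N x₀) {n : ℕ}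
    (hn : n ≤ N) {k : ℕ} (hk : k ≠ 0) :
    eLpNorm (fun w => gap f S h x₀ w n) ((2 * k : ℕ) : ℝ≥0∞) (seqLaw d h)
      ≤ ENNReal.ofReal (gapConst k α β r g κ * (h * L * (√d * (L + √d)) / (2 * S - lam))) := by
  refine (H.gap_sum_bound n hk).trans (ENNReal.ofReal_le_ofReal ?_)
  obtain ⟨-, b2, -, b4⟩ := H.gapFactor_sum_le hn
  have hh := H.small.h_pos
  have hL := H.small.L_pos
  have hm := H.m_pos
  have hC3 := H.gapDriftConst_nonneg k
  have hC4 := gapNoiseConst_nonneg k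
  have hq := H.gapFactor_nonneg
  rw [gap_noise_eq]
  set m := 2 * S - lam with hmd
  have hsh : 0 < √h := Real.sqrt_pos.mpr hh
  have t1 : (h ^ 2 * L * (L * (pathConst k α β r * √d) + G)
        + 2 * h * L * (3 * momentConst (2 * k) 1 * (√h * √d)) ^ 2)
        * ∑ j ∈ Finset.range n, gapFactor S lam L h ^ j
      ≤ 12 * gapDriftConst k α β r g * (h * L * (√d * (L + √d)) / m) := by
    calc _ ≤ gapDriftConst k α β r g * (h ^ 2 * L * (√d * (L + √d))) * (12 / (h * m)) := by
          refine mul_le_mul (H.gap_drift_le k) b2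
            (Finset.sum_nonneg fun j _ => by positivity) (by positivity)
      _ = _ := by field_simp
  have t2 : gapNoiseConst k * (h * L * (√h * √d))
        * √(∑ j ∈ Finset.range n, (gapFactor S lam L h ^ 2) ^ j)
      ≤ 6 * gapNoiseConst k * √(2 * κ) * (h * L * (√d * (L + √d)) / m) := by
    have e1 : √(36 / (h * m)) = 6 / √h * (1 / √m) := by
      rw [Real.sqrt_div (by norm_num), Real.sqrt_mul hh.le,
        show (36 : ℝ) = 6 ^ 2 by norm_num, Real.sqrt_sq (by norm_num)]
      field_simp
    calc _ ≤ gapNoiseConst k * (h * L * (√h * √d)) * √(36 / (h * m)) := by gcongr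
      _ = gapNoiseConst k * (h * L * √d) * 6 * (1 / √m) := by rw [e1]; field_simp
      _ ≤ gapNoiseConst k * (h * L * √d) * 6 * (√(2 * κ) * (L + √d) / m) :=
          mul_le_mul_of_nonneg_left H.inv_sqrt_m_le.1 (by positivity)
      _ = _ := by ring
  have hY : 0 ≤ h * L * (√d * (L + √d)) / m := by positivity
  have u1 : 0 ≤ gapDriftConst k α β r g * √(2 * κ) * (h * L * (√d * (L + √d)) / m) := by positivity
  have u2 : 0 ≤ gapNoiseConst k * (h * L * (√d * (L + √d)) / m) := by positivity
  unfold gapConst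
  linarith

/-- The uniform bound lacks the factor √T, which may be small. It is obtained by also bounding the
geometric sums by the number of steps. -/
theorem eLpNorm_gap_le_terminal (H : Setting f L lam α β G S h T ε r κ g N x₀) {k : ℕ}
    (hk : k ≠ 0) :
    eLpNorm (fun w => gap f S h x₀ w N) ((2 * k : ℕ) : ℝ≥0∞) (seqLaw d h)
      ≤ ENNReal.ofReal (gapConst k α β r g κ * targetRate d L lam S h T) := by
  refine (H.gap_sum_bound N hk).trans (ENNReal.ofReal_le_ofReal ?_)
  obtain ⟨b1, b2, b3, -⟩ := H.gapFactor_sum_le le_rfl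
  have hh := H.small.h_pos
  have hL := H.small.L_pos
  have hS := H.small.S_pos
  have hm := H.m_pos
  have hT := H.T_pos
  have hC3 := H.gapDriftConst_nonneg k
  have hC4 := gapNoiseConst_nonneg k
  have hq := H.gapFactor_nonneg
  have hX := H.one_le_dim
  have hsd := H.one_le_sqrt_d
  have hmS : 2 * S - lam ≤ 2 * S := by linarith [H.lam_nonneg]
  have hdd : √d * √d = d := Real.mul_self_sqrt (by positivity)
  rw [gap_noise_eq]
  set m := 2 * S - lam with hmd
  have hsm : 0 < √m := Real.sqrt_pos.mpr hm
  have hsh : 0 < √h := Real.sqrt_pos.mpr hh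
  set σ := ∑ j ∈ Finset.range N, gapFactor S lam L h ^ j with hσ
  have σ0 : 0 ≤ σ := Finset.sum_nonneg fun j _ => by positivity
  have tr : targetRate d L lam S h T = √T * h * L * (√d * (√d * (L + √d))) * (S / m) := by
    unfold targetRate
    rw [← mul_assoc √d √d, hdd, hmd]; ring
  -- Geometric mean of the bounds 3N and 12/(hm), with 2Nh = T.
  have hσ1 : σ ≤ 6 * √T / h * (1 / √m) := by
    have h1 : σ ^ 2 ≤ (6 * √T / h * (1 / √m)) ^ 2 := by
      have h2 : σ ^ 2 ≤ (3 * N) * (12 / (h * m)) := by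
        rw [sq]; exact mul_le_mul b1 b2 σ0 (by positivity)
      refine h2.trans ?_
      rw [mul_pow, div_pow, mul_pow, div_pow, one_pow, Real.sq_sqrt hT.le, Real.sq_sqrt hm.le,
        H.T_eq]
      rw [show 3 * (N : ℝ) * (12 / (h * m)) = 36 * N / (h * m) by ring,
        show 6 ^ 2 * (2 * N * h) / h ^ 2 * (1 / m) = 72 * N / (h * m) by field_simp; ring]
      gcongr
      linarith [(Nat.cast_nonneg N : (0 : ℝ) ≤ N)]
    exact (abs_le_of_sq_le_sq' h1 (by positivity)).2
  have t1 : (h ^ 2 * L * (L * (pathConst k α β r * √d) + G)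
        + 2 * h * L * (3 * momentConst (2 * k) 1 * (√h * √d)) ^ 2) * σ
      ≤ 6 * gapDriftConst k α β r g * √(2 * κ) * targetRate d L lam S h T := by
    calc _ ≤ gapDriftConst k α β r g * (h ^ 2 * L * (√d * (L + √d)))
            * (6 * √T / h * (1 / √m)) :=
          mul_le_mul (H.gap_drift_le k) hσ1 σ0 (by positivity)
      _ ≤ gapDriftConst k α β r g * (h ^ 2 * L * (√d * (√d * (L + √d))))
            * (6 * √T / h * (√(2 * κ) * S / m)) := by
          refine mul_le_mul ?_ (mul_le_mul_of_nonneg_left H.inv_sqrt_m_le.2 (by positivity))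
            (by positivity) (by positivity)
          gcongr
          exact le_mul_of_one_le_left (by positivity) hsd
      _ = _ := by rw [tr]; field_simp
  have t2 : gapNoiseConst k * (h * L * (√h * √d))
        * √(∑ j ∈ Finset.range N, (gapFactor S lam L h ^ 2) ^ j)
      ≤ 6 * gapNoiseConst k * targetRate d L lam S h T := by
    have e1 : √h * √(9 * N) ≤ 3 * √T := by
      rw [← Real.sqrt_mul hh.le, show h * (9 * N) = 3 ^ 2 * (h * N) by ring,
        Real.sqrt_mul (by positivity), Real.sqrt_sq (by norm_num)]
      gcongr
      rw [H.T_eq]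
      nlinarith [mul_nonneg hh.le (Nat.cast_nonneg N : (0 : ℝ) ≤ N)]
    have e2 : 1 ≤ 2 * (S / m) := by
      rw [← mul_div_assoc, le_div_iff₀ hm]; linarith
    calc _ ≤ gapNoiseConst k * (h * L * (√h * √d)) * √(9 * N) := by gcongr
      _ = gapNoiseConst k * (h * L * √d) * (√h * √(9 * N)) := by ring
      _ ≤ gapNoiseConst k * (h * L * √d) * (3 * √T) := by gcongr
      _ = 3 * (gapNoiseConst k * (h * L * (√d * 1)) * √T) * 1 := by ring
      _ ≤ 3 * (gapNoiseConst k * (h * L * (√d * (√d * (L + √d)))) * √T) * (2 * (S / m)) := by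
          gcongr
      _ = _ := by rw [tr]; ring
  have hY : 0 ≤ targetRate d L lam S h T := by rw [tr]; positivity
  have u1 : 0 ≤ gapDriftConst k α β r g * √(2 * κ) * targetRate d L lam S h T := by positivity
  have u2 : 0 ≤ gapNoiseConst k * √(2 * κ) * targetRate d L lam S h T := by positivity
  have u3 : 0 ≤ gapDriftConst k α β r g * targetRate d L lam S h T := by positivity
  unfold gapConst
  linarith

end Setting

end

/-! ### Exponential moments of the weights -/

/-- Square summation of a perturbed contraction. -/
theorem sum_sq_le_of_contraction {D x : ℕ → ℝ} {q θ δ : ℝ} {N : ℕ} (hD : ∀ n, 0 ≤ D n)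
    (hD0 : D 0 = 0) (hx : ∀ n, 0 ≤ x n) (hθ : 0 < θ) (hθ1 : θ ≤ 1) (hδ : 0 ≤ δ)
    (hδN : δ * N ≤ 1) (hq : q ≤ (1 - θ) * (1 + δ))
    (hrec : ∀ n, D (n + 1) ≤ q * D n + x n) :
    ∑ n ∈ Finset.range N, D n ^ 2 ≤ 9 / θ ^ 2 * ∑ n ∈ Finset.range N, x n ^ 2 := by
  set s := 1 + δ with hs
  have hs1 : 1 ≤ s := by linarith
  have hs0 : 0 < s := by linarith
  -- Dividing by powers of s removes the perturbation; going back costs at most 3, squared to 9,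
  -- because sⁿ ≤ 3 for n ≤ N.
  set e : ℕ → ℝ := fun n => D n / s ^ n with he
  have e0 : ∀ n, 0 ≤ e n := fun n => div_nonneg (hD n) (by positivity)
  have erec : ∀ n, e (n + 1) ≤ (1 - θ) * e n + x n := by
    intro n
    have hp : 0 < s ^ (n + 1) := by positivity
    have h1 : D n = e n * s ^ n := by simp only [he]; field_simp
    simp only [he]
    rw [div_le_iff₀ hp]
    change D (n + 1) ≤ ((1 - θ) * e n + x n) * s ^ (n + 1)
    have h2 : q * D n ≤ (1 - θ) * s * D n := mul_le_mul_of_nonneg_right hq (hD n)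
    have h3 : x n ≤ x n * s ^ (n + 1) := le_mul_of_one_le_right (hx n) (one_le_pow₀ hs1)
    calc D (n + 1) ≤ (1 - θ) * s * D n + x n := by linarith [hrec n]
      _ = (1 - θ) * e n * s ^ (n + 1) + x n := by rw [h1]; ring
      _ ≤ _ := by linarith
  -- Convexity of the square: (1 − θ)e + x is a convex combination of e and x/θ.
  have esq : ∀ n, e (n + 1) ^ 2 ≤ (1 - θ) * e n ^ 2 + x n ^ 2 / θ := by
    intro n
    refine (pow_le_pow_left₀ (e0 _) (erec n) 2).trans ?_
    have h1 : (1 - θ) * e n ^ 2 + x n ^ 2 / θ - ((1 - θ) * e n + x n) ^ 2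
        = (1 - θ) * (θ * e n - x n) ^ 2 / θ := by field_simp; ring
    have h2 : 0 ≤ (1 - θ) * (θ * e n - x n) ^ 2 / θ := by
      have : 0 ≤ 1 - θ := by linarith
      positivity
    linarith
  have esum : ∀ M, θ * ∑ n ∈ Finset.range M, e n ^ 2 + e M ^ 2
      ≤ (∑ n ∈ Finset.range M, x n ^ 2) / θ := by
    intro M
    induction M with
    | zero => simp [he, hD0]
    | succ M ih =>
      rw [Finset.sum_range_succ, Finset.sum_range_succ, add_div]
      have := esq M
      linarith
  have hDe : ∀ n ∈ Finset.range N, D n ^ 2 ≤ 9 * e n ^ 2 := by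
    intro n hn
    have h1 : D n = e n * s ^ n := by simp only [he]; field_simp
    have h2 : s ^ n ≤ 3 * 1 ^ n :=
      pow_le_three_mul_pow hs0.le zero_le_one hδ (by linarith) hδN (Finset.mem_range.mp hn).le
    rw [one_pow, mul_one] at h2
    have h3 : (s ^ n) ^ 2 ≤ 3 ^ 2 := pow_le_pow_left₀ (by positivity) h2 2
    rw [h1, mul_pow]
    nlinarith [sq_nonneg (e n)]
  have fin := esum N
  have h1 : θ * ∑ n ∈ Finset.range N, e n ^ 2 ≤ (∑ n ∈ Finset.range N, x n ^ 2) / θ := by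
    linarith [sq_nonneg (e N)]
  have h2 : ∑ n ∈ Finset.range N, e n ^ 2 ≤ (∑ n ∈ Finset.range N, x n ^ 2) / θ ^ 2 := by
    rw [le_div_iff₀ (by positivity)]
    rw [le_div_iff₀ hθ] at h1
    linarith
  calc _ ≤ ∑ n ∈ Finset.range N, 9 * e n ^ 2 := Finset.sum_le_sum hDe
    _ = 9 * ∑ n ∈ Finset.range N, e n ^ 2 := (Finset.mul_sum _ _ _).symm
    _ ≤ 9 * ((∑ n ∈ Finset.range N, x n ^ 2) / θ ^ 2) := by gcongr
    _ = _ := by ring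

/-! ### Exponential martingales and the summed squared gap -/

noncomputable section

variable {d : ℕ}

local notation "E" => EuclideanSpace ℝ (Fin d)

section LogWeight

variable (f : EuclideanSpace ℝ (Fin d) → ℝ) (S h : ℝ)
  (P Q : EuclideanSpace ℝ (Fin d) × EuclideanSpace ℝ (Fin d) → EuclideanSpace ℝ (Fin d))

theorem logWeight_congr (x₀ : E) {w w' : ℕ → E} {N : ℕ} (hw : ∀ i < 2 * N, w i = w' i) :
    logWeight f S h P Q x₀ w N = logWeight f S h P Q x₀ w' N := by
  refine Finset.sum_congr rfl fun n hn => ?_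
  have hn' := Finset.mem_range.mp hn
  rw [evenPath_congr f S h x₀ (w := w) (w' := w') fun i hi => hw i (by omega), hw (2 * n) (by omega),
    hw (2 * n + 1) (by omega)]

variable {f P Q} in
theorem measurable_logWeight (hf : Measurable (∇ f)) (hP : Measurable P) (hQ : Measurable Q)
    (N : ℕ) : Measurable fun q : E × (ℕ → E) => logWeight f S h P Q q.1 q.2 N := by
  unfold logWeight
  refine Finset.measurable_fun_sum _ fun n _ => ?_
  have hz := measurable_evenPath S h hf n
  have hp : Measurable fun q : E × (ℕ → E) => P (evenPath f S h q.1 q.2 n) := hP.comp hz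
  have hq : Measurable fun q : E × (ℕ → E) => Q (evenPath f S h q.1 q.2 n) := hQ.comp hz
  have hw : ∀ i, Measurable fun q : E × (ℕ → E) => q.2 i := fun i => by fun_prop
  exact ((hp.inner (hw _)).add (hq.inner (hw _))).sub
    (((hp.norm.pow_const 2).add (hq.norm.pow_const 2)).const_mul _)

variable {f P Q} in
theorem measurable_logWeight_right (hf : Measurable (∇ f)) (hP : Measurable P) (hQ : Measurable Q)
    (x₀ : E) (N : ℕ) : Measurable fun w : ℕ → E => logWeight f S h P Q x₀ w N := by
  have hc : Measurable fun w : ℕ → E => (x₀, w) := measurable_prodMk_left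
  have := (measurable_logWeight S h hf hP hQ N).comp hc
  simpa only [Function.comp_def] using this

variable {f h P Q} in
/-- The weights have expectation one. -/
theorem lintegral_exp_logWeight (hh : 0 ≤ h) (hf : Measurable (∇ f)) (hP : Measurable P)
    (hQ : Measurable Q) (x₀ : E) (N : ℕ) :
    ∫⁻ w, ENNReal.ofReal (Real.exp (logWeight f S h P Q x₀ w N)) ∂(seqLaw d h) = 1 := by
  induction N with
  | zero => simp [logWeight]
  | succ N ih =>
    have hm := measurable_evenPath_right S h hf x₀ N
    have hl := measurable_logWeight_right S h hf hP hQ x₀ N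
    have c2 := lintegral_infinitePi_eval_two (gaussLaw d h) (2 * N)
      (Φ := fun w x y => ENNReal.ofReal (Real.exp (logWeight f S h P Q x₀ w N
        + (inner ℝ (P (evenPath f S h x₀ w N)) x + inner ℝ (Q (evenPath f S h x₀ w N)) y
        - h / 2 * (‖P (evenPath f S h x₀ w N)‖ ^ 2 + ‖Q (evenPath f S h x₀ w N)‖ ^ 2)))))
      (by fun_prop)
      (fun w w' x y hw => by
        rw [evenPath_congr f S h x₀ hw, logWeight_congr f S h P Q x₀ hw])
    simp only [logWeight_succ]
    unfold seqLaw at ih ⊢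
    rw [c2, ← ih]
    refine lintegral_congr fun w => ?_
    set p := P (evenPath f S h x₀ w N)
    set q := Q (evenPath f S h x₀ w N)
    set l := logWeight f S h P Q x₀ w N
    have e : ∀ x y : E, ENNReal.ofReal (Real.exp (l + (inner ℝ p x + inner ℝ q y
        - h / 2 * (‖p‖ ^ 2 + ‖q‖ ^ 2))))
        = ENNReal.ofReal (Real.exp (l - h / 2 * (‖p‖ ^ 2 + ‖q‖ ^ 2)))
          * ENNReal.ofReal (Real.exp (inner ℝ p x)) * ENNReal.ofReal (Real.exp (inner ℝ q y)) := by
      intro x y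
      rw [← ENNReal.ofReal_mul (Real.exp_pos _).le, ← Real.exp_add,
        ← ENNReal.ofReal_mul (Real.exp_pos _).le, ← Real.exp_add]
      congr 2; ring
    have e1 : ∀ x : E, ∫⁻ y, ENNReal.ofReal (Real.exp (l + (inner ℝ p x + inner ℝ q y
        - h / 2 * (‖p‖ ^ 2 + ‖q‖ ^ 2)))) ∂(gaussLaw d h)
        = ENNReal.ofReal (Real.exp (l - h / 2 * (‖p‖ ^ 2 + ‖q‖ ^ 2)))
          * ENNReal.ofReal (Real.exp (h * ‖q‖ ^ 2 / 2))
          * ENNReal.ofReal (Real.exp (inner ℝ p x)) := by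
      intro x
      rw [lintegral_congr (e x), lintegral_const_mul _ (by fun_prop), lintegral_exp_inner hh]
      ring
    rw [lintegral_congr e1, lintegral_const_mul _ (by fun_prop), lintegral_exp_inner hh,
      ← ENNReal.ofReal_mul (Real.exp_pos _).le, ← Real.exp_add,
      ← ENNReal.ofReal_mul (Real.exp_pos _).le, ← Real.exp_add]
    congr 2; ring

/-- The integrands are controlled by the gap. -/
structure Integrands : Prop where
  meas_P : Measurable P
  meas_Q : Measurable Q
  norm_P : ∀ y, ‖P y‖ ^ 2 ≤ S ^ 2 * ‖y.1 - y.2‖ ^ 2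
  norm_Q : ∀ y, ‖Q y‖ ^ 2 ≤ 2 * S ^ 2 * ‖y.1 - y.2‖ ^ 2

end LogWeight

namespace Setting

variable {f : EuclideanSpace ℝ (Fin d) → ℝ} {L lam α β G S h T ε r κ g : ℝ} {N : ℕ}
  {x₀ : EuclideanSpace ℝ (Fin d)}
  {P Q : EuclideanSpace ℝ (Fin d) × EuclideanSpace ℝ (Fin d) → EuclideanSpace ℝ (Fin d)}

theorem div_sqrt_two_sq (S : ℝ) : (S / √2) ^ 2 = S ^ 2 / 2 := by
  rw [div_pow, Real.sq_sqrt (by norm_num)]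

theorem integrands_fine (H : Setting f L lam α β G S h T ε r κ g N x₀) :
    Integrands S (fineP (d := d) S) (fineQ f S h) where
  meas_P := by unfold fineP; fun_prop
  meas_Q := by
    have := H.meas
    unfold fineQ midGap; fun_prop
  norm_P y := by
    rw [fineP, norm_smul_sq, div_sqrt_two_sq]
    nlinarith [mul_nonneg (sq_nonneg S) (sq_nonneg ‖y.1 - y.2‖)]
  norm_Q y := by
    rw [fineQ, norm_smul_sq, div_sqrt_two_sq]
    have h1 := (H.drift.midGap_le H.small H.ε_nonneg H.ε_le y.1 y.2).2
    have h2 := pow_le_pow_left₀ (norm_nonneg _) h1 2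
    have h3 := mul_le_mul_of_nonneg_left h2 (by positivity : 0 ≤ S ^ 2 / 2)
    linarith

theorem integrands_coarse (S : ℝ) : Integrands S (coarseP (d := d) S) (coarseP S) where
  meas_P := by unfold coarseP; fun_prop
  meas_Q := by unfold coarseP; fun_prop
  norm_P y := by
    rw [coarseP, norm_smul_sq, neg_sq, div_sqrt_two_sq]
    nlinarith [mul_nonneg (sq_nonneg S) (sq_nonneg ‖y.1 - y.2‖)]
  norm_Q y := by
    rw [coarseP, norm_smul_sq, neg_sq, div_sqrt_two_sq]
    nlinarith [mul_nonneg (sq_nonneg S) (sq_nonneg ‖y.1 - y.2‖)]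

/-- Pathwise estimate of the gap. -/
theorem gap_norm_le (H : Setting f L lam α β G S h T ε r κ g N x₀) (w : ℕ → E) (n : ℕ) :
    ‖gap f S h x₀ w (n + 1)‖ ≤ gapFactor S lam L h * ‖gap f S h x₀ w n‖
      + h * L * (h * ‖∇ f (evenPath f S h x₀ w n).1‖ + 2 * ‖w (2 * n)‖) := by
  have hh := H.small.h_pos
  have hL := H.small.L_pos
  have h1 := H.drift.gapMean_le H.small H.ε_nonneg H.ε_le H.lam_nonneg H.lam_lt
    (evenPath f S h x₀ w n).1 (evenPath f S h x₀ w n).2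
  have e : gapOdd f S h (evenPath f S h x₀ w n) (w (2 * n))
      + gapRem f S h (evenPath f S h x₀ w n) (w (2 * n))
      = -h • (∇ f (fineMean (∇ f) S h (evenPath f S h x₀ w n).1 (evenPath f S h x₀ w n).2
        + √2 • w (2 * n))
        - ∇ f (fineMean (∇ f) S h (evenPath f S h x₀ w n).1 (evenPath f S h x₀ w n).2)) := by
    unfold gapOdd gapRem; module
  rw [gap_succ, add_assoc, e]
  refine (norm_add_le _ _).trans ?_
  have h2 : √2 ≤ 2 := Real.sqrt_le_iff.mpr ⟨by norm_num, by norm_num⟩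
  have h3 : ‖-h • (∇ f (fineMean (∇ f) S h (evenPath f S h x₀ w n).1 (evenPath f S h x₀ w n).2
        + √2 • w (2 * n))
        - ∇ f (fineMean (∇ f) S h (evenPath f S h x₀ w n).1 (evenPath f S h x₀ w n).2))‖
      ≤ h * (L * (2 * ‖w (2 * n)‖)) := by
    rw [norm_smul, norm_neg, Real.norm_of_nonneg hh.le]
    refine mul_le_mul_of_nonneg_left ((H.drift.lip _ _).trans ?_) hh.le
    rw [add_sub_cancel_left, norm_smul, Real.norm_of_nonneg (Real.sqrt_nonneg 2)]
    gcongr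
  unfold gap gapFactor
  linarith

theorem N_pos (H : Setting f L lam α β G S h T ε r κ g N x₀) : 0 < N := by
  rcases Nat.eq_zero_or_pos N with h0 | h0
  · have h1 := H.T_eq
    rw [h0] at h1
    have := H.T_pos
    simp at h1
    linarith
  · exact h0

/-- Pathwise estimate of the quadratic variation of the log-weights. -/
theorem sum_gap_sq_le (H : Setting f L lam α β G S h T ε r κ g N x₀) {q : ℝ}
    (hq : 100000 * q ^ 2 * ε ≤ 1) (w : ℕ → E) :
    6 * q ^ 2 * (h * S ^ 2) * ∑ n ∈ Finset.range N, ‖gap f S h x₀ w n‖ ^ 2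
      ≤ ∑ n ∈ Finset.range N, (1 / (N : ℝ)) * (1
        + (1 / 2) * (expRate d α * (‖(evenPath f S h x₀ w n).1‖ ^ 2
          + ‖(evenPath f S h x₀ w n).2‖ ^ 2))
        + (1 / 2) * (1 / (4 * (h * d)) * ‖w (2 * n)‖ ^ 2)) := by
  have hh := H.small.h_pos
  have hL := H.small.L_pos
  have hS := H.small.S_pos
  have hα := H.small.α_pos
  have hm := H.m_pos
  have hT := H.T_pos
  have hε0 := H.ε_nonneg
  have hd : (1 : ℝ) ≤ d := by exact_mod_cast H.one_le_d
  have hd0 : (0 : ℝ) < d := by linarith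
  have hN : (0 : ℝ) < N := by exact_mod_cast H.N_pos
  have hm1 := H.hm_le
  have hm0 := H.hm_pos
  have key := sum_sq_le_of_contraction (D := fun n => ‖gap f S h x₀ w n‖)
    (x := fun n => h * L * (h * ‖∇ f (evenPath f S h x₀ w n).1‖ + 2 * ‖w (2 * n)‖))
    (q := gapFactor S lam L h) (θ := h * (2 * S - lam) / 4) (δ := 10 * h ^ 2 * L ^ 2) (N := N)
    (fun n => norm_nonneg _) (by simp [gap, evenPath]) (fun n => by positivity) (by linarith)
    (by linarith) (by positivity)
    (by
      have h3 := H.T_hL2_le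
      have h4 := H.ε_le
      rw [H.T_eq] at h3
      linarith)
    (by
      unfold gapFactor
      nlinarith [sq_nonneg (h * L)])
    (H.gap_norm_le w)
  refine (mul_le_mul_of_nonneg_left key (by positivity)).trans ?_
  rw [Finset.mul_sum, Finset.mul_sum]
  refine Finset.sum_le_sum fun n _ => ?_
  set m := 2 * S - lam with hmd
  set a := ‖(evenPath f S h x₀ w n).1‖ with ha
  set ξ := ‖w (2 * n)‖ with hξ
  have hF2 := H.drift.norm_sq_le (evenPath f S h x₀ w n).1
  set F := ‖∇ f (evenPath f S h x₀ w n).1‖ with hF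
  have hz : (h * F + 2 * ξ) ^ 2 ≤ 4 * h ^ 2 * (L ^ 2 * a ^ 2 + G ^ 2) + 8 * ξ ^ 2 := by
    nlinarith [sq_nonneg (h * F - 2 * ξ), mul_le_mul_of_nonneg_left hF2 (sq_nonneg h)]
  -- The T-dependent restriction supplies exactly the factor 1/N that makes the sum over time an
  -- average.
  have htime : h * S ^ 2 * L ^ 2 / m ^ 2 ≤ ε / (2 * N * h * d) := by
    rw [div_le_div_iff₀ (by positivity) (by positivity)]
    have := H.time
    rw [H.T_eq] at this
    linarith
  have e1 : 6 * q ^ 2 * (h * S ^ 2) * (9 / (h * m / 4) ^ 2 * (h * L * (h * F + 2 * ξ)) ^ 2)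
      = 864 * q ^ 2 * (h * F + 2 * ξ) ^ 2 * (h * S ^ 2 * L ^ 2 / m ^ 2) := by
    field_simp; ring
  rw [e1]
  have s1 : 864 * q ^ 2 * (h * F + 2 * ξ) ^ 2 * (h * S ^ 2 * L ^ 2 / m ^ 2)
      ≤ 864 * q ^ 2 * (4 * h ^ 2 * (L ^ 2 * a ^ 2 + G ^ 2) + 8 * ξ ^ 2) * (ε / (2 * N * h * d)) := by
    gcongr
  refine s1.trans ?_
  have e2 : 864 * q ^ 2 * (4 * h ^ 2 * (L ^ 2 * a ^ 2 + G ^ 2) + 8 * ξ ^ 2) * (ε / (2 * N * h * d))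
      = 1 / N * (1728 * (q ^ 2 * ε) * ((h * L ^ 2) * a ^ 2 / d + (h * G ^ 2) / d)
        + 13824 * (q ^ 2 * ε) * (1 / (4 * (h * d)) * ξ ^ 2)) := by
    field_simp; ring
  rw [e2]
  refine mul_le_mul_of_nonneg_left ?_ (by positivity)
  have hqε : q ^ 2 * ε ≤ 1 / 100000 := by linarith
  have hqε0 : 0 ≤ q ^ 2 * ε := by positivity
  have b1 : (h * L ^ 2) * a ^ 2 / d ≤ 1 / 1000 * α * a ^ 2 / d := by
    have := (H.small.mono H.ε_le).hL2
    gcongr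
  have b2 : (h * G ^ 2) / d ≤ 1 := by
    rw [div_le_one hd0]
    have := H.small.hG2
    linarith [H.ε_le]
  have b3 : 1 / 1000 * α * a ^ 2 / d = 10 * (expRate d α * a ^ 2) := by
    unfold expRate; field_simp; ring
  rw [b3] at b1
  have r0 := expRate_nonneg (d := d) hα.le
  have c0 : 0 ≤ expRate d α * a ^ 2 := by positivity
  have c1 : 0 ≤ expRate d α * ‖(evenPath f S h x₀ w n).2‖ ^ 2 := by positivity
  have c2 : 0 ≤ 1 / (4 * (h * d)) * ξ ^ 2 := by positivity
  have c3 := mul_le_mul_of_nonneg_right hqε c0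
  have c4 := mul_le_mul_of_nonneg_right hqε c2
  have c5 := mul_le_mul_of_nonneg_left (add_le_add b1 b2) hqε0
  linarith

/-- Jensen's inequality over the time average, and again between path and noise, leaves only
exponential moments at single times, each bounded uniformly in n. -/
theorem lintegral_exp_sum_gap_le (H : Setting f L lam α β G S h T ε r κ g N x₀) {q : ℝ}
    (hq : 100000 * q ^ 2 * ε ≤ 1) :
    ∫⁻ w, ENNReal.ofReal (Real.exp
        (6 * q ^ 2 * (h * S ^ 2) * ∑ n ∈ Finset.range N, ‖gap f S h x₀ w n‖ ^ 2)) ∂(seqLaw d h)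
      ≤ ENNReal.ofReal (Real.exp (1 + pathExponent α β r)) := by
  have hh := H.small.h_pos
  have hd0 : (0 : ℝ) < d := by exact_mod_cast H.one_le_d
  have hN : (0 : ℝ) < N := by exact_mod_cast H.N_pos
  have hB : 1 ≤ pathExponent α β r := by
    unfold pathExponent
    nlinarith [H.β_nonneg, mul_nonneg H.small.α_pos.le (sq_nonneg r)]
  set B := pathExponent α β r with hBd
  set u : ℕ → (ℕ → E) → ℝ := fun n w => expRate d α * (‖(evenPath f S h x₀ w n).1‖ ^ 2
          + ‖(evenPath f S h x₀ w n).2‖ ^ 2) with hu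
  set v : ℕ → (ℕ → E) → ℝ := fun n w => 1 / (4 * (h * d)) * ‖w (2 * n)‖ ^ 2 with hv
  have mu : ∀ n, Measurable (u n) := fun n => by
    have := measurable_evenPath_right S h H.meas x₀ n
    simp only [hu]; fun_prop
  have mv : ∀ n, Measurable (v n) := fun n => by simp only [hv]; fun_prop
  have pt : ∀ w, ENNReal.ofReal (Real.exp
        (6 * q ^ 2 * (h * S ^ 2) * ∑ n ∈ Finset.range N, ‖gap f S h x₀ w n‖ ^ 2))
      ≤ ∑ n ∈ Finset.range N, ENNReal.ofReal (1 / N * (Real.exp 1 / 2))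
        * (ENNReal.ofReal (Real.exp (u n w)) + ENNReal.ofReal (Real.exp (v n w))) := by
    intro w
    have e : ∀ n, ENNReal.ofReal (1 / N * (Real.exp 1 / 2))
        * (ENNReal.ofReal (Real.exp (u n w)) + ENNReal.ofReal (Real.exp (v n w)))
        = ENNReal.ofReal (1 / N * (Real.exp 1 / 2) * (Real.exp (u n w) + Real.exp (v n w))) := by
      intro n
      rw [← ENNReal.ofReal_add (Real.exp_pos _).le (Real.exp_pos _).le,
        ← ENNReal.ofReal_mul (by positivity)]
    simp only [e]
    rw [← ENNReal.ofReal_sum_of_nonneg fun n _ => by positivity]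
    refine ENNReal.ofReal_le_ofReal ((Real.exp_le_exp.mpr (H.sum_gap_sq_le hq w)).trans ?_)
    have conv := convexOn_exp.map_sum_le (t := Finset.range N) (w := fun _ => (1 : ℝ) / N)
      (p := fun n => 1 + (1 / 2) * u n w + (1 / 2) * v n w) (fun _ _ => by positivity)
      (by simp [hN.ne']) (fun _ _ => Set.mem_univ _)
    simp only [smul_eq_mul] at conv
    refine conv.trans (Finset.sum_le_sum fun n _ => ?_)
    rw [mul_assoc]
    refine mul_le_mul_of_nonneg_left ?_ (by positivity)
    have c2 := convexOn_exp.2 (Set.mem_univ (u n w)) (Set.mem_univ (v n w))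
      (by norm_num : (0 : ℝ) ≤ 1 / 2) (by norm_num : (0 : ℝ) ≤ 1 / 2) (by norm_num)
    simp only [smul_eq_mul] at c2
    rw [add_assoc, Real.exp_add]
    have := mul_le_mul_of_nonneg_left c2 (Real.exp_pos 1).le
    linarith
  have iu : ∀ n, ∫⁻ w, ENNReal.ofReal (Real.exp (u n w)) ∂(seqLaw d h)
      ≤ ENNReal.ofReal (Real.exp B) := fun n =>
    lintegral_exp_path_le H.drift H.meas H.small H.ε_nonneg H.ε_le H.one_le_d H.β_nonneg H.init n
  have iv : ∀ n, ∫⁻ w, ENNReal.ofReal (Real.exp (v n w)) ∂(seqLaw d h)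
      ≤ ENNReal.ofReal (Real.exp B) := by
    intro n
    have mp : MeasurePreserving (fun w : ℕ → E => w (2 * n)) (seqLaw d h) (gaussLaw d h) :=
      measurePreserving_eval_infinitePi _ (2 * n)
    have h1 := mp.lintegral_comp
      (f := fun x : E => ENNReal.ofReal (Real.exp (1 / (4 * (h * d)) * ‖x‖ ^ 2))) (by fun_prop)
    simp only [hv]
    rw [h1]
    have h2 : 1 / (4 * (h * d)) * d * h = 1 / 4 := by field_simp
    refine (lintegral_exp_mul_norm_sq H.one_le_d hh (by positivity) h2.le).trans ?_
    rw [h2]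
    exact ENNReal.ofReal_le_ofReal (Real.exp_le_exp.mpr (by linarith))
  calc _ ≤ ∫⁻ w, ∑ n ∈ Finset.range N, ENNReal.ofReal (1 / N * (Real.exp 1 / 2))
        * (ENNReal.ofReal (Real.exp (u n w)) + ENNReal.ofReal (Real.exp (v n w)))
          ∂(seqLaw d h) := lintegral_mono pt
    _ = ∑ n ∈ Finset.range N, ENNReal.ofReal (1 / N * (Real.exp 1 / 2))
        * (∫⁻ w, ENNReal.ofReal (Real.exp (u n w)) ∂(seqLaw d h)
          + ∫⁻ w, ENNReal.ofReal (Real.exp (v n w)) ∂(seqLaw d h)) := by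
        rw [lintegral_finsetSum _ fun n _ => by have := mu n; have := mv n; fun_prop]
        refine Finset.sum_congr rfl fun n _ => ?_
        have := mu n
        have := mv n
        rw [lintegral_const_mul _ (by fun_prop), lintegral_add_left (by fun_prop)]
    _ ≤ ∑ n ∈ Finset.range N, ENNReal.ofReal (1 / N * (Real.exp 1 / 2))
        * (ENNReal.ofReal (Real.exp B) + ENNReal.ofReal (Real.exp B)) := by
        gcongr with n _
        · exact iu n
        · exact iv n
    _ = _ := by
        rw [Finset.sum_const, Finset.card_range, nsmul_eq_mul,
          ← ENNReal.ofReal_add (by positivity) (by positivity),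
          ← ENNReal.ofReal_mul (by positivity), ← ENNReal.ofReal_natCast,
          ← ENNReal.ofReal_mul (by positivity), Real.exp_add]
        congr 1
        field_simp
        norm_num

end Setting

end

/-! ### Moments of the weights and of the log-weights -/

noncomputable section

variable {d : ℕ}

local notation "E" => EuclideanSpace ℝ (Fin d)

/-- Bound of the moments of the weights. -/
def weightConst (α β r : ℝ) : ℝ := Real.exp (1 + pathExponent α β r)

/-- The martingale part of the log-weight. -/
def logWeightMart (f : E → ℝ) (S h : ℝ) (P Q : E × E → E) (x₀ : E) (w : ℕ → E) (N : ℕ) : ℝ :=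
  ∑ n ∈ Finset.range N, (inner ℝ (P (evenPath f S h x₀ w n)) (w (2 * n))
    + inner ℝ (Q (evenPath f S h x₀ w n)) (w (2 * n + 1)))

/-- The quadratic part of the log-weight. -/
def logWeightVar (f : E → ℝ) (S h : ℝ) (P Q : E × E → E) (x₀ : E) (w : ℕ → E) (N : ℕ) : ℝ :=
  h / 2 * ∑ n ∈ Finset.range N,
    (‖P (evenPath f S h x₀ w n)‖ ^ 2 + ‖Q (evenPath f S h x₀ w n)‖ ^ 2)

theorem logWeight_eq_sub (f : E → ℝ) (S h : ℝ) (P Q : E × E → E) (x₀ : E) (w : ℕ → E) (N : ℕ) :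
    logWeight f S h P Q x₀ w N
      = logWeightMart f S h P Q x₀ w N - logWeightVar f S h P Q x₀ w N := by
  unfold logWeight logWeightMart logWeightVar
  rw [Finset.mul_sum, ← Finset.sum_sub_distrib]

section

variable {f : EuclideanSpace ℝ (Fin d) → ℝ} (S h : ℝ)
  {P Q : EuclideanSpace ℝ (Fin d) × EuclideanSpace ℝ (Fin d) → EuclideanSpace ℝ (Fin d)}

theorem measurable_logWeightVar (hf : Measurable (∇ f)) (hP : Measurable P) (hQ : Measurable Q)
    (x₀ : E) (N : ℕ) : Measurable fun w : ℕ → E => logWeightVar f S h P Q x₀ w N := by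
  unfold logWeightVar
  refine (Finset.measurable_fun_sum _ fun n _ => ?_).const_mul _
  have hz := measurable_evenPath_right S h hf x₀ n
  exact ((hP.comp hz).norm.pow_const 2).add ((hQ.comp hz).norm.pow_const 2)

theorem measurable_logWeightMart (hf : Measurable (∇ f)) (hP : Measurable P) (hQ : Measurable Q)
    (x₀ : E) (N : ℕ) : Measurable fun w : ℕ → E => logWeightMart f S h P Q x₀ w N := by
  have e : (fun w : ℕ → E => logWeightMart f S h P Q x₀ w N)
      = fun w => logWeight f S h P Q x₀ w N + logWeightVar f S h P Q x₀ w N := by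
    funext w
    rw [logWeight_eq_sub, sub_add_cancel]
  rw [e]
  exact (measurable_logWeight_right S h hf hP hQ x₀ N).add
    (measurable_logWeightVar S h hf hP hQ x₀ N)

end

theorem logWeightMart_congr (f : E → ℝ) (S h : ℝ) (P Q : E × E → E) (x₀ : E) {w w' : ℕ → E}
    {N : ℕ} (hw : ∀ i < 2 * N, w i = w' i) :
    logWeightMart f S h P Q x₀ w N = logWeightMart f S h P Q x₀ w' N := by
  refine Finset.sum_congr rfl fun n hn => ?_
  have hn' := Finset.mem_range.mp hn
  rw [evenPath_congr f S h x₀ (w := w) (w' := w') fun i hi => hw i (by omega), hw (2 * n) (by omega),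
    hw (2 * n + 1) (by omega)]

namespace Integrands

variable {f : EuclideanSpace ℝ (Fin d) → ℝ} {S h : ℝ}
  {P Q : EuclideanSpace ℝ (Fin d) × EuclideanSpace ℝ (Fin d) → EuclideanSpace ℝ (Fin d)}

theorem norm_P_le (I : Integrands S P Q) (hS : 0 ≤ S) (y : E × E) :
    ‖P y‖ ≤ S * ‖y.1 - y.2‖ := by
  have h1 := I.norm_P y
  rw [← mul_pow] at h1
  exact (abs_le_of_sq_le_sq' h1 (by positivity)).2

theorem norm_Q_le (I : Integrands S P Q) (hS : 0 ≤ S) (y : E × E) :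
    ‖Q y‖ ≤ 2 * S * ‖y.1 - y.2‖ := by
  have h1 := I.norm_Q y
  have h2 : ‖Q y‖ ^ 2 ≤ (2 * S * ‖y.1 - y.2‖) ^ 2 := by
    nlinarith [mul_nonneg (sq_nonneg S) (sq_nonneg ‖y.1 - y.2‖)]
  exact (abs_le_of_sq_le_sq' h2 (by positivity)).2

theorem logWeightVar_nonneg (hh : 0 ≤ h) (x₀ : E) (w : ℕ → E) (N : ℕ) :
    0 ≤ logWeightVar f S h P Q x₀ w N :=
  mul_nonneg (by positivity) (Finset.sum_nonneg fun n _ => by positivity)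

theorem sum_norm_sq_le (I : Integrands S P Q) (x₀ : E) (w : ℕ → E) (N : ℕ) :
    ∑ n ∈ Finset.range N, (‖P (evenPath f S h x₀ w n)‖ ^ 2 + ‖Q (evenPath f S h x₀ w n)‖ ^ 2)
      ≤ 3 * S ^ 2 * ∑ n ∈ Finset.range N, ‖gap f S h x₀ w n‖ ^ 2 := by
  rw [Finset.mul_sum]
  refine Finset.sum_le_sum fun n _ => ?_
  have h1 := I.norm_P (evenPath f S h x₀ w n)
  have h2 := I.norm_Q (evenPath f S h x₀ w n)
  unfold gap
  linarith

theorem logWeightVar_le (I : Integrands S P Q) (hh : 0 ≤ h) (x₀ : E) (w : ℕ → E) (N : ℕ) :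
    logWeightVar f S h P Q x₀ w N
      ≤ 3 / 2 * (h * S ^ 2) * ∑ n ∈ Finset.range N, ‖gap f S h x₀ w n‖ ^ 2 := by
  have := mul_le_mul_of_nonneg_left (I.sum_norm_sq_le (f := f) (h := h) x₀ w N)
    (by positivity : 0 ≤ h / 2)
  unfold logWeightVar
  linarith

end Integrands

/-- Rate of the log-weights. -/
def springRate (d : ℕ) (L lam S h T : ℝ) : ℝ :=
  √T * S * (h * L * (√d * (L + √d)) / (2 * S - lam))

/-- Constant in the moment bound of the martingale part of the log-weights. -/
def martConst (k : ℕ) (α β r g κ : ℝ) : ℝ :=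
  √(symmConst k) * (12 * (2 * k).factorial) * gapConst k α β r g κ

/-- Constant in the moment bound of the quadratic part of the log-weights. -/
def varConst (k : ℕ) (α β r g κ : ℝ) : ℝ :=
  (2 * k).factorial * weightConst α β r * gapConst (2 * k) α β r g κ

namespace Setting

variable {f : EuclideanSpace ℝ (Fin d) → ℝ} {L lam α β G S h T ε r κ g : ℝ} {N : ℕ}
  {x₀ : EuclideanSpace ℝ (Fin d)}
  {P Q : EuclideanSpace ℝ (Fin d) × EuclideanSpace ℝ (Fin d) → EuclideanSpace ℝ (Fin d)}

theorem one_le_pathExponent (H : Setting f L lam α β G S h T ε r κ g N x₀) :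
    1 ≤ pathExponent α β r := by
  unfold pathExponent
  nlinarith [H.β_nonneg, mul_nonneg H.small.α_pos.le (sq_nonneg r)]

theorem one_le_weightConst (H : Setting f L lam α β G S h T ε r κ g N x₀) :
    1 ≤ weightConst α β r :=
  Real.one_le_exp (by linarith [H.one_le_pathExponent])

theorem springRate_nonneg (H : Setting f L lam α β G S h T ε r κ g N x₀) :
    0 ≤ springRate d L lam S h T := by
  have := H.small.h_pos
  have := H.small.L_pos
  have := H.small.S_pos
  have := H.m_pos
  unfold springRate
  positivity

theorem sqrt_mul_springRate (d : ℕ) (L lam S h T : ℝ) :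
    √d * springRate d L lam S h T = targetRate d L lam S h T := by
  have hdd : √(d : ℝ) * √d = d := Real.mul_self_sqrt (by positivity)
  unfold springRate targetRate
  calc _ = √T * (S * L * (√d * √d) * (L + √d) / (2 * S - lam)) * h := by ring
    _ = _ := by rw [hdd]

theorem measurable_gap (H : Setting f L lam α β G S h T ε r κ g N x₀) (n : ℕ) :
    Measurable fun w => gap f S h x₀ w n := by
  have := measurable_evenPath_right S h H.meas x₀ n
  simp only [gap]
  fun_prop

/-- Multiplying the integrands by 2q gives another exponential martingale, of mean one. Half of its
logarithm exceeds q times the original one up to hq² times the quadratic sum, and the Cauchy–Schwarz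
inequality separates the two parts. -/
theorem lintegral_exp_mul_logWeight_le (H : Setting f L lam α β G S h T ε r κ g N x₀)
    (I : Integrands S P Q) {q : ℝ} (hq0 : 0 ≤ q) (hq : 100000 * q ^ 2 * ε ≤ 1) :
    ∫⁻ w, ENNReal.ofReal (Real.exp (q * logWeight f S h P Q x₀ w N)) ∂(seqLaw d h)
      ≤ ENNReal.ofReal (weightConst α β r) := by
  have hh := H.small.h_pos
  set P' : E × E → E := fun y => (2 * q) • P y with hP'
  set Q' : E × E → E := fun y => (2 * q) • Q y with hQ'
  have mP' : Measurable P' := I.meas_P.const_smul (2 * q)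
  have mQ' : Measurable Q' := I.meas_Q.const_smul (2 * q)
  set u : (ℕ → E) → ℝ := fun w => 1 / 2 * logWeight f S h P' Q' x₀ w N with hu
  set v : (ℕ → E) → ℝ := fun w =>
    3 * q ^ 2 * (h * S ^ 2) * ∑ n ∈ Finset.range N, ‖gap f S h x₀ w n‖ ^ 2 with hv
  have mu : Measurable u := (measurable_logWeight_right S h H.meas mP' mQ' x₀ N).const_mul _
  have mv : Measurable v := (Finset.measurable_fun_sum _ fun n _ =>
    (H.measurable_gap n).norm.pow_const 2).const_mul _
  have iu : ∫⁻ w, ENNReal.ofReal (Real.exp (2 * u w)) ∂(seqLaw d h)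
      ≤ ENNReal.ofReal (Real.exp (2 * 0)) := by
    have e : ∀ w, 2 * u w = logWeight f S h P' Q' x₀ w N := fun w => by simp only [hu]; ring
    simp only [e]
    rw [lintegral_exp_logWeight S hh.le H.meas mP' mQ' x₀ N]
    simp
  have iv : ∫⁻ w, ENNReal.ofReal (Real.exp (2 * v w)) ∂(seqLaw d h)
      ≤ ENNReal.ofReal (Real.exp (2 * ((1 + pathExponent α β r) / 2))) := by
    have e : ∀ w, 2 * v w
        = 6 * q ^ 2 * (h * S ^ 2) * ∑ n ∈ Finset.range N, ‖gap f S h x₀ w n‖ ^ 2 :=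
      fun w => by simp only [hv]; ring
    simp only [e]
    rw [mul_div_cancel₀ _ (by norm_num : (2 : ℝ) ≠ 0)]
    exact H.lintegral_exp_sum_gap_le hq
  have pt : ∀ w, q * logWeight f S h P Q x₀ w N ≤ u w + v w := by
    intro w
    have e : logWeight f S h P' Q' x₀ w N
        = 2 * q * logWeight f S h P Q x₀ w N + (h * q - 2 * h * q ^ 2)
          * ∑ n ∈ Finset.range N,
            (‖P (evenPath f S h x₀ w n)‖ ^ 2 + ‖Q (evenPath f S h x₀ w n)‖ ^ 2) := by
      unfold logWeight
      rw [Finset.mul_sum, Finset.mul_sum, ← Finset.sum_add_distrib]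
      refine Finset.sum_congr rfl fun n _ => ?_
      simp only [hP', hQ', norm_smul_sq, real_inner_smul_left]
      ring
    have s := mul_le_mul_of_nonneg_left (I.sum_norm_sq_le (f := f) (h := h) x₀ w N)
      (by positivity : 0 ≤ h * q ^ 2)
    have s0 : 0 ≤ h * q * ∑ n ∈ Finset.range N,
        (‖P (evenPath f S h x₀ w n)‖ ^ 2 + ‖Q (evenPath f S h x₀ w n)‖ ^ 2) :=
      mul_nonneg (by positivity) (Finset.sum_nonneg fun n _ => by positivity)
    simp only [hu, hv]
    rw [e]
    linarith
  calc _ ≤ ∫⁻ w, ENNReal.ofReal (Real.exp (u w + v w)) ∂(seqLaw d h) :=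
        lintegral_mono fun w => ENNReal.ofReal_le_ofReal (Real.exp_le_exp.mpr (pt w))
    _ ≤ _ := lintegral_exp_add_le _ mu mv iu iv
    _ ≤ _ := by
        refine ENNReal.ofReal_le_ofReal (Real.exp_le_exp.mpr ?_)
        linarith [H.one_le_pathExponent]

/-- The moments of the weights are bounded. -/
theorem eLpNorm_exp_logWeight_le (H : Setting f L lam α β G S h T ε r κ g N x₀)
    (I : Integrands S P Q) {k : ℕ} (hk : k ≠ 0) (hε : 100000 * (k : ℝ) ^ 2 * ε ≤ 1) :
    eLpNorm (fun w => Real.exp (logWeight f S h P Q x₀ w N)) (k : ℝ≥0∞) (seqLaw d h)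
      ≤ ENNReal.ofReal (weightConst α β r) := by
  have h1 := H.one_le_weightConst
  rw [eLpNorm_nat_le_iff _ hk (by linarith)]
  have e : ∀ w : ℕ → E, ‖Real.exp (logWeight f S h P Q x₀ w N)‖ ^ k
      = Real.exp (k * logWeight f S h P Q x₀ w N) := fun w => by
    rw [Real.norm_of_nonneg (Real.exp_pos _).le, Real.exp_nat_mul]
  simp only [e]
  exact (H.lintegral_exp_mul_logWeight_le I (Nat.cast_nonneg k) hε).trans
    (ENNReal.ofReal_le_ofReal (le_self_pow₀ h1 hk))

theorem eLpNorm_integrand_le (H : Setting f L lam α β G S h T ε r κ g N x₀)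
    {R : E × E → E} {s : ℝ} (hs : 0 ≤ s) (hR : ∀ y, ‖R y‖ ≤ s * ‖y.1 - y.2‖) {n : ℕ}
    (hn : n ≤ N) {k : ℕ} (hk : k ≠ 0) :
    eLpNorm (fun w => R (evenPath f S h x₀ w n)) ((2 * k : ℕ) : ℝ≥0∞) (seqLaw d h)
      ≤ ENNReal.ofReal (s * (gapConst k α β r g κ
        * (h * L * (√d * (L + √d)) / (2 * S - lam)))) := by
  refine (eLpNorm_le_mul_eLpNorm_of_ae_le_mul (c := s) (g := fun w => gap f S h x₀ w n)
    (ae_of_all _ fun w => hR _) _).trans ?_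
  rw [ENNReal.ofReal_mul hs]
  gcongr
  exact H.eLpNorm_gap_le_uniform hn hk

/-- Each coarse step adds a term that is odd under reflection of the increments from time 2n on. The
squares of the norms therefore add, and N steps cost only √N. -/
theorem eLpNorm_logWeightMart_le (H : Setting f L lam α β G S h T ε r κ g N x₀)
    (I : Integrands S P Q) {k : ℕ} (hk : k ≠ 0) :
    eLpNorm (fun w => logWeightMart f S h P Q x₀ w N) ((2 * k : ℕ) : ℝ≥0∞) (seqLaw d h)
      ≤ ENNReal.ofReal (martConst k α β r g κ * springRate d L lam S h T) := by
  have hh := H.small.h_pos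
  have hS := H.small.S_pos
  have hL := H.small.L_pos
  have hm := H.m_pos
  have hgc := H.gapConst_nonneg k
  have hsc : 0 ≤ symmConst k := zero_le_one.trans (symmConst_ge_one _)
  set Y := gapConst k α β r g κ * (h * L * (√d * (L + √d)) / (2 * S - lam)) with hY
  have hY0 : 0 ≤ Y := by positivity
  set M : ℝ := ((2 * k).factorial : ℝ) with hM
  have hM0 : 0 ≤ M := by positivity
  have h1k : (1 : ℝ≥0∞) ≤ ((2 * k : ℕ) : ℝ≥0∞) := by
    have : 1 ≤ 2 * k := by omega
    exact_mod_cast this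
  set x := 12 * M * (√h * (S * Y)) with hx
  have hx0 : 0 ≤ x := by positivity
  have main : ∀ n ≤ N, eLpNorm (fun w => logWeightMart f S h P Q x₀ w n)
      ((2 * k : ℕ) : ℝ≥0∞) (seqLaw d h) ≤ ENNReal.ofReal √(n * (symmConst k * x ^ 2)) := by
    intro n
    induction n with
    | zero => intro _; simp [logWeightMart]
    | succ n ih =>
      intro hn
      have hz := measurable_evenPath_right S h H.meas x₀ n
      have mP : Measurable fun w => P (evenPath f S h x₀ w n) := I.meas_P.comp hz
      have mQ : Measurable fun w => Q (evenPath f S h x₀ w n) := I.meas_Q.comp hz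
      have b1 := eLpNorm_inner_increment_le hh (2 * n) mP
        (fun w w' hw => by rw [evenPath_congr f S h x₀ hw]) hk (by positivity)
        (H.eLpNorm_integrand_le hS.le (I.norm_P_le hS.le) (by omega) hk)
      have b2 := eLpNorm_inner_increment_le hh (2 * n + 1) mQ
        (fun w w' hw => by
          rw [evenPath_congr f S h x₀ (w := w) (w' := w') fun i hi => hw i (by omega)])
        hk (by positivity)
        (H.eLpNorm_integrand_le (by positivity : 0 ≤ 2 * S) (I.norm_Q_le hS.le) (by omega) hk)
      set X : (ℕ → E) → ℝ := fun w => inner ℝ (P (evenPath f S h x₀ w n)) (w (2 * n))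
        + inner ℝ (Q (evenPath f S h x₀ w n)) (w (2 * n + 1)) with hX
      have m1 : Measurable fun w : ℕ → E => inner ℝ (P (evenPath f S h x₀ w n)) (w (2 * n)) :=
        mP.inner (measurable_pi_apply _)
      have m2 : Measurable fun w : ℕ → E => inner ℝ (Q (evenPath f S h x₀ w n)) (w (2 * n + 1)) :=
        mQ.inner (measurable_pi_apply _)
      have mX : Measurable X := m1.add m2
      have mA := measurable_logWeightMart S h H.meas I.meas_P I.meas_Q x₀ n
      have bX : eLpNorm X ((2 * k : ℕ) : ℝ≥0∞) (seqLaw d h) ≤ ENNReal.ofReal x := by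
        refine (eLpNorm_add_le m1.aestronglyMeasurable m2.aestronglyMeasurable h1k).trans
          ((add_le_add b1 b2).trans ?_)
        rw [← ENNReal.ofReal_add (by positivity) (by positivity)]
        refine ENNReal.ofReal_le_ofReal (le_of_eq ?_)
        rw [hx]; ring
      have e : (fun w => logWeightMart f S h P Q x₀ w (n + 1))
          = fun w => logWeightMart f S h P Q x₀ w n + X w := by
        funext w
        rw [logWeightMart, Finset.sum_range_succ]; rfl
      have hsym : eLpNorm (fun w => logWeightMart f S h P Q x₀ w n - X w)
          ((2 * k : ℕ) : ℝ≥0∞) (seqLaw d h)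
          = eLpNorm (fun w => logWeightMart f S h P Q x₀ w n + X w)
          ((2 * k : ℕ) : ℝ≥0∞) (seqLaw d h) := by
        have mp := measurePreserving_flipFrom (d := d) hh.le (2 * n)
        refine Eq.trans ?_ (eLpNorm_comp_measurePreserving (mA.add mX).aestronglyMeasurable mp)
        congr 1
        funext w
        have hw : ∀ i < 2 * n, flipFrom (2 * n) w i = w i := fun i hi => flipFrom_of_lt hi w
        simp only [Function.comp_apply, hX]
        rw [logWeightMart_congr f S h P Q x₀ hw, evenPath_congr f S h x₀ hw,
          flipFrom_of_le le_rfl, flipFrom_of_le (by omega), inner_neg_right, inner_neg_right]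
        ring
      rw [e]
      refine (eLpNorm_add_le_of_symm hk mA.aestronglyMeasurable mX.aestronglyMeasurable hsym
        (Real.sqrt_nonneg _) hx0 (ih (by omega)) bX).trans (ENNReal.ofReal_le_ofReal ?_)
      rw [Real.sq_sqrt (by positivity)]
      refine Real.sqrt_le_sqrt (le_of_eq ?_)
      push_cast; ring
  refine (main N le_rfl).trans (ENNReal.ofReal_le_ofReal ?_)
  have e1 : √(N * (symmConst k * x ^ 2)) = √(symmConst k) * (12 * M) * (√(N * h) * (S * Y)) := by
    rw [Real.sqrt_mul (by positivity), Real.sqrt_mul hsc, Real.sqrt_sq hx0,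
      Real.sqrt_mul (by positivity), hx]
    ring
  have e2 : √(N * h) ≤ √T := by
    refine Real.sqrt_le_sqrt ?_
    rw [H.T_eq]
    nlinarith [mul_nonneg (Nat.cast_nonneg N : (0 : ℝ) ≤ N) hh.le]
  rw [e1]
  calc _ ≤ √(symmConst k) * (12 * M) * (√T * (S * Y)) := by gcongr
    _ = _ := by rw [martConst, springRate, hY]; ring

/-- The quadratic part is of second order in a, the scale of the log-weight, and is bounded in every
moment by the exponential estimate. Together these give a bound linear in a without assuming a
small. -/
theorem eLpNorm_logWeightVar_le (H : Setting f L lam α β G S h T ε r κ g N x₀)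
    (I : Integrands S P Q) (hε : 100000 * ε ≤ 1) {k : ℕ} (hk : k ≠ 0) :
    eLpNorm (fun w => logWeightVar f S h P Q x₀ w N) ((2 * k : ℕ) : ℝ≥0∞) (seqLaw d h)
      ≤ ENNReal.ofReal (varConst k α β r g κ * springRate d L lam S h T) := by
  have hh := H.small.h_pos
  have hS := H.small.S_pos
  have hL := H.small.L_pos
  have hm := H.m_pos
  have hT := H.T_pos
  have hgc := H.gapConst_nonneg (2 * k)
  have hw1 := H.one_le_weightConst
  have h2k : 2 * k ≠ 0 := by omega
  have h1k : (1 : ℝ≥0∞) ≤ ((2 * k : ℕ) : ℝ≥0∞) := by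
    have : 1 ≤ 2 * k := by omega
    exact_mod_cast this
  set M : ℝ := ((2 * k).factorial : ℝ) with hM
  have hM1 : 1 ≤ M := by rw [hM]; exact_mod_cast (2 * k).factorial_pos
  set Y := gapConst (2 * k) α β r g κ * (h * L * (√d * (L + √d)) / (2 * S - lam)) with hY
  have hY0 : 0 ≤ Y := by positivity
  set a := √T * S * Y with ha
  have ha0 : 0 ≤ a := by positivity
  have hC1 : 1 ≤ M * weightConst α β r := one_le_mul_of_one_le_of_one_le hM1 hw1
  have nn : ∀ w, 0 ≤ logWeightVar f S h P Q x₀ w N := fun w =>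
    Integrands.logWeightVar_nonneg hh.le x₀ w N
  have small : eLpNorm (fun w => logWeightVar f S h P Q x₀ w N) ((2 * k : ℕ) : ℝ≥0∞) (seqLaw d h)
      ≤ ENNReal.ofReal (a ^ 2) := by
    have h1 : eLpNorm (fun w => logWeightVar f S h P Q x₀ w N) ((2 * k : ℕ) : ℝ≥0∞) (seqLaw d h)
        ≤ eLpNorm ((3 / 2 * (h * S ^ 2)) • ∑ n ∈ Finset.range N,
          fun w => ‖gap f S h x₀ w n‖ ^ 2) ((2 * k : ℕ) : ℝ≥0∞) (seqLaw d h) := by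
      refine eLpNorm_mono_real fun w => ?_
      rw [Real.norm_of_nonneg (nn w)]
      simpa using I.logWeightVar_le hh.le x₀ w N
    refine h1.trans ?_
    rw [eLpNorm_const_smul, Real.enorm_of_nonneg (by positivity)]
    have h2 : eLpNorm (∑ n ∈ Finset.range N, fun w => ‖gap f S h x₀ w n‖ ^ 2)
        ((2 * k : ℕ) : ℝ≥0∞) (seqLaw d h) ≤ ENNReal.ofReal (N * Y ^ 2) := by
      refine (eLpNorm_sum_le (fun n _ =>
        ((H.measurable_gap n).norm.pow_const 2).aestronglyMeasurable) h1k).trans ?_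
      calc _ ≤ ∑ n ∈ Finset.range N, ENNReal.ofReal (Y ^ 2) := by
            refine Finset.sum_le_sum fun n hn => ?_
            rw [eLpNorm_norm_sq _ h2k, ENNReal.ofReal_pow hY0]
            exact pow_le_pow_left₀ zero_le
              (H.eLpNorm_gap_le_uniform (Finset.mem_range.mp hn).le h2k) 2
        _ = _ := by
            rw [Finset.sum_const, Finset.card_range, nsmul_eq_mul,
              ENNReal.ofReal_mul (by positivity), ENNReal.ofReal_natCast]
    calc _ ≤ ENNReal.ofReal (3 / 2 * (h * S ^ 2)) * ENNReal.ofReal (N * Y ^ 2) := by gcongr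
      _ = ENNReal.ofReal (3 / 2 * (h * S ^ 2) * (N * Y ^ 2)) :=
          (ENNReal.ofReal_mul (by positivity)).symm
      _ ≤ _ := by
          refine ENNReal.ofReal_le_ofReal ?_
          have e : a ^ 2 = 2 * N * h * S ^ 2 * Y ^ 2 := by
            rw [ha, mul_pow (√T * S), mul_pow √T, Real.sq_sqrt hT.le, H.T_eq]
          rw [e]
          have : 0 ≤ h * S ^ 2 * (N * Y ^ 2) := by positivity
          linarith
  have bdd : eLpNorm (fun w => logWeightVar f S h P Q x₀ w N) ((2 * k : ℕ) : ℝ≥0∞) (seqLaw d h)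
      ≤ ENNReal.ofReal (M * weightConst α β r) := by
    rw [eLpNorm_nat_le_iff _ h2k (by linarith)]
    have q1 := H.lintegral_exp_sum_gap_le (q := 1) (by linarith)
    calc _ ≤ ∫⁻ w, ENNReal.ofReal M * ENNReal.ofReal (Real.exp
        (6 * 1 ^ 2 * (h * S ^ 2) * ∑ n ∈ Finset.range N, ‖gap f S h x₀ w n‖ ^ 2))
          ∂(seqLaw d h) := by
          refine lintegral_mono fun w => ?_
          rw [← ENNReal.ofReal_mul (by linarith)]
          refine ENNReal.ofReal_le_ofReal ?_
          have g0 : 0 ≤ h * S ^ 2 * ∑ n ∈ Finset.range N, ‖gap f S h x₀ w n‖ ^ 2 :=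
            mul_nonneg (by positivity) (Finset.sum_nonneg fun n _ => by positivity)
          have v1 := I.logWeightVar_le (f := f) hh.le x₀ w N
          have p1 := Real.pow_div_factorial_le_exp _ (nn w) (2 * k)
          rw [div_le_iff₀ (by positivity)] at p1
          rw [Real.norm_of_nonneg (nn w)]
          refine p1.trans ?_
          rw [mul_comm]
          gcongr
          linarith
      _ = ENNReal.ofReal M * ∫⁻ w, ENNReal.ofReal (Real.exp
        (6 * 1 ^ 2 * (h * S ^ 2) * ∑ n ∈ Finset.range N, ‖gap f S h x₀ w n‖ ^ 2))
          ∂(seqLaw d h) := lintegral_const_mul' _ _ ENNReal.ofReal_ne_top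
      _ ≤ ENNReal.ofReal M * ENNReal.ofReal (weightConst α β r) := by
          gcongr
          exact q1
      _ = ENNReal.ofReal (M * weightConst α β r) := (ENNReal.ofReal_mul (by linarith)).symm
      _ ≤ _ := ENNReal.ofReal_le_ofReal (le_self_pow₀ hC1 h2k)
  have e : varConst k α β r g κ * springRate d L lam S h T = M * weightConst α β r * a := by
    rw [varConst, springRate, ha, hY]; ring
  rw [e]
  -- For a ≤ 1 use a² ≤ a; for a ≥ 1 the constant bound is at most a times itself.
  rcases le_total a 1 with h1 | h1
  · refine small.trans (ENNReal.ofReal_le_ofReal ?_)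
    nlinarith
  · exact bdd.trans (ENNReal.ofReal_le_ofReal (le_mul_of_one_le_right (by linarith) h1))

/-- Moments of the log-weights. -/
theorem eLpNorm_logWeight_le (H : Setting f L lam α β G S h T ε r κ g N x₀)
    (I : Integrands S P Q) (hε : 100000 * ε ≤ 1) {k : ℕ} (hk : k ≠ 0) :
    eLpNorm (fun w => logWeight f S h P Q x₀ w N) ((2 * k : ℕ) : ℝ≥0∞) (seqLaw d h)
      ≤ ENNReal.ofReal ((martConst k α β r g κ + varConst k α β r g κ)
        * springRate d L lam S h T) := by
  have hgc := H.gapConst_nonneg k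
  have hgc' := H.gapConst_nonneg (2 * k)
  have hw := H.one_le_weightConst
  have hs := H.springRate_nonneg
  have h1k : (1 : ℝ≥0∞) ≤ ((2 * k : ℕ) : ℝ≥0∞) := by
    have : 1 ≤ 2 * k := by omega
    exact_mod_cast this
  have c1 : 0 ≤ martConst k α β r g κ := by unfold martConst; positivity
  have c2 : 0 ≤ varConst k α β r g κ := by unfold varConst; positivity
  simp only [logWeight_eq_sub]
  refine (eLpNorm_sub_le
    (measurable_logWeightMart S h H.meas I.meas_P I.meas_Q x₀ N).aestronglyMeasurable
    (measurable_logWeightVar S h H.meas I.meas_P I.meas_Q x₀ N).aestronglyMeasurable h1k).trans ?_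
  rw [add_mul, ENNReal.ofReal_add (by positivity) (by positivity)]
  exact add_le_add (H.eLpNorm_logWeightMart_le I hk) (H.eLpNorm_logWeightVar_le I hε hk)

end Setting

end

/-! ### The level difference for a deterministic initial value -/

theorem eLpNorm_mul_le_two_mul {Ω : Type*} [MeasurableSpace Ω] {μ : Measure Ω} {X Y : Ω → ℝ}
    (hX : AEStronglyMeasurable X μ) (hY : AEStronglyMeasurable Y μ) (m : ℕ) :
    eLpNorm (fun ω => X ω * Y ω) (m : ℝ≥0∞) μ
      ≤ eLpNorm X ((2 * m : ℕ) : ℝ≥0∞) μ * eLpNorm Y ((2 * m : ℕ) : ℝ≥0∞) μ := by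
  have T : ENNReal.HolderTriple ((2 * m : ℕ) : ℝ≥0∞) ((2 * m : ℕ) : ℝ≥0∞) (m : ℝ≥0∞) := by
    constructor
    rw [Nat.cast_mul, ENNReal.mul_inv (by simp) (by simp), ← add_mul, Nat.cast_ofNat,
      ENNReal.inv_two_add_inv_two, one_mul]
  have := eLpNorm_smul_le_mul_eLpNorm (hpqr := T) hY hX
  rw [smul_eq_mul] at this
  exact this

theorem abs_exp_sub_exp_le (x y : ℝ) :
    |Real.exp x - Real.exp y| ≤ |x - y| * (Real.exp x + Real.exp y) := by
  wlog hxy : y ≤ x generalizing x y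
  · rw [abs_sub_comm, abs_sub_comm x, add_comm]
    exact this y x (le_of_not_ge hxy)
  rw [abs_of_nonneg (sub_nonneg.mpr (Real.exp_le_exp.mpr hxy)), abs_of_nonneg (sub_nonneg.mpr hxy)]
  -- The tangent bound e^(y−x) ≥ 1 + y − x gives eˣ − eʸ ≤ (x − y)eˣ.
  have h1 : Real.exp y = Real.exp x * Real.exp (y - x) := by rw [← Real.exp_add]; congr 1; ring
  have h2 := Real.add_one_le_exp (y - x)
  have h3 := mul_le_mul_of_nonneg_left h2 (Real.exp_pos x).le
  have h4 : 0 ≤ (x - y) * Real.exp y := mul_nonneg (sub_nonneg.mpr hxy) (Real.exp_pos y).le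
  linarith

noncomputable section

variable {d : ℕ}

local notation "E" => EuclideanSpace ℝ (Fin d)

/-- Constant in the moment bound of the level difference. -/
def levelConst (k : ℕ) (K b α β r g κ : ℝ) : ℝ :=
  K * gapConst (2 * k) α β r g κ * weightConst α β r
    + (b + K * pathConst (2 * k) α β r)
      * (2 * (martConst (4 * k) α β r g κ + varConst (4 * k) α β r g κ)
        * (2 * weightConst α β r))

namespace Setting

variable {f φ : EuclideanSpace ℝ (Fin d) → ℝ} {L lam α β G S h T ε r κ g b : ℝ} {N : ℕ}
  {x₀ : EuclideanSpace ℝ (Fin d)} {K : ℝ≥0}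

theorem abs_levelDifference_le (hh : 0 < h) (hφ : LipschitzWith K φ) (hb : |φ 0| ≤ b) (x₀ : E)
    (w : ℕ → E) :
    |levelDifference f φ S h x₀ w N|
      ≤ K * ‖gap f S h x₀ w N‖ * Real.exp (logWeight f S h (fineP S) (fineQ f S h) x₀ w N)
        + (b + K * ‖(evenPath f S h x₀ w N).2‖)
          * (|logWeight f S h (fineP S) (fineQ f S h) x₀ w N
              - logWeight f S h (coarseP S) (coarseP S) x₀ w N|
            * (Real.exp (logWeight f S h (fineP S) (fineQ f S h) x₀ w N)
              + Real.exp (logWeight f S h (coarseP S) (coarseP S) x₀ w N))) := by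
  rw [levelDifference_eq hh]
  unfold gap
  set a := (evenPath f S h x₀ w N).1
  set c := (evenPath f S h x₀ w N).2
  set x := logWeight f S h (fineP S) (fineQ f S h) x₀ w N
  set y := logWeight f S h (coarseP S) (coarseP S) x₀ w N
  have h1 : |φ a - φ c| ≤ K * ‖a - c‖ := by simpa [Real.dist_eq, dist_eq_norm] using hφ.dist_le_mul a c
  have h2 : |φ c| ≤ b + K * ‖c‖ := by
    have h3 : |φ c - φ 0| ≤ K * ‖c‖ := by simpa [Real.dist_eq] using hφ.dist_le_mul c 0
    have h4 := abs_add_le (φ c - φ 0) (φ 0)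
    rw [sub_add_cancel] at h4
    linarith
  calc |φ a * Real.exp x - φ c * Real.exp y|
      = |(φ a - φ c) * Real.exp x + φ c * (Real.exp x - Real.exp y)| := by congr 1; ring
    _ ≤ |φ a - φ c| * Real.exp x + |φ c| * |Real.exp x - Real.exp y| := by
        refine (abs_add_le _ _).trans (le_of_eq ?_)
        rw [abs_mul, abs_mul, Real.abs_exp]
    _ ≤ _ := by
        gcongr
        · exact (abs_nonneg _).trans h2
        · exact abs_exp_sub_exp_le x y

theorem targetRate_nonneg (H : Setting f L lam α β G S h T ε r κ g N x₀) :
    0 ≤ targetRate d L lam S h T := by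
  rw [← sqrt_mul_springRate]
  exact mul_nonneg (Real.sqrt_nonneg _) H.springRate_nonneg

/-- Hölder's inequality is used with exponents 4k, and once more with 8k for the difference of the
log-weights times the sum of the weights. The growth of φ along the coarse path contributes the
missing √d between `springRate` and `targetRate`. -/
theorem eLpNorm_levelDifference_le (H : Setting f L lam α β G S h T ε r κ g N x₀)
    (hφ : LipschitzWith K φ) (hb : |φ 0| ≤ b) {k : ℕ} (hk : k ≠ 0)
    (hε : 100000 * (8 * k : ℝ) ^ 2 * ε ≤ 1) :
    eLpNorm (fun w => levelDifference f φ S h x₀ w N) ((2 * k : ℕ) : ℝ≥0∞) (seqLaw d h)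
      ≤ ENNReal.ofReal (levelConst k K b α β r g κ * targetRate d L lam S h T) := by
  have hh := H.small.h_pos
  have hε0 := H.ε_nonneg
  have hb0 : 0 ≤ b := (abs_nonneg _).trans hb
  have hk1 : (1 : ℝ) ≤ k := by exact_mod_cast Nat.one_le_iff_ne_zero.mpr hk
  have hεk : 0 ≤ ((k : ℝ) ^ 2 - 1) * ε := mul_nonneg (by nlinarith) hε0
  have hε1 : 100000 * ε ≤ 1 := by linarith
  have h2k : 2 * k ≠ 0 := by omega
  have h4k : 4 * k ≠ 0 := by omega
  have If := H.integrands_fine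
  have Ic := integrands_coarse (d := d) S
  have hW := H.one_le_weightConst
  have hpc := pathConst_nonneg (2 * k) α β r
  have hsr := H.springRate_nonneg
  have htr := H.targetRate_nonneg
  have hgc := H.gapConst_nonneg (2 * k)
  have hsd := H.one_le_sqrt_d
  set C := martConst (4 * k) α β r g κ + varConst (4 * k) α β r g κ with hC
  have hC0 : 0 ≤ C := by
    have := H.gapConst_nonneg (4 * k)
    have := H.gapConst_nonneg (2 * (4 * k))
    rw [hC]; unfold martConst varConst; positivity
  have one_le : ∀ m : ℕ, m ≠ 0 → (1 : ℝ≥0∞) ≤ (m : ℝ≥0∞) := fun m hm => by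
    exact_mod_cast Nat.one_le_iff_ne_zero.mpr hm
  set x : (ℕ → E) → ℝ := fun w => logWeight f S h (fineP S) (fineQ f S h) x₀ w N with hx
  set y : (ℕ → E) → ℝ := fun w => logWeight f S h (coarseP S) (coarseP S) x₀ w N with hy
  set A : (ℕ → E) → ℝ := fun w => K * ‖gap f S h x₀ w N‖ with hA
  set B : (ℕ → E) → ℝ := fun w => b + K * ‖(evenPath f S h x₀ w N).2‖ with hB
  set D : (ℕ → E) → ℝ := fun w => |x w - y w| with hD
  set F : (ℕ → E) → ℝ := fun w => Real.exp (x w) + Real.exp (y w) with hF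
  have mx : Measurable x := measurable_logWeight_right S h H.meas If.meas_P If.meas_Q x₀ N
  have my : Measurable y := measurable_logWeight_right S h H.meas Ic.meas_P Ic.meas_Q x₀ N
  have mA : Measurable A := (H.measurable_gap N).norm.const_mul _
  have mB : Measurable B :=
    ((measurable_evenPath_right S h H.meas x₀ N).snd.norm.const_mul _).const_add _
  have mD : Measurable D := (mx.sub my).norm
  have mF : Measurable F := mx.exp.add my.exp
  have bA : eLpNorm A ((2 * (2 * k) : ℕ) : ℝ≥0∞) (seqLaw d h)
      ≤ ENNReal.ofReal (K * (gapConst (2 * k) α β r g κ * targetRate d L lam S h T)) := by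
    refine (eLpNorm_const_smul (K : ℝ) (fun w => ‖gap f S h x₀ w N‖) _ _).le.trans ?_
    rw [eLpNorm_norm, ENNReal.ofReal_mul K.coe_nonneg, Real.enorm_of_nonneg K.coe_nonneg]
    gcongr
    exact H.eLpNorm_gap_le_terminal h2k
  have bB : eLpNorm B ((2 * (2 * k) : ℕ) : ℝ≥0∞) (seqLaw d h)
      ≤ ENNReal.ofReal ((b + K * pathConst (2 * k) α β r) * √d) := by
    refine (eLpNorm_add_le (f := fun _ => b) (g := fun w => K * ‖(evenPath f S h x₀ w N).2‖)
      aestronglyMeasurable_const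
      ((measurable_evenPath_right S h H.meas x₀ N).snd.norm.const_mul _).aestronglyMeasurable
      (one_le _ (by omega))).trans ?_
    have c1 : eLpNorm (fun _ : ℕ → E => b) ((2 * (2 * k) : ℕ) : ℝ≥0∞) (seqLaw d h)
        ≤ ENNReal.ofReal (b * √d) := by
      rw [eLpNorm_const _ (by exact_mod_cast (by omega : 2 * (2 * k) ≠ 0)) (NeZero.ne _)]
      simp only [measure_univ, ENNReal.one_rpow, mul_one, Real.enorm_of_nonneg hb0]
      exact ENNReal.ofReal_le_ofReal (le_mul_of_one_le_right hb0 hsd)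
    have c2 : eLpNorm (fun w => K * ‖(evenPath f S h x₀ w N).2‖) ((2 * (2 * k) : ℕ) : ℝ≥0∞)
        (seqLaw d h) ≤ ENNReal.ofReal (K * (pathConst (2 * k) α β r * √d)) := by
      refine (eLpNorm_const_smul (K : ℝ) (fun w => ‖(evenPath f S h x₀ w N).2‖) _ _).le.trans ?_
      rw [eLpNorm_norm, ENNReal.ofReal_mul K.coe_nonneg, Real.enorm_of_nonneg K.coe_nonneg]
      gcongr
      exact (H.eLpNorm_path_le N h2k).2
    rw [add_mul, mul_assoc, ENNReal.ofReal_add (by positivity) (by positivity)]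
    exact add_le_add c1 c2
  have bD : eLpNorm D ((2 * (4 * k) : ℕ) : ℝ≥0∞) (seqLaw d h)
      ≤ ENNReal.ofReal (2 * C * springRate d L lam S h T) := by
    refine (eLpNorm_norm (fun w => x w - y w)).le.trans ((eLpNorm_sub_le mx.aestronglyMeasurable
      my.aestronglyMeasurable (one_le _ (by omega))).trans ?_)
    refine (add_le_add (H.eLpNorm_logWeight_le If hε1 h4k)
      (H.eLpNorm_logWeight_le Ic hε1 h4k)).trans (le_of_eq ?_)
    rw [← ENNReal.ofReal_add (by positivity) (by positivity)]
    congr 1; ring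
  have bF : eLpNorm F ((2 * (4 * k) : ℕ) : ℝ≥0∞) (seqLaw d h)
      ≤ ENNReal.ofReal (2 * weightConst α β r) := by
    have hε8 : 100000 * ((2 * (4 * k) : ℕ) : ℝ) ^ 2 * ε ≤ 1 := by push_cast; linarith
    refine (eLpNorm_add_le mx.exp.aestronglyMeasurable my.exp.aestronglyMeasurable
      (one_le _ (by omega))).trans ?_
    refine (add_le_add (H.eLpNorm_exp_logWeight_le If (by omega) hε8)
      (H.eLpNorm_exp_logWeight_le Ic (by omega) hε8)).trans (le_of_eq ?_)
    rw [← ENNReal.ofReal_add (by positivity) (by positivity), two_mul]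
  have bX : eLpNorm (fun w => Real.exp (x w)) ((2 * (2 * k) : ℕ) : ℝ≥0∞) (seqLaw d h)
      ≤ ENNReal.ofReal (weightConst α β r) := by
    refine H.eLpNorm_exp_logWeight_le If (by omega) ?_
    push_cast
    nlinarith [mul_nonneg (sq_nonneg (k : ℝ)) hε0]
  have bDF : eLpNorm (fun w => D w * F w) ((2 * (2 * k) : ℕ) : ℝ≥0∞) (seqLaw d h)
      ≤ ENNReal.ofReal (2 * C * springRate d L lam S h T * (2 * weightConst α β r)) := by
    rw [ENNReal.ofReal_mul (by positivity)]
    have e : 2 * (2 * k) = 4 * k := by ring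
    rw [e]
    exact (eLpNorm_mul_le_two_mul mD.aestronglyMeasurable mF.aestronglyMeasurable _).trans
      (mul_le_mul' bD bF)
  have t1 : eLpNorm (fun w => A w * Real.exp (x w)) ((2 * k : ℕ) : ℝ≥0∞) (seqLaw d h)
      ≤ ENNReal.ofReal (K * (gapConst (2 * k) α β r g κ * targetRate d L lam S h T)
        * weightConst α β r) := by
    rw [ENNReal.ofReal_mul (by positivity)]
    exact (eLpNorm_mul_le_two_mul mA.aestronglyMeasurable mx.exp.aestronglyMeasurable _).trans
      (mul_le_mul' bA bX)
  have t2 : eLpNorm (fun w => B w * (D w * F w)) ((2 * k : ℕ) : ℝ≥0∞) (seqLaw d h)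
      ≤ ENNReal.ofReal ((b + K * pathConst (2 * k) α β r) * √d
        * (2 * C * springRate d L lam S h T * (2 * weightConst α β r))) := by
    rw [ENNReal.ofReal_mul (by positivity)]
    exact (eLpNorm_mul_le_two_mul mB.aestronglyMeasurable
      (mD.mul mF).aestronglyMeasurable _).trans (mul_le_mul' bB bDF)
  calc _ ≤ eLpNorm ((fun w => A w * Real.exp (x w)) + fun w => B w * (D w * F w))
        ((2 * k : ℕ) : ℝ≥0∞) (seqLaw d h) :=
        eLpNorm_mono_real fun w => abs_levelDifference_le hh hφ hb x₀ w
    _ ≤ _ := (eLpNorm_add_le (mA.mul mx.exp).aestronglyMeasurable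
        (mB.mul (mD.mul mF)).aestronglyMeasurable (one_le _ h2k)).trans (add_le_add t1 t2)
    _ = _ := by
        rw [← ENNReal.ofReal_add (by positivity) (by positivity), levelConst, ← hC,
          ← sqrt_mul_springRate]
        congr 1; ring

end Setting

end

/-! ### Random initial values -/

section

variable {d : ℕ}

local notation "E" => EuclideanSpace ℝ (Fin d)

theorem measurable_levelDifference {f φ : E → ℝ} {S h : ℝ} (hh : 0 < h) (hf : Measurable (∇ f))
    (hφ : Measurable φ) (N : ℕ) :
    Measurable fun q : E × (ℕ → E) => levelDifference f φ S h q.1 q.2 N := by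
  have mP : Measurable (fineP (d := d) S) := by unfold fineP; fun_prop
  have mQ : Measurable (fineQ f S h) := by unfold fineQ midGap; fun_prop
  have mC : Measurable (coarseP (d := d) S) := by unfold coarseP; fun_prop
  have hz := measurable_evenPath S h hf N
  have e : (fun q : E × (ℕ → E) => levelDifference f φ S h q.1 q.2 N) = _ :=
    funext fun q => levelDifference_eq (f := f) (φ := φ) (S := S) hh q.1 q.2 N
  rw [e]
  exact ((hφ.comp hz.fst).mul (measurable_logWeight S h hf mP mQ N).exp).sub
    ((hφ.comp hz.snd).mul (measurable_logWeight S h hf mC mC N).exp)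

/-- Joint law of the initial value and the increments. -/
theorem BrownianIncrements.map_prod_eq {Ω : Type*} [MeasurableSpace Ω] {P : Measure Ω}
    [IsProbabilityMeasure P] {h : ℝ} {X₀ : Ω → E} {ΔW : ℕ → Ω → E}
    (hX : AEMeasurable X₀ P) (hW : BrownianIncrements P h X₀ ΔW) :
    AEMeasurable (fun ω => (X₀ ω, fun n => ΔW n ω)) P ∧
    P.map (fun ω => (X₀ ω, fun n => ΔW n ω)) = (P.map X₀).prod (seqLaw d h) := by
  have hm : AEMeasurable (fun ω n => ΔW n ω) P :=
    aemeasurable_pi_lambda _ fun n => (hW.law n).aemeasurable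
  have hlaw := iIndepFun.hasLaw_infinitePi hW.law hW.indep hm
  refine ⟨hX.prodMk hm, ?_⟩
  rw [(indepFun_iff_map_prod_eq_prod_map_map hX hm).mp hW.indep_init, hlaw.map_eq]
  rfl

/-- A moment bound that is uniform in the initial value holds for random initial values. -/
theorem BrownianIncrements.eLpNorm_le {Ω : Type*} [MeasurableSpace Ω] {P : Measure Ω}
    [IsProbabilityMeasure P] {h r A : ℝ} {X₀ : Ω → E} {ΔW : ℕ → Ω → E}
    (hX : AEMeasurable X₀ P) (hr : ∀ᵐ ω ∂P, ‖X₀ ω‖ ≤ r) (hW : BrownianIncrements P h X₀ ΔW)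
    {D : E → (ℕ → E) → ℝ} (hD : Measurable fun q : E × (ℕ → E) => D q.1 q.2) {k : ℕ} (hk : k ≠ 0)
    (hA : 0 ≤ A)
    (hb : ∀ x, ‖x‖ ≤ r → eLpNorm (D x) (k : ℝ≥0∞) (seqLaw d h) ≤ ENNReal.ofReal A) :
    eLpNorm (fun ω => D (X₀ ω) fun n => ΔW n ω) (k : ℝ≥0∞) P ≤ ENNReal.ofReal A := by
  obtain ⟨hm, hmap⟩ := hW.map_prod_eq hX
  rw [eLpNorm_nat_le_iff _ hk hA]
  have mF : Measurable fun q : E × (ℕ → E) => ENNReal.ofReal (‖D q.1 q.2‖ ^ k) :=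
    (hD.norm.pow_const k).ennreal_ofReal
  have hr' : ∀ᵐ x ∂(P.map X₀), ‖x‖ ≤ r :=
    (ae_map_iff hX (measurableSet_le measurable_norm measurable_const)).mpr hr
  have : IsProbabilityMeasure (P.map X₀) := Measure.isProbabilityMeasure_map hX
  calc _ = ∫⁻ q, ENNReal.ofReal (‖D q.1 q.2‖ ^ k) ∂(P.map fun ω => (X₀ ω, fun n => ΔW n ω)) :=
        (lintegral_map' mF.aemeasurable hm).symm
    _ = ∫⁻ x, ∫⁻ w, ENNReal.ofReal (‖D x w‖ ^ k) ∂(seqLaw d h) ∂(P.map X₀) := by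
        rw [hmap, lintegral_prod _ mF.aemeasurable]
    _ ≤ ∫⁻ _, ENNReal.ofReal (A ^ k) ∂(P.map X₀) := by
        refine lintegral_mono_ae ?_
        filter_upwards [hr'] with x hx
        exact (eLpNorm_nat_le_iff _ hk hA).mp (hb x hx)
    _ = _ := by simp

/-- Clearing denominators turns the entries of the minimum into the polynomial inequalities of
`Setting`, with ε = C. -/
theorem StepAdmissible.setting {f : E → ℝ} {C S lam L α β T h r κ g : ℝ} {N : ℕ} {x₀ : E}
    (hd : 1 ≤ d) (hC : 0 ≤ C) (hC1 : C ≤ 1 / 1000) (hL : 0 < L) (h1 : LSmooth f L)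
    (h2 : LHessianSmooth f L) (hlam : 0 ≤ lam) (h3 : WeakOneSidedLipschitz f lam) (hα : 0 < α)
    (hβ : 0 ≤ β) (h4 : Dissipative f α β) (hg : ‖∇ f 0‖ ≤ g) (hlS : lam / 2 < S) (hκ : 0 < κ)
    (hκS : 1 / κ ≤ S) (hSκ : S ≤ κ * (L + √d) ^ 2) (hT : 0 < T) (hh : 0 < h)
    (hTN : T = 2 * N * h) (hx₀ : ‖x₀‖ ≤ r) (hst : StepAdmissible C S lam L α ‖∇ f 0‖ T d h) :
    Setting f L lam α β ‖∇ f 0‖ S h T C r κ g N x₀ := by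
  have hdrift := driftBounds_gradient h1 h2 h3 h4
  have hS : 0 < S := by linarith
  have hd0 : (0 : ℝ) < d := by exact_mod_cast hd
  have : Nonempty (Fin d) := ⟨⟨0, hd⟩⟩
  obtain ⟨s1, s2, s3, -, s5, s6, -⟩ := hst
  rw [← mul_div_assoc, le_div_iff₀ (by positivity)] at s1 s2 s3 s6
  have hcont : Continuous (∇ f) := by
    refine (LipschitzWith.of_dist_le_mul (K := L.toNNReal) fun x y => ?_).continuous
    rw [dist_eq_norm, dist_eq_norm, Real.coe_toNNReal _ hL.le]
    exact h1.2 x y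
  exact
    { drift := hdrift
      meas := hcont.measurable
      small :=
        { h_pos := hh
          S_pos := hS
          L_pos := hL
          α_pos := hα
          G_nonneg := norm_nonneg _
          α_le := hdrift.α_le
          hS := by linarith
          hS2 := s2
          hL2 := s3
          hG2 := s5.trans (mul_le_of_le_one_right hC (min_le_left _ _)) }
      ε_nonneg := hC
      ε_le := hC1
      one_le_d := hd
      β_nonneg := hβ
      lam_nonneg := hlam
      lam_lt := by linarith
      T_pos := hT
      T_eq := hTN
      time := by linarith
      init := hx₀
      κ_pos := hκ
      S_ge := hκS
      S_le := hSκ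
      G_le := hg }

end

theorem mainTheorem7 (p : ℝ) (hp : 1 ≤ p) :
    ∃ C₅ : ℝ, 0 < C₅ ∧
    ∀ (K : ℝ≥0) (b r g α β κ : ℝ), 0 < α → 0 < β → 0 < κ →
    ∃ M : ℝ, 0 < M ∧
    ∀ (d : ℕ), 1 ≤ d →
    ∀ (f φ : EuclideanSpace ℝ (Fin d) → ℝ) (L lam S : ℝ),
      0 < L → LSmooth f L → LHessianSmooth f L →
      0 ≤ lam → WeakOneSidedLipschitz f lam →
      Dissipative f α β → ‖∇ f 0‖ ≤ g →
      LipschitzWith K φ → |φ 0| ≤ b →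
      lam / 2 < S → 1 / κ ≤ S → S ≤ κ * (L + √d) ^ 2 →
    ∀ (Ω : Type*) [MeasurableSpace Ω] (P : Measure Ω) [IsProbabilityMeasure P]
      (X₀ : Ω → EuclideanSpace ℝ (Fin d)) (ΔW : ℕ → Ω → EuclideanSpace ℝ (Fin d))
      (T h : ℝ) (N : ℕ),
      AEMeasurable X₀ P → (∀ᵐ ω ∂P, ‖X₀ ω‖ ≤ r) → BrownianIncrements P h X₀ ΔW →
      0 < T → 0 < h → T = 2 * N * h →
      StepAdmissible C₅ S lam L α ‖∇ f 0‖ T d h →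
      eLpNorm (fun ω => levelDifference f φ S h (X₀ ω) (fun n => ΔW n ω) N) (ENNReal.ofReal p) P
        ≤ ENNReal.ofReal (M * (√T * (S * L * d * (L + √d) / (2 * S - lam)) * h)) := by
  set k := ⌈p⌉₊ with hkdef
  have hpk : p ≤ k := Nat.le_ceil p
  have hk1 : (1 : ℝ) ≤ k := hp.trans hpk
  have hk : k ≠ 0 := by
    rintro h0
    rw [h0] at hk1
    norm_num at hk1
  -- The weights are needed in L^(8k), and the moment of order q requires 100000 q² ε ≤ 1.
  set C : ℝ := 1 / (100000 * (8 * k) ^ 2) with hC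
  have hC0 : 0 < C := by positivity
  have hCk : 100000 * (8 * k : ℝ) ^ 2 * C ≤ 1 := by rw [hC, mul_one_div_cancel (by positivity)]
  have hC1 : C ≤ 1 / 1000 := by
    rw [hC]
    refine one_div_le_one_div_of_le (by norm_num) ?_
    nlinarith
  refine ⟨C, hC0, fun K b r g α β κ hα hβ hκ =>
    -- The maximum with 1 ensures positivity, since M is chosen before anything is known about the
    -- signs of b, r and g.
    ⟨max 1 (levelConst k K b α β r g κ), lt_max_of_lt_left one_pos, ?_⟩⟩
  intro d hd f φ L lam S hL h1 h2 hlam h3 h4 hg hφ hb hlS hκS hSκ Ω _ P _ X₀ ΔW T h N hX hr hW hT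
    hh hTN hst
  have hset : ∀ x : EuclideanSpace ℝ (Fin d), ‖x‖ ≤ r →
      Setting f L lam α β ‖∇ f 0‖ S h T C r κ g N x := fun x hx =>
    hst.setting hd hC0.le hC1 hL h1 h2 hlam h3 hα hβ.le h4 hg hlS hκ hκS hSκ hT hh hTN hx
  -- One admissible initial value suffices for the conclusions that do not depend on it, such as the
  -- sign of the rate.
  obtain ⟨ω, hω⟩ := hr.exists
  have H := hset _ hω
  have hrate := H.targetRate_nonneg
  have hmeas := measurable_levelDifference (S := S) hh H.meas hφ.continuous.measurable N
  have hm := (hmeas.comp_aemeasurable (hW.map_prod_eq hX).1).aestronglyMeasurable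
  have hexp : ENNReal.ofReal p ≤ ((2 * k : ℕ) : ℝ≥0∞) := by
    rw [← ENNReal.ofReal_natCast]
    refine ENNReal.ofReal_le_ofReal (hpk.trans ?_)
    push_cast
    linarith
  set M := max 1 (levelConst k K b α β r g κ) with hM
  have hM0 : 0 ≤ M := zero_le_one.trans (le_max_left _ _)
  have hbound := hW.eLpNorm_le hX hr (D := fun x w => levelDifference f φ S h x w N) hmeas
    (k := 2 * k) (by omega) (mul_nonneg hM0 hrate) fun x hx =>
      ((hset x hx).eLpNorm_levelDifference_le hφ hb hk hCk).trans
        (ENNReal.ofReal_le_ofReal (mul_le_mul_of_nonneg_right (le_max_right _ _) hrate))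
  rw [targetRate] at hbound
  exact (eLpNorm_le_eLpNorm_of_exponent_le hexp hm).trans hbound
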